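/- Let $\gamma\in(1,\tfrac43)$. For $\rho>0$ set $$G(y;\rho,\omega)=\gamma\rho^{\gamma-1}-y^2\omega^2,\qquad h(\rho,\omega)=2\omega^2+(\gamma-1)\omega-\frac{4\pi\rho\omega}{4-3\gamma}+(\gamma-1)(2-\gamma),$$ and consider the self-similar Euler--Poisson system for $(\rho(y),\omega(y))$, $y>0$, $$\rho'=\frac{y\rho\,h(\rho,\omega)}{G(y;\rho,\omega)},\qquad \omega'=\frac{4-3\gamma-3\omega}{y}-\frac{y\omega\,h(\rho,\omega)}{G(y;\rho,\omega)}.\tag{1}$$ Let $$y_F=\frac{3}{4-3\gamma}\sqrt{\frac{\gamma}{(6\pi)^{\gamma-1}}},\qquad y_f=\frac{\sqrt\gamma}{2-\gamma}\Big(\frac{4-3\gamma}{2\pi}\Big)^{\frac{\gamma-1}{2}},$$ so that $0<y_f<y_F$. The far-field solution of (1) is $$\rho_f(y)=\Big(\frac{\gamma(4-3\gamma)}{2\pi(2-\gamma)^2}\Big)^{\frac1{2-\gamma}}y^{-\frac{2}{2-\gamma}},\qquad \omega_f(y)=2-\gamma,$$ and the Friedman solution has the constant velocity $\omega_F=\frac{4-3\gamma}{3}$.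 For $y_*\in[y_f,y_F]$, a pair $(\rho,\omega)$ is of Larson--Penston--Hunter (LPH) type at $y_*$ if $\rho,\omega$ are real analytic at $y_*$, the values $\rho_0=\rho(y_*)>0$ and $\omega_0=\omega(y_*)$ satisfy $G(y_*;\rho_0,\omega_0)=0=h(\rho_0,\omega_0)$, the first derivatives are $\rho'(y_*)=\rho_0R_1/y_*$ and $\omega'(y_*)=W_1/y_*$, where $$R_1=\frac{(9-7\gamma)\omega_0^2-8\omega_0^3-\sqrt{\omega_0^3s(\omega_0)}}{2\omega_0^3(\gamma+1)},\qquad W_1=4-3\gamma-3\omega_0-\omega_0R_1,$$ $$s(\omega)=-4(4-3\gamma)(\gamma+1)(\gamma-1)(2-\gamma)+\big(-12(\gamma-1)(\gamma^2-5\gamma+5)+\gamma^2+6\gamma-3\big)\omega-8(3\gamma^2-15\gamma+14)\omega^2+8(5-3\gamma)\omega^3,$$ and (1), multiplied by $G$, holds near $y_*$ (this determines all further Taylor coefficients recursively). We write $(\rho(\cdot;y_*),\omega(\cdot;y_*))$ for the LPH-type solution at $y_*$ and its extension as a solution of (1). Let $$s(y_*)=\inf\{a\in(0,y_*) : (\rho(\cdot;y_*),\omega(\cdot;y_*))\text{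 extends to }(a,y_*]\text{ as a solution of (1) with } G>0\text{ on }(a,y_*)\},$$ $$\mathcal Y=\{y_*\in[y_f,y_F) : \text{there exists } y\in(s(y_*),y_*)\text{ with }\omega(y;y_*)=\tfrac{4-3\gamma}{3}\},$$ $$Y=\{y_*\in[y_f,y_F) : [y_*,y_F)\subset\mathcal Y\},\qquad \bar y_*=\inf Y .$$ Then $Y$ is non-empty and the critical sonic point $\bar y_*$ is not equal to $y_f$. In particular, the global solution $(\rho(\cdot;\bar y_*),\omega(\cdot;\bar y_*))$ is not the far-field solution: any solution on $(0,\infty)$ that extends the LPH-type solution at $\bar y_*$ and is subsonic ($G>0$) on $(0,\bar y_*)$ and supersonic ($G<0$) on $(\bar y_*,\infty)$ differs from $(\rho_f,\omega_f)$. -/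

import Mathlib

open Set Filter Topology

noncomputable section

namespace EulerPoisson

/-- The sonic function `G(y; ρ, ω) = γ ρ^(γ-1) - y² ω²`. -/
def G (γ y r w : ℝ) : ℝ := γ * r ^ (γ - 1) - y ^ 2 * w ^ 2

/-- `h(ρ, ω) = 2ω² + (γ-1)ω - 4πρω/(4-3γ) + (γ-1)(2-γ)`. -/
def h (γ r w : ℝ) : ℝ :=
  2 * w ^ 2 + (γ - 1) * w - 4 * Real.pi * r * w / (4 - 3 * γ) + (γ - 1) * (2 - γ)

/-- The self-similar Euler-Poisson system holds at the point `y` (used only where `G ≠ 0`). -/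
def SolvesAt (γ : ℝ) (ρ ω : ℝ → ℝ) (y : ℝ) : Prop :=
  HasDerivAt ρ (y * ρ y * h γ (ρ y) (ω y) / G γ y (ρ y) (ω y)) y ∧
  HasDerivAt ω ((4 - 3 * γ - 3 * ω y) / y
    - y * ω y * h γ (ρ y) (ω y) / G γ y (ρ y) (ω y)) y

/-- The same system multiplied by `G`, which makes sense at a sonic point as well. -/
def SolvesMulAt (γ : ℝ) (ρ ω : ℝ → ℝ) (y : ℝ) : Prop :=
  G γ y (ρ y) (ω y) * deriv ρ y = y * ρ y * h γ (ρ y) (ω y) ∧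
  G γ y (ρ y) (ω y) * deriv ω y =
    (4 - 3 * γ - 3 * ω y) / y * G γ y (ρ y) (ω y) - y * ω y * h γ (ρ y) (ω y)

/-- The velocity of the Friedman solution. -/
def omegaF (γ : ℝ) : ℝ := (4 - 3 * γ) / 3

/-- The density `k y^(-2/(2-γ))` of the far-field solution. -/
def rhoFar (γ y : ℝ) : ℝ :=
  (γ * (4 - 3 * γ) / (2 * Real.pi * (2 - γ) ^ 2)) ^ (1 / (2 - γ)) * y ^ (-(2 / (2 - γ)))

/-- The (constant) velocity of the far-field solution. -/
def omegaFar (γ _y : ℝ) : ℝ := 2 - γ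

/-- The sonic point of the Friedman solution. -/
def yF (γ : ℝ) : ℝ := 3 / (4 - 3 * γ) * Real.sqrt (γ / (6 * Real.pi) ^ (γ - 1))

/-- The sonic point of the far-field solution. -/
def yf (γ : ℝ) : ℝ :=
  Real.sqrt γ / (2 - γ) * ((4 - 3 * γ) / (2 * Real.pi)) ^ ((γ - 1) / 2)

/-- The cubic for which `ω³ s(ω)` is the discriminant, up to the factor `ω²`, of the quadratic
equation for the rescaled first Taylor coefficient of the density at a sonic point. -/
def branchDisc (γ w : ℝ) : ℝ :=
  -4 * (4 - 3 * γ) * (γ + 1) * (γ - 1) * (2 - γ)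
  + (-12 * (γ - 1) * (γ ^ 2 - 5 * γ + 5) + γ ^ 2 + 6 * γ - 3) * w
  - 8 * (3 * γ ^ 2 - 15 * γ + 14) * w ^ 2 + 8 * (5 - 3 * γ) * w ^ 3

/-- The Larson-Penston-Hunter branch `R₁` (the smaller root of the quadratic). -/
def R₁ (γ w : ℝ) : ℝ :=
  ((9 - 7 * γ) * w ^ 2 - 8 * w ^ 3 - Real.sqrt (w ^ 3 * branchDisc γ w)) /
    (2 * w ^ 3 * (γ + 1))

/-- The Larson-Penston-Hunter branch `W₁`. -/
def W₁ (γ w : ℝ) : ℝ := 4 - 3 * γ - 3 * w - w * R₁ γ w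

/-- `(ρ, ω)` is of Larson-Penston-Hunter type near the sonic point `y⋆`: both functions are given
near `y⋆` by convergent power series, whose zeroth coefficients satisfy the sonic conditions (with
positive density), whose first coefficients lie on the branch `(R₁, W₁)`, and whose further
coefficients satisfy the recursion obtained by inserting the series into the system, that is,
the system holds near `y⋆`. -/
structure IsLPHAt (γ yStar : ℝ) (ρ ω : ℝ → ℝ) : Prop where
  analytic_rho : AnalyticAt ℝ ρ yStar
  analytic_omega : AnalyticAt ℝ ω yStar
  rho_pos : 0 < ρ yStar
  sonic : G γ yStar (ρ yStar) (ω yStar) = 0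
  regular : h γ (ρ yStar) (ω yStar) = 0
  deriv_rho : deriv ρ yStar = ρ yStar * R₁ γ (ω yStar) / yStar
  deriv_omega : deriv ω yStar = W₁ γ (ω yStar) / yStar
  solves : ∀ᶠ y in 𝓝 yStar, SolvesMulAt γ ρ ω y

/-- The LPH-type solution at `y⋆` extends to `(a, y⋆]` as the solution `(ρ, ω)`, which is subsonic
on `(a, y⋆)`. -/
structure IsSubsonicLPH (γ yStar a : ℝ) (ρ ω : ℝ → ℝ) : Prop where
  lph : IsLPHAt γ yStar ρ ω
  subsonic : ∀ y ∈ Ioo a yStar, 0 < G γ y (ρ y) (ω y)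
  solves : ∀ y ∈ Ioo a yStar, SolvesAt γ ρ ω y

/-- The sonic time `s(y⋆)`. -/
def sonicTime (γ yStar : ℝ) : ℝ :=
  sInf {a : ℝ | a ∈ Ioo 0 yStar ∧ ∃ ρ ω : ℝ → ℝ, IsSubsonicLPH γ yStar a ρ ω}

/-- `ω(y; y⋆) = v`: some subsonic extension to the left of the LPH-type solution at `y⋆` covers
`y`, and its velocity takes the value `v` there. -/
def OmegaEq (γ yStar y v : ℝ) : Prop :=
  ∃ a ∈ Ioo 0 y, ∃ ρ ω : ℝ → ℝ, IsSubsonicLPH γ yStar a ρ ω ∧ ω y = v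

/-- The set `𝒴` of the sonic points in `[y_f, y_F)` whose solution takes the Friedman velocity
between the sonic time and the sonic point. -/
def crossingSet (γ : ℝ) : Set ℝ :=
  {yStar | yStar ∈ Ico (yf γ) (yF γ) ∧
    ∃ y ∈ Ioo (sonicTime γ yStar) yStar, OmegaEq γ yStar y (omegaF γ)}

/-- The fundamental set `Y`. -/
def fundamentalSet (γ : ℝ) : Set ℝ :=
  {yStar | yStar ∈ Ico (yf γ) (yF γ) ∧ ∀ z ∈ Ico yStar (yF γ), z ∈ crossingSet γ}

/-- The critical sonic point `ȳ⋆ = inf Y`. -/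
def yBar (γ : ℝ) : ℝ := sInf (fundamentalSet γ)

/-- `(ρ, ω)` is a global solution on `(0, ∞)` arising from the LPH-type solution at `y⋆`: subsonic
to the left of `y⋆` and supersonic to the right of it. -/
structure IsGlobalLPH (γ yStar : ℝ) (ρ ω : ℝ → ℝ) : Prop where
  lph : IsLPHAt γ yStar ρ ω
  subsonic : ∀ y ∈ Ioo 0 yStar, 0 < G γ y (ρ y) (ω y)
  supersonic : ∀ y ∈ Ioi yStar, G γ y (ρ y) (ω y) < 0
  solves : ∀ y ∈ Ioi (0 : ℝ), y ≠ yStar → SolvesAt γ ρ ω y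

end EulerPoisson

end

/-! Put t = log (y / y⋆), N = 1/ω, D = 4πρ/((4-3γ)ω) and V = γρ^(γ-1)/(yω)² - 1. The system becomes
autonomous, subsonic means V > 0, the sonic point is V = 0 at t = 0, and the logarithmic density
slope is p = (2 + (γ-1)N + (γ-1)(2-γ)N² - D)/V. The sonic points in [y_f, y_F] correspond
monotonically to the values n = 1/ω₀ between n_f = 1/(2-γ) and n_F = 3/(4-3γ).

At the sonic point p has the form 0/0. The difference quotients at t = 0 of N, D, p and σ = t/V
solve a Briot-Bouquet system t Y' = Φ(t, Y). A contraction argument that is uniform in n gives LPH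
trajectories on a common interval (-r, r), their continuity in n, and uniqueness among trajectories
with bounded difference quotients (`exists_localFamily`). Grönwall extends the continuity to any
compact interval of existence (`IsTraj.dist_lt`).

Y is non-empty because at n = n_F the LPH branch has p < 0, so N rises above n_F immediately to the
left of the sonic point. This persists for n slightly below n_F, and the intermediate value theorem
gives a crossing.

Suppose now that the infimum of Y is y_f. Then every n in (n_f, n_F) has a first backward crossing
time T(n) of N = n_F. The crossing is transversal, so T is continuous. The zeros of N - n_f on
(T(n), 0) are simple, since a double zero would place the trajectory on the far-field solution, and
they stay away from both ends, where N is close to n_F and to n. Hence their number is finite and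
independent of n (`finite_crossings_and_ncard_eq`). As n decreases to n_f, however, the trajectory
follows the far-field solution for an arbitrarily long time (`exists_near_farField`). There the
squared Mach number tends to 0 backward in time, and the relative deviations X, Y satisfy, up to
small relative errors, (2-γ)X' = -(4-3γ)X - 2Y, (2-γ)Y' = (4-3γ)X + 2(γ-1)Y, a matrix with trace
5γ-6 and determinant 2(4-3γ)(2-γ) > 0.

If γ ≤ 6/5, then (X, Y) rotates at a speed bounded below and produces more zeros than the fixed
number allows (`not_forall_isFirstCrossing_of_rotation`). If γ > 6/5, then the origin is stable
backward in time, and a Lyapunov function keeps X small for ever, so n_F is never reached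
(`not_forall_isFirstCrossing_of_stable`). Either way there is a contradiction. -/

noncomputable section

namespace EulerPoisson

/-! ### Holomorphic solutions of Briot-Bouquet systems. -/

section Singular

variable {E : Type*} [NormedAddCommGroup E] [NormedSpace ℂ E]

/-- The solution operator of the Euler equation `t W' + c W = H` on a disc around `0`. -/
def eulerOp (c : ℕ) (H : ℂ → E) (t : ℂ) : E :=
  ∫ s in (0 : ℝ)..1, ((s : ℂ) ^ (c - 1)) • H (s * t)

lemma ofReal_mul_mem_ball {r : ℝ} {t : ℂ} (ht : t ∈ Metric.ball (0 : ℂ) r) {s : ℝ}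
    (hs : s ∈ Icc (0 : ℝ) 1) : (s : ℂ) * t ∈ Metric.ball (0 : ℂ) r := by
  simp only [mem_ball_zero_iff, norm_mul, Complex.norm_real, Real.norm_eq_abs,
    abs_of_nonneg hs.1] at *
  nlinarith [norm_nonneg t, hs.2]

lemma eulerOp_continuousOn {c : ℕ} {H : ℂ → E} {r : ℝ}
    (hH : ContinuousOn H (Metric.ball 0 r)) {t : ℂ} (ht : t ∈ Metric.ball (0 : ℂ) r) :
    ContinuousOn (fun s : ℝ => ((s : ℂ) ^ (c - 1)) • H (s * t)) (Icc 0 1) := by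
  refine ContinuousOn.smul (by fun_prop) (hH.comp (by fun_prop) ?_)
  intro s hs
  exact ofReal_mul_mem_ball ht hs

lemma eulerOp_intervalIntegrable {c : ℕ} {H : ℂ → E} {r : ℝ}
    (hH : ContinuousOn H (Metric.ball 0 r)) {t : ℂ} (ht : t ∈ Metric.ball (0 : ℂ) r) :
    IntervalIntegrable (fun s : ℝ => ((s : ℂ) ^ (c - 1)) • H (s * t)) MeasureTheory.volume 0 1 := by
  apply ContinuousOn.intervalIntegrable
  rw [uIcc_of_le zero_le_one]
  exact eulerOp_continuousOn hH ht

/-- The weight s^(c-1) has integral 1/c. This gain is what turns a Lipschitz constant below c into a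
contraction. -/
lemma norm_eulerOp_le {c : ℕ} (hc : 0 < c) {H : ℂ → E} {r K : ℝ}
    (hK : ∀ t ∈ Metric.ball (0 : ℂ) r, ‖H t‖ ≤ K) {t : ℂ} (ht : t ∈ Metric.ball (0 : ℂ) r) :
    ‖eulerOp c H t‖ ≤ K / c := by
  have h1 : ‖eulerOp c H t‖ ≤ ∫ s in (0 : ℝ)..1, s ^ (c - 1) * K := by
    refine intervalIntegral.norm_integral_le_of_norm_le zero_le_one ?_ ?_
    · refine Eventually.of_forall fun s hs => ?_
      rw [norm_smul, norm_pow, Complex.norm_real, Real.norm_eq_abs, abs_of_nonneg hs.1.le]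
      exact mul_le_mul_of_nonneg_left (hK _ (ofReal_mul_mem_ball ht ⟨hs.1.le, hs.2⟩))
        (pow_nonneg hs.1.le _)
    · exact Continuous.intervalIntegrable (by fun_prop) _ _
  have h2 : ∫ s in (0 : ℝ)..1, s ^ (c - 1) * K = K / c := by
    rw [intervalIntegral.integral_mul_const, integral_pow]
    have : ((c - 1 : ℕ) : ℝ) + 1 = c := by
      rw [Nat.cast_sub hc]; simp
    rw [this, Nat.sub_add_cancel hc]
    simp [hc.ne']
    field_simp
  rwa [h2] at h1

lemma eulerOp_sub {c : ℕ} {H H' : ℂ → E} {r : ℝ}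
    (hH : ContinuousOn H (Metric.ball 0 r)) (hH' : ContinuousOn H' (Metric.ball 0 r))
    {t : ℂ} (ht : t ∈ Metric.ball (0 : ℂ) r) :
    eulerOp c H t - eulerOp c H' t = eulerOp c (fun t => H t - H' t) t := by
  unfold eulerOp
  rw [← intervalIntegral.integral_sub (eulerOp_intervalIntegrable hH ht)
    (eulerOp_intervalIntegrable hH' ht)]
  simp only [smul_sub]

variable [CompleteSpace E]

/-- Differentiation under the integral sign. A slightly smaller closed disc supplies, by
compactness, the constant that dominates the derivative. -/
lemma hasDerivAt_eulerOp {c : ℕ} (hc : 0 < c) {H : ℂ → E} {r : ℝ}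
    (hH : DifferentiableOn ℂ H (Metric.ball 0 r)) {t : ℂ} (ht : t ∈ Metric.ball (0 : ℂ) r) :
    HasDerivAt (eulerOp c H) (∫ s in (0 : ℝ)..1, ((s : ℂ) ^ c) • deriv H (s * t)) t := by
  obtain ⟨ρ, htρ, hρr⟩ : ∃ ρ, ‖t‖ < ρ ∧ ρ < r := exists_between (by simpa using ht)
  have hcd : ContinuousOn (deriv H) (Metric.closedBall 0 ρ) :=
    (hH.deriv Metric.isOpen_ball).continuousOn.mono (Metric.closedBall_subset_ball hρr)
  obtain ⟨C, hC⟩ := (isCompact_closedBall (0 : ℂ) ρ).exists_bound_of_continuousOn hcd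
  have hmem : ∀ x ∈ Metric.ball (0 : ℂ) ρ, ∀ s ∈ Ioc (0 : ℝ) 1,
      (s : ℂ) * x ∈ Metric.ball (0 : ℂ) ρ := fun x hx s hs =>
    ofReal_mul_mem_ball hx ⟨hs.1.le, hs.2⟩
  have hsub : Metric.ball (0 : ℂ) ρ ⊆ Metric.ball 0 r := Metric.ball_subset_ball hρr.le
  have htρ' : t ∈ Metric.ball (0 : ℂ) ρ := by simpa using htρ
  have hpow : ∀ s : ℂ, s ^ c = s ^ (c - 1) * s := fun s => by
    rw [← pow_succ, Nat.sub_add_cancel hc]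
  refine (intervalIntegral.hasDerivAt_integral_of_dominated_loc_of_deriv_le
    (F := fun (x : ℂ) (s : ℝ) => ((s : ℂ) ^ (c - 1)) • H (s * x))
    (F' := fun (x : ℂ) (s : ℝ) => ((s : ℂ) ^ c) • deriv H (s * x)) (bound := fun _ => C)
    (s := Metric.ball 0 ρ) (Metric.isOpen_ball.mem_nhds htρ') ?_ ?_ ?_ ?_ ?_ ?_).2
  · filter_upwards [Metric.isOpen_ball.mem_nhds htρ'] with x hx
    rw [uIoc_of_le zero_le_one]
    exact ((eulerOp_continuousOn hH.continuousOn (hsub hx)).mono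
      Ioc_subset_Icc_self).aestronglyMeasurable measurableSet_Ioc
  · exact eulerOp_intervalIntegrable hH.continuousOn ht
  · rw [uIoc_of_le zero_le_one]
    refine (ContinuousOn.mono ?_ Ioc_subset_Icc_self).aestronglyMeasurable measurableSet_Ioc
    refine ContinuousOn.smul (by fun_prop) (hcd.comp (by fun_prop) ?_)
    intro s hs
    exact Metric.ball_subset_closedBall (ofReal_mul_mem_ball htρ' hs)
  · refine Eventually.of_forall fun s hs x hx => ?_
    rw [uIoc_of_le zero_le_one] at hs
    rw [norm_smul, norm_pow, Complex.norm_real, Real.norm_eq_abs, abs_of_nonneg hs.1.le]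
    have := hC _ (Metric.ball_subset_closedBall (hmem x hx s hs))
    have h1 : s ^ c ≤ 1 := pow_le_one₀ hs.1.le hs.2
    nlinarith [norm_nonneg (deriv H (s * x)), pow_nonneg hs.1.le c]
  · simp
  · refine Eventually.of_forall fun s hs x hx => ?_
    rw [uIoc_of_le zero_le_one] at hs
    have h1 : HasDerivAt H (deriv H (s * x)) (s * x) :=
      ((hH _ (hsub (hmem x hx s hs))).differentiableAt
        (Metric.isOpen_ball.mem_nhds (hsub (hmem x hx s hs)))).hasDerivAt
    have h2 : HasDerivAt (fun x : ℂ => (s : ℂ) * x) (s : ℂ) x := by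
      simpa using (hasDerivAt_id x).const_mul (s : ℂ)
    have h3 := (h1.scomp x h2).const_smul ((s : ℂ) ^ (c - 1))
    rw [hpow, mul_smul]
    exact h3

/-- The combined integrand is the s-derivative of s^c H(st), so only the boundary value H(t)
survives; the one at s = 0 vanishes because c > 0. -/
lemma eulerOp_eq {c : ℕ} (hc : 0 < c) {H : ℂ → E} {r : ℝ}
    (hH : DifferentiableOn ℂ H (Metric.ball 0 r)) {t : ℂ} (ht : t ∈ Metric.ball (0 : ℂ) r) :
    t • deriv (eulerOp c H) t + (c : ℂ) • eulerOp c H t = H t := by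
  rw [(hasDerivAt_eulerOp hc hH ht).deriv]
  have hcd : ContinuousOn (deriv H) (Metric.ball 0 r) :=
    (hH.deriv Metric.isOpen_ball).continuousOn
  have hi1 := eulerOp_intervalIntegrable (c := c) hH.continuousOn ht
  have hi2 := eulerOp_intervalIntegrable (c := c + 1) hcd ht
  simp only [Nat.add_sub_cancel] at hi2
  have key : ∫ s in (0 : ℝ)..1, (t • ((s : ℂ) ^ c • deriv H (s * t)) +
      (c : ℂ) • ((s : ℂ) ^ (c - 1) • H (s * t))) =
      ((1 : ℝ) : ℂ) ^ c • H ((1 : ℝ) * t) - ((0 : ℝ) : ℂ) ^ c • H ((0 : ℝ) * t) := by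
    refine intervalIntegral.integral_eq_sub_of_hasDerivAt
      (f := fun s : ℝ => ((s : ℂ) ^ c) • H (s * t)) ?_ ?_
    · intro s hs
      rw [uIcc_of_le zero_le_one] at hs
      have hm := ofReal_mul_mem_ball ht hs
      have h1 : HasDerivAt H (deriv H (s * t)) (s * t) :=
        ((hH _ hm).differentiableAt (Metric.isOpen_ball.mem_nhds hm)).hasDerivAt
      have h2 : HasDerivAt (fun x : ℂ => x * t) t (s : ℂ) := by
        simpa using (hasDerivAt_id (s : ℂ)).mul_const t
      have h3 : HasDerivAt (fun x : ℂ => x ^ c • H (x * t))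
          ((s : ℂ) ^ c • (t • deriv H (s * t)) + ((c : ℂ) * (s : ℂ) ^ (c - 1)) • H (s * t))
          (s : ℂ) := (hasDerivAt_pow c (s : ℂ)).smul (h1.scomp (s : ℂ) h2)
      have h4 := h3.scomp s Complex.ofRealCLM.hasDerivAt
      rw [Complex.ofRealCLM_apply, Complex.ofReal_one, one_smul, mul_smul, smul_comm] at h4
      exact h4
    · exact (hi2.smul t).add (hi1.smul (c : ℂ))
  have hi3 := hi2.smul t
  have hi4 := hi1.smul (c : ℂ)
  simp only [Pi.smul_def] at hi3 hi4
  rw [intervalIntegral.integral_add hi3 hi4,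
    intervalIntegral.integral_smul, intervalIntegral.integral_smul] at key
  unfold eulerOp
  rw [key]
  simp [hc.ne']

/-- **Briot-Bouquet systems.** If `Φ t Y + c Y` maps a ball to the `c`-fold of that ball and is a
contraction after division by `c`, then `t Y' = Φ t Y` has a holomorphic solution. -/
theorem exists_holomorphic_solution {Φ : ℂ → E → E} {r R q : ℝ} {c : ℕ} (hc : 0 < c)
    (hR : 0 ≤ R) (hq0 : 0 ≤ q) (hq : q < c)
    (hd : Differentiable ℂ (fun x : ℂ × E => Φ x.1 x.2))
    (hb : ∀ t ∈ Metric.ball (0 : ℂ) r, ∀ Y, ‖Y‖ ≤ R → ‖Φ t Y + (c : ℂ) • Y‖ ≤ c * R)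
    (hl : ∀ t ∈ Metric.ball (0 : ℂ) r, ∀ Y Z, ‖Y‖ ≤ R → ‖Z‖ ≤ R →
      ‖(Φ t Y + (c : ℂ) • Y) - (Φ t Z + (c : ℂ) • Z)‖ ≤ q * ‖Y - Z‖)
    {F : Type*} [NormedAddCommGroup F] [NormedSpace ℝ F] [CompleteSpace F] (L : E →L[ℝ] F)
    (hL : ∀ t : ℝ, ∀ Y, L Y = 0 → L (Φ t Y) = 0) :
    ∃ Y : ℂ → E, DifferentiableOn ℂ Y (Metric.ball 0 r) ∧
      (∀ t ∈ Metric.ball (0 : ℂ) r, ‖Y t‖ ≤ R) ∧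
      (∀ t ∈ Metric.ball (0 : ℂ) r, t • deriv Y t = Φ t (Y t)) ∧
      ∀ t : ℝ, (t : ℂ) ∈ Metric.ball (0 : ℂ) r → L (Y t) = 0 := by
  have hc' : (0 : ℝ) < c := by exact_mod_cast hc
  -- Adding cY to both sides gives t Y' + cY = Φ + cY, so solutions are the fixed points of T.
  -- Picard iteration starts from 0 and converges uniformly, which preserves holomorphy.
  set T : (ℂ → E) → ℂ → E := fun Y => eulerOp c (fun t => Φ t (Y t) + (c : ℂ) • Y t) with hT
  have hdY : ∀ Y : ℂ → E, DifferentiableOn ℂ Y (Metric.ball 0 r) →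
      DifferentiableOn ℂ (fun t => Φ t (Y t) + (c : ℂ) • Y t) (Metric.ball 0 r) := by
    intro Y hY
    have h1 : DifferentiableOn ℂ (fun t : ℂ => (t, Y t)) (Metric.ball 0 r) :=
      differentiableOn_id.prodMk hY
    exact (hd.comp_differentiableOn h1).add (hY.const_smul _)
  set A : ℕ → ℂ → E := fun k => T^[k] 0 with hA
  have hAs : ∀ k, A (k + 1) = T (A k) := fun k => Function.iterate_succ_apply' T k 0
  have hAd : ∀ k, DifferentiableOn ℂ (A k) (Metric.ball 0 r) := by
    intro k
    induction k with
    | zero => exact differentiableOn_const 0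
    | succ k ih =>
      rw [hAs]
      intro t ht
      exact (hasDerivAt_eulerOp hc (hdY _ ih) ht).differentiableAt.differentiableWithinAt
  have hAb : ∀ k, ∀ t ∈ Metric.ball (0 : ℂ) r, ‖A k t‖ ≤ R := by
    intro k
    induction k with
    | zero => intro t _; simpa [hA] using hR
    | succ k ih =>
      rw [hAs]
      intro t ht
      have := norm_eulerOp_le hc (fun t ht => hb t ht (A k t) (ih t ht)) ht
      rwa [mul_div_cancel_left₀ _ hc'.ne'] at this
  have hstep : ∀ (Y Z : ℂ → E) (K : ℝ), DifferentiableOn ℂ Y (Metric.ball 0 r) →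
      DifferentiableOn ℂ Z (Metric.ball 0 r) → (∀ t ∈ Metric.ball (0 : ℂ) r, ‖Y t‖ ≤ R) →
      (∀ t ∈ Metric.ball (0 : ℂ) r, ‖Z t‖ ≤ R) →
      (∀ t ∈ Metric.ball (0 : ℂ) r, ‖Y t - Z t‖ ≤ K) →
      ∀ t ∈ Metric.ball (0 : ℂ) r, ‖T Y t - T Z t‖ ≤ q / c * K := by
    intro Y Z K hY hZ hYR hZR hK t ht
    simp only [hT]
    rw [eulerOp_sub (hdY Y hY).continuousOn (hdY Z hZ).continuousOn ht]
    have := norm_eulerOp_le (K := q * K) hc (H := fun t => (Φ t (Y t) + (c : ℂ) • Y t) -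
      (Φ t (Z t) + (c : ℂ) • Z t)) (fun s hs => (hl s hs _ _ (hYR s hs) (hZR s hs)).trans
        (mul_le_mul_of_nonneg_left (hK s hs) hq0)) ht
    rwa [div_mul_eq_mul_div]
  have hcauchy : ∀ k, ∀ t ∈ Metric.ball (0 : ℂ) r, dist (A k t) (A (k + 1) t) ≤
      (2 * R) * (q / c) ^ k := by
    intro k
    induction k with
    | zero =>
      intro t ht
      rw [dist_eq_norm]
      have := norm_sub_le (A 0 t) (A 1 t)
      have := hAb 0 t ht
      have := hAb 1 t ht
      simp only [pow_zero, zero_add]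
      linarith
    | succ k ih =>
      intro t ht
      rw [dist_eq_norm, hAs, hAs (k + 1)]
      have := hstep (A k) (A (k + 1)) (2 * R * (q / c) ^ k) (hAd _) (hAd _) (hAb _) (hAb _)
        (fun s hs => by rw [← dist_eq_norm]; exact ih s hs) t ht
      rw [← hAs] at this ⊢
      calc _ ≤ _ := this
        _ = _ := by ring
  have hqc : q / c < 1 := (div_lt_one hc').2 hq
  have hlim : ∀ t, ∃ y, t ∈ Metric.ball (0 : ℂ) r → Tendsto (fun k => A k t) atTop (𝓝 y) := by
    intro t
    by_cases ht : t ∈ Metric.ball (0 : ℂ) r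
    · obtain ⟨y, hy⟩ := cauchySeq_tendsto_of_complete
        (cauchySeq_of_le_geometric _ _ hqc (fun k => hcauchy k t ht))
      exact ⟨y, fun _ => hy⟩
    · exact ⟨0, fun h => absurd h ht⟩
  choose Y hY using hlim
  have hdist : ∀ k, ∀ t ∈ Metric.ball (0 : ℂ) r, ‖A k t - Y t‖ ≤
      2 * R / (1 - q / c) * (q / c) ^ k := by
    intro k t ht
    rw [← dist_eq_norm]
    have := dist_le_of_le_geometric_of_tendsto _ _ hqc (fun k => hcauchy k t ht) (hY t ht) k
    calc _ ≤ _ := this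
      _ = _ := by ring
  have hgeo : Tendsto (fun k : ℕ => 2 * R / (1 - q / c) * (q / c) ^ k) atTop (𝓝 0) := by
    have := (tendsto_pow_atTop_nhds_zero_of_lt_one (by positivity) hqc).const_mul
      (2 * R / (1 - q / c))
    simpa using this
  have hunif : TendstoUniformlyOn A Y atTop (Metric.ball 0 r) := by
    rw [Metric.tendstoUniformlyOn_iff]
    intro ε hε
    filter_upwards [hgeo.eventually (gt_mem_nhds hε)] with k hk t ht
    rw [dist_comm, dist_eq_norm]
    exact (hdist k t ht).trans_lt hk
  have hYd : DifferentiableOn ℂ Y (Metric.ball 0 r) :=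
    hunif.tendstoLocallyUniformlyOn.differentiableOn (Eventually.of_forall hAd) Metric.isOpen_ball
  have hYb : ∀ t ∈ Metric.ball (0 : ℂ) r, ‖Y t‖ ≤ R := fun t ht =>
    le_of_tendsto (hY t ht).norm (Eventually.of_forall fun k => hAb k t ht)
  have hfix : ∀ t ∈ Metric.ball (0 : ℂ) r, Y t = T Y t := by
    intro t ht
    refine tendsto_nhds_unique ((tendsto_add_atTop_iff_nat 1).2 (hY t ht)) ?_
    rw [tendsto_iff_norm_sub_tendsto_zero]
    have h0 : Tendsto (fun k : ℕ => q / c * (2 * R / (1 - q / c) * (q / c) ^ k)) atTop (𝓝 0) := by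
      simpa using hgeo.const_mul (q / c)
    refine squeeze_zero (fun k => norm_nonneg _) (fun k => ?_) h0
    rw [hAs]
    exact hstep (A k) Y _ (hAd k) hYd (hAb k) hYb (hdist k) t ht
  refine ⟨Y, hYd, hYb, ?_, ?_⟩
  · intro t ht
    have h1 := eulerOp_eq hc (hdY Y hYd) ht
    have h2 : deriv Y t = deriv (T Y) t := by
      apply Filter.EventuallyEq.deriv_eq
      filter_upwards [Metric.isOpen_ball.mem_nhds ht] with s hs using hfix s hs
    rw [h2]
    have h3 : T Y t = eulerOp c (fun t => Φ t (Y t) + (c : ℂ) • Y t) t := rfl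
    rw [← h3, ← hfix t ht] at h1
    exact add_right_cancel h1
  · intro t ht
    -- For real t the integral defining the next iterate uses only real points st, so the kernel of
    -- the real-linear map L is preserved along the iteration. With L the imaginary part this yields
    -- real solutions.
    have hAL : ∀ k, ∀ t : ℝ, (t : ℂ) ∈ Metric.ball (0 : ℂ) r → L (A k t) = 0 := by
      intro k
      induction k with
      | zero => intro t _; simp [hA]
      | succ k ih =>
        intro t ht
        rw [hAs]
        simp only [hT, eulerOp]
        have hint := eulerOp_intervalIntegrable (c := c) (hdY _ (hAd k)).continuousOn ht
        rw [← L.intervalIntegral_comp_comm hint]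
        rw [intervalIntegral.integral_congr (g := fun _ => (0 : F)), intervalIntegral.integral_zero]
        intro s hs
        rw [uIcc_of_le zero_le_one] at hs
        have hm := ofReal_mul_mem_ball ht hs
        have h1 := ih (s * t) (by push_cast; exact hm)
        have h2 := hL (s * t) _ h1
        push_cast at h1 h2
        have h3 : ((s : ℂ) ^ (c - 1)) • (Φ (s * t) (A k (s * t)) + (c : ℂ) • A k (s * t)) =
            (s ^ (c - 1) : ℝ) • (Φ (s * t) (A k (s * t)) + (c : ℝ) • A k (s * t)) := by
          rw [← Complex.coe_smul, ← Complex.coe_smul]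
          push_cast
          rfl
        simp only [h3, map_smul, map_add, h1, h2, smul_zero, add_zero]
    have h1 : Tendsto (fun k => L (A k t)) atTop (𝓝 (L (Y t))) :=
      (L.continuous.tendsto _).comp (hY t ht)
    simp only [hAL _ t ht] at h1
    exact tendsto_nhds_unique h1 tendsto_const_nhds

end Singular

/-! ### Comparison of bounded solutions on one side of the singular point. -/

section Comparison

variable {E : Type*} [NormedAddCommGroup E] [NormedSpace ℂ E]

/-- Since (t^c Δ)' = t^(c-1)(tΔ' + cΔ), one integrates from t to -ε and lets ε tend to 0. The
boundary term ε^c Δ(-ε) disappears because Δ is bounded; no continuity of Δ at 0 is needed. -/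
lemma norm_le_of_euler_ineq {Δ Δ' : ℝ → E} {r K C : ℝ} {c : ℕ} (hc : 0 < c)
    (hd : ∀ t ∈ Ioo (-r) 0, HasDerivAt Δ (Δ' t) t)
    (hK : ∀ t ∈ Ioo (-r) 0, ‖t • Δ' t + (c : ℝ) • Δ t‖ ≤ K)
    (hC : ∀ t ∈ Ioo (-r) 0, ‖Δ t‖ ≤ C) {t : ℝ} (ht : t ∈ Ioo (-r) 0) : ‖Δ t‖ ≤ K / c := by
  have hc' : (0 : ℝ) < c := by exact_mod_cast hc
  have hpos : 0 < (-t) ^ c := pow_pos (by linarith [ht.2]) c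
  have hpow : ∀ s : ℝ, s ^ c = s ^ (c - 1) * s := fun s => by
    rw [← pow_succ, Nat.sub_add_cancel hc]
  have key : ∀ ε ∈ Ioo 0 (-t), (-t) ^ c * ‖Δ t‖ ≤ K * (-t) ^ c / c + ε ^ c * C := by
    intro ε hε
    have hsub : ∀ s ∈ Icc t (-ε), s ∈ Ioo (-r) 0 := fun s hs =>
      ⟨ht.1.trans_le hs.1, by linarith [hs.2, hε.1]⟩
    have hder : ∀ s ∈ Icc t (-ε), HasDerivAt (fun s => s ^ c • Δ s - t ^ c • Δ t)
        (s ^ (c - 1) • (s • Δ' s + (c : ℝ) • Δ s)) s := by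
      intro s hs
      have h : HasDerivAt (fun s => s ^ c • Δ s - t ^ c • Δ t) _ s :=
        ((hasDerivAt_pow c s).smul (hd s (hsub s hs))).sub_const (t ^ c • Δ t)
      refine h.congr_deriv ?_
      rw [smul_add, smul_smul, smul_smul, ← hpow, mul_comm ((c : ℝ)) _]
    have hB : ∀ s, HasDerivAt (fun s : ℝ => K * ((-t) ^ c - (-s) ^ c) / c)
        (K * (-s) ^ (c - 1)) s := by
      intro s
      have h : HasDerivAt (fun s : ℝ => K * ((-t) ^ c - (-s) ^ c) / c) _ s :=
        ((((hasDerivAt_neg s).pow c).const_sub ((-t) ^ c)).const_mul K).div_const (c : ℝ)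
      refine h.congr_deriv ?_
      field_simp
    have := image_norm_le_of_norm_deriv_right_le_deriv_boundary
      (f := fun s => s ^ c • Δ s - t ^ c • Δ t) (a := t) (b := -ε)
      (f' := fun s => s ^ (c - 1) • (s • Δ' s + (c : ℝ) • Δ s))
      (B := fun s : ℝ => K * ((-t) ^ c - (-s) ^ c) / c) (B' := fun s => K * (-s) ^ (c - 1))
      (fun s hs => (hder s hs).continuousAt.continuousWithinAt)
      (fun s hs => (hder s ⟨hs.1, hs.2.le⟩).hasDerivWithinAt) (by simp) hB
      (fun s hs => by
        have hs' := hsub s ⟨hs.1, hs.2.le⟩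
        rw [norm_smul, norm_pow, Real.norm_eq_abs, abs_of_neg hs'.2, mul_comm K]
        exact mul_le_mul_of_nonneg_left (hK s hs') (pow_nonneg (by linarith [hs'.2]) _))
      (right_mem_Icc.2 (by linarith [hε.2]))
    simp only [neg_neg] at this
    have h1 : ‖t ^ c • Δ t‖ ≤ ‖(-ε) ^ c • Δ (-ε) - t ^ c • Δ t‖ + ‖(-ε) ^ c • Δ (-ε)‖ := by
      rw [← norm_neg (t ^ c • Δ t)]
      have := norm_sub_le ((-ε) ^ c • Δ (-ε) - t ^ c • Δ t) ((-ε) ^ c • Δ (-ε))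
      simpa using this
    rw [norm_smul, norm_smul, norm_pow, norm_pow, Real.norm_eq_abs, Real.norm_eq_abs,
      abs_of_neg ht.2, abs_neg, abs_of_pos hε.1] at h1
    have h2 := hC (-ε) (hsub _ (right_mem_Icc.2 (by linarith [hε.2])))
    have h3 : ε ^ c * ‖Δ (-ε)‖ ≤ ε ^ c * C :=
      mul_le_mul_of_nonneg_left h2 (pow_nonneg hε.1.le _)
    have hK0 : 0 ≤ K := (norm_nonneg _).trans (hK t ht)
    have h4 : K * ((-t) ^ c - ε ^ c) / c ≤ K * (-t) ^ c / c := by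
      gcongr
      linarith [pow_nonneg hε.1.le c]
    linarith
  have hlim : Tendsto (fun ε : ℝ => K * (-t) ^ c / c + ε ^ c * C) (𝓝[>] 0)
      (𝓝 (K * (-t) ^ c / c + 0 ^ c * C)) :=
    (Continuous.tendsto (by fun_prop) 0).mono_left nhdsWithin_le_nhds
  have hle := ge_of_tendsto hlim (by
    filter_upwards [Ioo_mem_nhdsGT (show (0 : ℝ) < -t by linarith [ht.2])] with ε hε using key ε hε)
  rw [zero_pow hc.ne', zero_mul, add_zero] at hle
  rw [le_div_iff₀ hc']
  rw [le_div_iff₀ hc'] at hle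
  nlinarith

/-- Two bounded solutions of perturbed Briot-Bouquet systems are close to each other. -/
lemma norm_sub_le_of_briotBouquet {Φ₁ Φ₂ : ℝ → E → E} {Y₁ Y₂ Y₁' Y₂' : ℝ → E} {r q ε C : ℝ}
    {c : ℕ} (hc : 0 < c) (hq0 : 0 ≤ q) (hq : q < c)
    (hd₁ : ∀ t ∈ Ioo (-r) 0, HasDerivAt Y₁ (Y₁' t) t)
    (hd₂ : ∀ t ∈ Ioo (-r) 0, HasDerivAt Y₂ (Y₂' t) t)
    (he₁ : ∀ t ∈ Ioo (-r) 0, t • Y₁' t = Φ₁ t (Y₁ t))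
    (he₂ : ∀ t ∈ Ioo (-r) 0, t • Y₂' t = Φ₂ t (Y₂ t))
    (hb₁ : ∀ t ∈ Ioo (-r) 0, ‖Y₁ t‖ ≤ C) (hb₂ : ∀ t ∈ Ioo (-r) 0, ‖Y₂ t‖ ≤ C)
    (hl : ∀ t ∈ Ioo (-r) 0, ‖(Φ₁ t (Y₁ t) + (c : ℝ) • Y₁ t) - (Φ₂ t (Y₂ t) + (c : ℝ) • Y₂ t)‖ ≤
      q * ‖Y₁ t - Y₂ t‖ + ε) {t : ℝ} (ht : t ∈ Ioo (-r) 0) :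
    ‖Y₁ t - Y₂ t‖ ≤ ε / (c - q) := by
  have hc' : (0 : ℝ) < c := by exact_mod_cast hc
  set S : Set ℝ := (fun t => ‖Y₁ t - Y₂ t‖) '' Ioo (-r) 0 with hS
  have hbd : ∀ t ∈ Ioo (-r) 0, ‖Y₁ t - Y₂ t‖ ≤ 2 * C := fun t ht => by
    have := norm_sub_le (Y₁ t) (Y₂ t)
    linarith [hb₁ t ht, hb₂ t ht]
  have hbdd : BddAbove S := ⟨2 * C, by rintro _ ⟨t, ht, rfl⟩; exact hbd t ht⟩
  have hle : ∀ t ∈ Ioo (-r) 0, ‖Y₁ t - Y₂ t‖ ≤ sSup S := fun t ht =>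
    le_csSup hbdd (mem_image_of_mem _ ht)
  have h1 : ∀ t ∈ Ioo (-r) 0, ‖Y₁ t - Y₂ t‖ ≤ (q * sSup S + ε) / c := by
    intro t ht
    refine norm_le_of_euler_ineq (Δ := fun t => Y₁ t - Y₂ t) (Δ' := fun t => Y₁' t - Y₂' t)
      hc (fun s hs => (hd₁ s hs).sub (hd₂ s hs)) (fun s hs => ?_) hbd ht
    have h := hl s hs
    rw [← he₁ s hs, ← he₂ s hs] at h
    have h2 : s • (Y₁' s - Y₂' s) + (c : ℝ) • (Y₁ s - Y₂ s) =
        (s • Y₁' s + (c : ℝ) • Y₁ s) - (s • Y₂' s + (c : ℝ) • Y₂ s) := by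
      rw [smul_sub, smul_sub]; abel
    rw [h2]
    have := mul_le_mul_of_nonneg_left (hle s hs) hq0
    linarith
  -- The supremum is finite by boundedness, so the estimate may be applied to it and then solved for
  -- it, using q < c.
  have h2 : sSup S ≤ (q * sSup S + ε) / c :=
    csSup_le ⟨_, mem_image_of_mem _ ht⟩ (by rintro _ ⟨t, ht, rfl⟩; exact h1 t ht)
  refine (hle t ht).trans ?_
  rw [le_div_iff₀ (by linarith)]
  rw [le_div_iff₀ hc'] at h2
  linarith

end Comparison

/-! ### Families of Briot-Bouquet systems over a compact parameter set. -/

section Family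

/-- A tube lemma: a strict inequality at t = 0 over a compact set persists on one disc for all
parameters. -/
lemma exists_ball_of_forall_zero {A E : Type*} [NormedAddCommGroup A] [NormedAddCommGroup E]
    {S : Set (A × E)} (hS : IsCompact S) {f : A × ℂ × E → ℝ}
    (hf : Continuous f) {b : ℝ} (h0 : ∀ x ∈ S, f (x.1, 0, x.2) < b) :
    ∃ r > 0, ∀ x ∈ S, ∀ t ∈ Metric.ball (0 : ℂ) r, f (x.1, t, x.2) < b := by
  have hn : IsOpen {x : (A × E) × ℂ | f (x.1.1, x.2, x.1.2) < b} :=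
    isOpen_lt (by fun_prop) continuous_const
  obtain ⟨u, v, hu, hv, hSu, hv0, huv⟩ := generalized_tube_lemma hS (isCompact_singleton (x := (0:ℂ)))
    hn (by
      rintro ⟨x, t⟩ ⟨hx, ht⟩
      simp only [mem_singleton_iff] at ht
      simpa [ht] using h0 x hx)
  obtain ⟨r, hr, hrv⟩ := Metric.isOpen_iff.1 hv 0 (hv0 rfl)
  exact ⟨r, hr, fun x hx t ht => huv (mk_mem_prod (hSu hx) (hrv ht))⟩

variable {E A : Type*} [NormedAddCommGroup E] [NormedSpace ℂ E] [FiniteDimensional ℂ E]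
  [NormedAddCommGroup A] [NormedSpace ℂ A]

/-- A smooth family of Briot-Bouquet systems whose linear part at the singular point, shifted by
`c`, is uniformly a strict contraction relative to `c`. -/
structure IsBriotBouquetFamily (Φ : A → ℂ → E → E) (𝒦 : Set A) (c : ℕ) : Prop where
  pos : 0 < c
  compact : IsCompact 𝒦
  contDiff : ContDiff ℂ 2 (fun x : A × ℂ × E => Φ x.1 x.2.1 x.2.2)
  contract : ∀ P ∈ 𝒦, ∀ Y Z, ‖(Φ P 0 Y + (c : ℂ) • Y) - (Φ P 0 Z + (c : ℂ) • Z)‖ ≤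
    (c - 1 / 2) * ‖Y - Z‖

variable {Φ : A → ℂ → E → E} {𝒦 : Set A} {c : ℕ}

/-- The difference Φ(t, ·) - Φ(0, ·) vanishes identically at t = 0, so by compactness its derivative
in Y is below 1/4 on a uniform disc. This spends half of the gap 1/2 in `contract`. -/
lemma IsBriotBouquetFamily.exists_lipschitz (h : IsBriotBouquetFamily Φ 𝒦 c) (R : ℝ) :
    ∃ r > 0, ∀ P ∈ 𝒦, ∀ t ∈ Metric.ball (0 : ℂ) r, ∀ Y Z, ‖Y‖ ≤ R → ‖Z‖ ≤ R →
      ‖(Φ P t Y + (c : ℂ) • Y) - (Φ P t Z + (c : ℂ) • Z)‖ ≤ (c - 1 / 4) * ‖Y - Z‖ := by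
  have : ProperSpace E := FiniteDimensional.proper ℂ E
  set Ψ : A × ℂ × E → E → E := fun x Y => Φ x.1 x.2.1 Y - Φ x.1 0 Y with hΨ
  have hΨc : ContDiff ℂ 2 (Function.uncurry Ψ) := by
    refine ContDiff.sub ?_ ?_
    · exact h.contDiff.comp (f := fun y : (A × ℂ × E) × E => (y.1.1, y.1.2.1, y.2)) (by fun_prop)
    · exact h.contDiff.comp (f := fun y : (A × ℂ × E) × E => (y.1.1, (0 : ℂ), y.2)) (by fun_prop)
  have hcont : ContDiff ℂ 1 (fun x : A × ℂ × E => fderiv ℂ (Ψ x) x.2.2) :=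
    ContDiff.fderiv hΨc (by fun_prop) (by norm_num)
  obtain ⟨r, hr, hr'⟩ := exists_ball_of_forall_zero (b := 1 / 4)
    (h.compact.prod (isCompact_closedBall (0 : E) R)) hcont.continuous.norm (by
      intro x _
      have : Ψ (x.1, 0, x.2) = fun _ => 0 := by
        funext Y
        simp [hΨ]
      simp [this])
  refine ⟨r, hr, fun P hP t ht Y Z hY hZ => ?_⟩
  have h1 : ‖Ψ (P, t, 0) Y - Ψ (P, t, 0) Z‖ ≤ 1 / 4 * ‖Y - Z‖ := by
    refine Convex.norm_image_sub_le_of_norm_fderiv_le (𝕜 := ℂ) (s := Metric.closedBall 0 R)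
      (fun x _ => ?_) (fun x hx => ?_) (convex_closedBall _ _) (by simpa using hZ) (by simpa using hY)
    · exact (hΨc.comp (f := fun y : E => ((P, t, (0 : E)), y)) (by fun_prop)).differentiable
        (by norm_num) x
    · exact (hr' (P, x) ⟨hP, hx⟩ t ht).le
  have h2 := h.contract P hP Y Z
  have h3 : (Φ P t Y + (c : ℂ) • Y) - (Φ P t Z + (c : ℂ) • Z) =
      (Ψ (P, t, 0) Y - Ψ (P, t, 0) Z) +
        ((Φ P 0 Y + (c : ℂ) • Y) - (Φ P 0 Z + (c : ℂ) • Z)) := by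
    simp only [hΨ]; abel
  rw [h3]
  refine (norm_add_le _ _).trans ?_
  linarith

/-- Existence of holomorphic solutions on a disc that does not depend on the parameter. -/
theorem IsBriotBouquetFamily.exists_solution (h : IsBriotBouquetFamily Φ 𝒦 c)
    {F : Type*} [NormedAddCommGroup F] [NormedSpace ℝ F] [CompleteSpace F] (L : E →L[ℝ] F)
    (hL : ∀ P ∈ 𝒦, ∀ t : ℝ, ∀ Y, L Y = 0 → L (Φ P t Y) = 0) :
    ∃ R r₀ : ℝ, 0 < r₀ ∧ 0 ≤ R ∧ ∀ r ∈ Ioc 0 r₀,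
      (∀ P ∈ 𝒦, ∀ t ∈ Metric.ball (0 : ℂ) r, ∀ Y Z, ‖Y‖ ≤ R → ‖Z‖ ≤ R →
        ‖(Φ P t Y + (c : ℂ) • Y) - (Φ P t Z + (c : ℂ) • Z)‖ ≤ (c - 1 / 4) * ‖Y - Z‖) ∧
      ∀ P ∈ 𝒦, ∃ Y : ℂ → E, DifferentiableOn ℂ Y (Metric.ball 0 r) ∧
        (∀ t ∈ Metric.ball (0 : ℂ) r, ‖Y t‖ ≤ R) ∧
        (∀ t ∈ Metric.ball (0 : ℂ) r, t • deriv Y t = Φ P t (Y t)) ∧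
        ∀ t : ℝ, (t : ℂ) ∈ Metric.ball (0 : ℂ) r → L (Y t) = 0 := by
  have : CompleteSpace E := FiniteDimensional.complete ℂ E
  have hcont := h.contDiff.continuous
  obtain ⟨F₀, hF₀⟩ := h.compact.exists_bound_of_continuousOn
    (f := fun P => Φ P 0 0) (hcont.comp (f := fun P : A => (P, (0 : ℂ), (0 : E)))
      (by fun_prop)).continuousOn
  obtain ⟨r₁, hr₁, hr₁'⟩ := exists_ball_of_forall_zero (b := |F₀| + 1)
    (h.compact.prod (isCompact_singleton (x := (0 : E)))) hcont.norm (by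
      rintro ⟨P, Y⟩ ⟨hP, hY⟩
      simp only [mem_singleton_iff] at hY
      subst hY
      exact (hF₀ P hP).trans_lt (by linarith [le_abs_self F₀]))
  obtain ⟨r₂, hr₂, hr₂'⟩ := h.exists_lipschitz (4 * (|F₀| + 1))
  have hc1 : (1 : ℝ) ≤ c := by exact_mod_cast h.pos
  -- The radius R = 4(|F₀| + 1) makes ‖Φ(t, 0)‖ ≤ R/4, which is the room left by the Lipschitz
  -- constant: (c - 1/4)R + R/4 = cR.
  refine ⟨4 * (|F₀| + 1), min r₁ r₂, lt_min hr₁ hr₂, by positivity, fun r hr => ?_⟩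
  have hb1 : Metric.ball (0 : ℂ) r ⊆ Metric.ball 0 r₁ :=
    Metric.ball_subset_ball (hr.2.trans (min_le_left _ _))
  have hb2 : Metric.ball (0 : ℂ) r ⊆ Metric.ball 0 r₂ :=
    Metric.ball_subset_ball (hr.2.trans (min_le_right _ _))
  refine ⟨fun P hP t ht => hr₂' P hP t (hb2 ht), fun P hP => ?_⟩
  refine exists_holomorphic_solution (q := c - 1 / 4) h.pos (by positivity) (by linarith)
    (by linarith) ?_ ?_ (fun t ht => hr₂' P hP t (hb2 ht)) L (hL P hP)
  · exact (h.contDiff.comp (f := fun y : ℂ × E => (P, y)) (by fun_prop)).differentiable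
      (by norm_num)
  · intro t ht Y hY
    have h1 := hr₂' P hP t (hb2 ht) Y 0 hY (by simpa using by positivity)
    have h2 := (hr₁' (P, 0) ⟨hP, rfl⟩ t (hb1 ht)).le
    simp only [smul_zero, add_zero, sub_zero] at h1 h2
    have h3 := norm_le_norm_sub_add (Φ P t Y + (c : ℂ) • Y) (Φ P t 0)
    have h4 : ((c : ℝ) - 1 / 4) * ‖Y‖ ≤ (c - 1 / 4) * (4 * (|F₀| + 1)) :=
      mul_le_mul_of_nonneg_left hY (by linarith)
    linarith

/-- A bounded solution on an interval to the left of the singular point. -/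
structure IsLeftSolution (Φ : ℂ → E → E) (r C : ℝ) (Y : ℝ → E) : Prop where
  bound : ∀ t ∈ Ioo (-r) 0, ‖Y t‖ ≤ C
  solves : ∀ t ∈ Ioo (-r) 0, ∃ Y', HasDerivAt Y Y' t ∧ t • Y' = Φ t (Y t)

lemma ofReal_mem_ball_of_mem_Ioo {r t : ℝ} (ht : t ∈ Ioo (-r) 0) :
    (t : ℂ) ∈ Metric.ball (0 : ℂ) r := by
  rw [mem_ball_zero_iff, Complex.norm_real, Real.norm_eq_abs, abs_of_neg ht.2]
  linarith [ht.1]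

/-- The bound C is arbitrary, at the price of an interval depending on C. This is what allows a
comparison with a trajectory about whose difference quotients only boundedness is known. -/
lemma IsBriotBouquetFamily.eq_of_isLeftSolution (h : IsBriotBouquetFamily Φ 𝒦 c) (C : ℝ) :
    ∃ r₀ > 0, ∀ r ∈ Ioc 0 r₀, ∀ P ∈ 𝒦, ∀ Y Z : ℝ → E, IsLeftSolution (Φ P) r C Y →
      IsLeftSolution (Φ P) r C Z → ∀ t ∈ Ioo (-r) 0, Y t = Z t := by
  obtain ⟨r₀, hr₀, hl⟩ := h.exists_lipschitz C
  have hc1 : (1 : ℝ) ≤ c := by exact_mod_cast h.pos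
  refine ⟨r₀, hr₀, fun r hr P hP Y Z hY hZ t ht => ?_⟩
  choose! Y' hY' heY using hY.solves
  choose! Z' hZ' heZ using hZ.solves
  have := norm_sub_le_of_briotBouquet (Φ₁ := fun t => Φ P t) (Φ₂ := fun t => Φ P t)
    (q := c - 1 / 4) (ε := 0) h.pos (by linarith) (by linarith) hY' hZ' heY heZ
    hY.bound hZ.bound (fun s hs => by
      have := hl P hP s (Metric.ball_subset_ball hr.2 (ofReal_mem_ball_of_mem_Ioo hs)) _ _
        (hY.bound s hs) (hZ.bound s hs)
      rw [add_zero]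
      exact_mod_cast this) ht
  rw [zero_div] at this
  exact sub_eq_zero.1 (norm_le_zero_iff.1 this)

/-- By compactness the two fields differ by less than ε/4 for close parameters; dividing by the
contraction gap 1/4 gives ε. -/
lemma IsBriotBouquetFamily.close_of_isLeftSolution (h : IsBriotBouquetFamily Φ 𝒦 c) {R r : ℝ}
    (hl : ∀ P ∈ 𝒦, ∀ t ∈ Metric.ball (0 : ℂ) r, ∀ Y Z, ‖Y‖ ≤ R → ‖Z‖ ≤ R →
        ‖(Φ P t Y + (c : ℂ) • Y) - (Φ P t Z + (c : ℂ) • Z)‖ ≤ (c - 1 / 4) * ‖Y - Z‖)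
    {P : A} (hP : P ∈ 𝒦) {ε : ℝ} (hε : 0 < ε) :
    ∃ δ > 0, ∀ Q ∈ 𝒦, dist Q P < δ → ∀ Y Z : ℝ → E, IsLeftSolution (Φ P) r R Y →
      IsLeftSolution (Φ Q) r R Z → ∀ t ∈ Ioo (-r) 0, ‖Y t - Z t‖ ≤ ε := by
  have : ProperSpace E := FiniteDimensional.proper ℂ E
  have hc1 : (1 : ℝ) ≤ c := by exact_mod_cast h.pos
  have hn : IsOpen {x : (ℂ × E) × A | ‖Φ P x.1.1 x.1.2 - Φ x.2 x.1.1 x.1.2‖ < ε / 4} := by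
    refine isOpen_lt (Continuous.norm (Continuous.sub ?_ ?_)) continuous_const
    · exact h.contDiff.continuous.comp (f := fun x : (ℂ × E) × A => (P, x.1.1, x.1.2)) (by fun_prop)
    · exact h.contDiff.continuous.comp (f := fun x : (ℂ × E) × A => (x.2, x.1.1, x.1.2)) (by fun_prop)
  obtain ⟨u, v, -, hv, hSu, hv0, huv⟩ := generalized_tube_lemma
    ((isCompact_closedBall (0 : ℂ) r).prod (isCompact_closedBall (0 : E) R))
    (isCompact_singleton (x := P)) hn (by
      rintro ⟨x, t⟩ ⟨hx, ht⟩
      simp only [mem_singleton_iff] at ht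
      simp [ht, hε])
  obtain ⟨δ, hδ, hδv⟩ := Metric.isOpen_iff.1 hv P (hv0 rfl)
  refine ⟨δ, hδ, fun Q hQ hQP Y Z hY hZ t ht => ?_⟩
  choose! Y' hY' heY using hY.solves
  choose! Z' hZ' heZ using hZ.solves
  have := norm_sub_le_of_briotBouquet (Φ₁ := fun t => Φ P t) (Φ₂ := fun t => Φ Q t)
    (q := c - 1 / 4) (ε := ε / 4) h.pos (by linarith) (by linarith) hY' hZ' heY heZ
    hY.bound hZ.bound (fun s hs => by
      have hsb := ofReal_mem_ball_of_mem_Ioo hs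
      have h1 := hl P hP s hsb _ _ (hY.bound s hs) (hZ.bound s hs)
      have h2 : ‖Φ P s (Z s) - Φ Q s (Z s)‖ < ε / 4 :=
        huv (mk_mem_prod (hSu (mk_mem_prod (Metric.ball_subset_closedBall hsb)
          (by simpa using hZ.bound s hs))) (hδv hQP))
      have h3 := norm_add_le ((Φ P s (Y s) + (c : ℂ) • Y s) - (Φ P s (Z s) + (c : ℂ) • Z s))
        (Φ P s (Z s) - Φ Q s (Z s))
      have h4 : (Φ P s (Y s) + (c : ℂ) • Y s) - (Φ P s (Z s) + (c : ℂ) • Z s) +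
          (Φ P s (Z s) - Φ Q s (Z s)) =
          (Φ P s (Y s) + (c : ℝ) • Y s) - (Φ Q s (Z s) + (c : ℝ) • Z s) := by
        rw [← Complex.coe_smul, ← Complex.coe_smul]
        push_cast
        abel
      rw [← h4]
      linarith) ht
  refine this.trans (le_of_eq ?_)
  ring

end Family

/-! ### Algebra at the sonic points, parametrized by n = 1/ω. -/

section SonicPoint

/-- The value of `4πρ / ((4 - 3γ) ω)` at a sonic point with `1 / ω = n`. -/
def sonicD (γ n : ℝ) : ℝ := 2 + (γ - 1) * n + (γ - 1) * (2 - γ) * n ^ 2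

/-- The discriminant of the quadratic equation for the logarithmic density slope. -/
def sonicDisc (γ n : ℝ) : ℝ :=
  ((9 - 7 * γ) * n - 8) ^ 2 + 4 * (γ + 1) * (3 - (4 - 3 * γ) * n) * ((γ - 1) * (2 - γ) * n ^ 2 - 2)

/-- The logarithmic density slope of the Larson-Penston-Hunter branch. -/
def sonicP (γ n : ℝ) : ℝ := ((9 - 7 * γ) * n - 8 - √(sonicDisc γ n)) / (2 * (γ + 1))

/-- The derivative of the squared Mach number in logarithmic time at a sonic point. -/
def sonicL (γ n : ℝ) : ℝ := 2 * (4 - 3 * γ) * n - 4 - (γ + 1) * sonicP γ n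

/-- The range of `1 / ω` at the sonic points between the far-field and the Friedman one. -/
def sonicRange (γ : ℝ) : Set ℝ := Icc (1 / (2 - γ)) (3 / (4 - 3 * γ))

/-- The location of the sonic point at which `1 / ω = n`. -/
def sonicPos (γ n : ℝ) : ℝ :=
  √γ * n ^ (1 - (γ - 1) / 2) * ((4 - 3 * γ) * sonicD γ n / (4 * Real.pi)) ^ ((γ - 1) / 2)

/-- The density at the sonic point at which `1 / ω = n`. -/
def sonicRho (γ n : ℝ) : ℝ := (4 - 3 * γ) * sonicD γ n / (4 * Real.pi * n)

variable {γ n : ℝ}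

lemma pos_of_mem_sonicRange (h1 : 1 < γ) (h2 : γ < 4 / 3) (hn : n ∈ sonicRange γ) : 0 < n :=
  lt_of_lt_of_le (by have : 0 < 2 - γ := by linarith
                     positivity) hn.1

lemma mul_le_of_mem_sonicRange (h2 : γ < 4 / 3) (hn : n ∈ sonicRange γ) :
    1 ≤ (2 - γ) * n ∧ (4 - 3 * γ) * n ≤ 3 := by
  have ha : 0 < 2 - γ := by linarith
  have hb : 0 < 4 - 3 * γ := by linarith
  have := hn.1
  have := hn.2
  rw [div_le_iff₀ ha] at *
  rw [le_div_iff₀ hb] at *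
  constructor <;> linarith

/-- With s = 3 - (4-3γ)n, the discriminant times (4-3γ)² is a square plus a non-negative multiple of
s (2 - (2-γ)s)(3(5-3γ) - s). All three factors are non-negative on the range; the first two vanish
at the Friedman and at the far-field end respectively. -/
lemma sonicDisc_nonneg (h1 : 1 < γ) (h2 : γ < 4 / 3) (hn : n ∈ sonicRange γ) :
    0 ≤ sonicDisc γ n := by
  obtain ⟨h3, h4⟩ := mul_le_of_mem_sonicRange h2 hn
  have hb : 0 < 4 - 3 * γ := by linarith
  set s := 3 - (4 - 3 * γ) * n with hs
  have hs0 : 0 ≤ s := by linarith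
  have hs1 : 0 ≤ 2 - (2 - γ) * s := by
    have : 2 - (2 - γ) * s = (4 - 3 * γ) * ((2 - γ) * n - 1) := by rw [hs]; ring
    rw [this]
    exact mul_nonneg hb.le (by linarith)
  have hs2 : 0 ≤ 3 * (5 - 3 * γ) - s := by
    nlinarith
  have key : (4 - 3 * γ) ^ 2 * sonicDisc γ n =
      (5 - 3 * γ - (2 - 3 * (γ - 1) - 6 * (γ - 1) ^ 2) * s) ^ 2 +
      4 * (γ - 1) * (γ + 1) * (s * (2 - (2 - γ) * s) * (3 * (5 - 3 * γ) - s)) := by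
    rw [hs, sonicDisc]; ring
  have h5 : 0 ≤ (4 - 3 * γ) ^ 2 * sonicDisc γ n := by
    rw [key]
    have : 0 ≤ (γ - 1) * (γ + 1) := by nlinarith
    have h6 := mul_nonneg (mul_nonneg hs0 hs1) hs2
    nlinarith [mul_nonneg this h6, sq_nonneg (5 - 3 * γ - (2 - 3 * (γ - 1) - 6 * (γ - 1) ^ 2) * s)]
  exact nonneg_of_mul_nonneg_right h5 (by positivity)

lemma sonicL_eq (h1 : 1 < γ) : sonicL γ n = ((7 - 5 * γ) * n + √(sonicDisc γ n)) / 2 := by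
  have : γ + 1 ≠ 0 := by linarith
  rw [sonicL, sonicP]
  field_simp
  ring

/-- Here 7 - 5γ > 0 because γ < 4/3 < 7/5. As V'(0) = -L, positivity makes V > 0 to the left of the
sonic point and keeps σ(0) = -1/L finite. -/
lemma sonicL_pos (h1 : 1 < γ) (h2 : γ < 4 / 3) (hn : n ∈ sonicRange γ) : 0 < sonicL γ n := by
  have hn0 := pos_of_mem_sonicRange h1 h2 hn
  rw [sonicL_eq h1]
  have h3 : 0 < (7 - 5 * γ) * n := mul_pos (by linarith) hn0
  have := Real.sqrt_nonneg (sonicDisc γ n)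
  linarith

lemma sonicP_sqrt (h1 : 1 < γ) :
    √(sonicDisc γ n) = (9 - 7 * γ) * n - 8 - 2 * (γ + 1) * sonicP γ n := by
  have : γ + 1 ≠ 0 := by linarith
  rw [sonicP]
  field_simp
  ring

lemma sonicP_quadratic (h1 : 1 < γ) (h2 : γ < 4 / 3) (hn : n ∈ sonicRange γ) :
    (γ + 1) * sonicP γ n ^ 2 - ((9 - 7 * γ) * n - 8) * sonicP γ n -
      (3 - (4 - 3 * γ) * n) * ((γ - 1) * (2 - γ) * n ^ 2 - 2) = 0 := by
  have h := Real.sq_sqrt (sonicDisc_nonneg h1 h2 hn)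
  rw [sonicP_sqrt h1, sonicDisc] at h
  have h3 : 0 < 4 * (γ + 1) := by linarith
  have h4 : 4 * (γ + 1) * ((γ + 1) * sonicP γ n ^ 2 - ((9 - 7 * γ) * n - 8) * sonicP γ n -
      (3 - (4 - 3 * γ) * n) * ((γ - 1) * (2 - γ) * n ^ 2 - 2)) = 0 := by linarith
  exact (mul_eq_zero.1 h4).resolve_left h3.ne'

lemma R₁_inv (h1 : 1 < γ) (h2 : γ < 4 / 3) (hn : n ∈ sonicRange γ) : R₁ γ n⁻¹ = sonicP γ n := by
  have hn0 := pos_of_mem_sonicRange h1 h2 hn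
  have h3 : (n⁻¹) ^ 3 * branchDisc γ n⁻¹ = (n⁻¹ ^ 3) ^ 2 * sonicDisc γ n := by
    rw [branchDisc, sonicDisc]
    field_simp
    ring
  rw [R₁, h3, Real.sqrt_mul (by positivity), Real.sqrt_sq (by positivity), sonicP]
  have : γ + 1 ≠ 0 := by linarith
  field_simp

lemma continuous_sonicP : Continuous (sonicP γ) := by
  unfold sonicP sonicDisc
  fun_prop

lemma continuous_sonicL : Continuous (sonicL γ) := by
  unfold sonicL
  have := continuous_sonicP (γ := γ)
  fun_prop

lemma continuous_sonicD : Continuous (sonicD γ) := by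
  unfold sonicD
  fun_prop

lemma sonicP_farField (h1 : 1 < γ) (h2 : γ < 4 / 3) : sonicP γ (1 / (2 - γ)) = -(2 / (2 - γ)) := by
  have ha : 2 - γ ≠ 0 := by linarith
  have hb : γ + 1 ≠ 0 := by linarith
  have h3 : sonicDisc γ (1 / (2 - γ)) = ((5 * γ - 3) / (2 - γ)) ^ 2 := by
    rw [sonicDisc]
    field_simp
    ring
  rw [sonicP, h3, Real.sqrt_sq (div_nonneg (by linarith) (by linarith))]
  field_simp
  ring

/-- At n_F the constant term of the quadratic for the slope vanishes, so one root is 0, the slope of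
the Friedman solution. The LPH branch takes the other, negative root, which is what drives nearby
solutions across the Friedman velocity. -/
lemma sonicP_friedman (h1 : 1 < γ) (h2 : γ < 4 / 3) : sonicP γ (3 / (4 - 3 * γ)) < 0 := by
  have ha : 0 < 4 - 3 * γ := by linarith
  have h4 : (9 - 7 * γ) * (3 / (4 - 3 * γ)) - 8 = -(5 - 3 * γ) / (4 - 3 * γ) := by
    rw [eq_div_iff ha.ne', sub_mul, mul_assoc, div_mul_cancel₀ _ ha.ne']
    ring
  rw [sonicP, h4]
  refine div_neg_of_neg_of_pos ?_ (by linarith)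
  have := Real.sqrt_nonneg (sonicDisc γ (3 / (4 - 3 * γ)))
  have : -(5 - 3 * γ) / (4 - 3 * γ) < 0 := div_neg_of_neg_of_pos (by linarith) ha
  linarith

lemma sonicD_pos (h1 : 1 < γ) (h2 : γ < 4 / 3) (hn : 0 < n) : 0 < sonicD γ n := by
  unfold sonicD
  have : 0 < γ - 1 := by linarith
  have : 0 < 2 - γ := by linarith
  positivity

lemma sonicRho_pos (h1 : 1 < γ) (h2 : γ < 4 / 3) (hn : 0 < n) : 0 < sonicRho γ n := by
  unfold sonicRho
  have := sonicD_pos h1 h2 hn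
  have : 0 < 4 - 3 * γ := by linarith
  positivity

lemma sonicPos_pos (h1 : 1 < γ) (h2 : γ < 4 / 3) (hn : 0 < n) : 0 < sonicPos γ n := by
  unfold sonicPos
  have := sonicD_pos h1 h2 hn
  have : 0 < 4 - 3 * γ := by linarith
  positivity

lemma sonicPos_sq (h1 : 1 < γ) (h2 : γ < 4 / 3) (hn : 0 < n) :
    sonicPos γ n ^ 2 = γ * n ^ 2 * sonicRho γ n ^ (γ - 1) := by
  have hD := sonicD_pos h1 h2 hn
  have hd : 0 < 4 - 3 * γ := by linarith
  have h3 : (4 - 3 * γ) * sonicD γ n / (4 * Real.pi) = sonicRho γ n * n := by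
    rw [sonicRho]; field_simp
  have hρ := sonicRho_pos h1 h2 hn
  rw [sonicPos, h3, Real.mul_rpow hρ.le hn.le, mul_pow, mul_pow, mul_pow,
    Real.sq_sqrt (by linarith)]
  rw [← Real.rpow_natCast (n ^ (1 - (γ - 1) / 2)), ← Real.rpow_natCast (n ^ ((γ - 1) / 2)),
    ← Real.rpow_natCast (sonicRho γ n ^ ((γ - 1) / 2)), ← Real.rpow_mul hn.le,
    ← Real.rpow_mul hn.le, ← Real.rpow_mul hρ.le]
  have h4 : n ^ ((1 - (γ - 1) / 2) * ((2 : ℕ) : ℝ)) * n ^ ((γ - 1) / 2 * ((2 : ℕ) : ℝ)) = n ^ 2 := by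
    rw [← Real.rpow_add hn, ← Real.rpow_natCast n 2]
    congr 1
    push_cast
    ring
  have h5 : (γ - 1) / 2 * ((2 : ℕ) : ℝ) = γ - 1 := by push_cast; ring
  rw [← h4, h5]
  ring

lemma sonicPos_strictMonoOn (h1 : 1 < γ) (h2 : γ < 4 / 3) :
    StrictMonoOn (sonicPos γ) (Ioi 0) := by
  intro a ha b hb hab
  simp only [mem_Ioi] at ha hb
  have hd : 0 < 4 - 3 * γ := by linarith
  have hDa := sonicD_pos h1 h2 ha
  have h3 : a ^ (1 - (γ - 1) / 2) < b ^ (1 - (γ - 1) / 2) :=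
    Real.rpow_lt_rpow ha.le hab (by linarith)
  have hD : sonicD γ a ≤ sonicD γ b := by
    unfold sonicD
    have : 0 < γ - 1 := by linarith
    have : 0 < 2 - γ := by linarith
    gcongr
  have h4 : ((4 - 3 * γ) * sonicD γ a / (4 * Real.pi)) ^ ((γ - 1) / 2) ≤
      ((4 - 3 * γ) * sonicD γ b / (4 * Real.pi)) ^ ((γ - 1) / 2) := by
    have : 0 ≤ (γ - 1) / 2 := by linarith
    gcongr
  unfold sonicPos
  refine mul_lt_mul (mul_lt_mul_of_pos_left h3 (Real.sqrt_pos.2 (by linarith))) h4 ?_ (by positivity)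
  positivity

lemma sonicPos_continuousOn (h1 : 1 < γ) (h2 : γ < 4 / 3) :
    ContinuousOn (sonicPos γ) (Ioi 0) := by
  intro a ha
  simp only [mem_Ioi] at ha
  have hd : 0 < 4 - 3 * γ := by linarith
  have hDa := sonicD_pos h1 h2 ha
  have hc := continuous_sonicD (γ := γ)
  refine ContinuousAt.continuousWithinAt ?_
  unfold sonicPos
  refine ContinuousAt.mul (continuousAt_const.mul
    (Real.continuousAt_rpow_const _ _ (Or.inl ha.ne'))) ?_
  exact ContinuousAt.rpow_const (by fun_prop) (Or.inl (by positivity))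

lemma sonicPos_farField (h1 : 1 < γ) (h2 : γ < 4 / 3) : sonicPos γ (1 / (2 - γ)) = yf γ := by
  have ha : 0 < 2 - γ := by linarith
  have hd : 0 < 4 - 3 * γ := by linarith
  have hn : 0 < 1 / (2 - γ) := by positivity
  have hyf : 0 ≤ yf γ := by unfold yf; positivity
  rw [← sq_eq_sq₀ (sonicPos_pos h1 h2 hn).le hyf, sonicPos_sq h1 h2 hn]
  have h3 : sonicRho γ (1 / (2 - γ)) = (4 - 3 * γ) / (2 * Real.pi) := by
    rw [sonicRho, sonicD]
    field_simp
    ring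
  rw [h3, yf, mul_pow, div_pow (√γ), Real.sq_sqrt (by linarith), ← Real.rpow_natCast (_ ^ ((γ - 1) / 2)),
    ← Real.rpow_mul (by positivity)]
  have h5 : (γ - 1) / 2 * ((2 : ℕ) : ℝ) = γ - 1 := by push_cast; ring
  rw [h5]
  field_simp

lemma sonicPos_friedman (h1 : 1 < γ) (h2 : γ < 4 / 3) : sonicPos γ (3 / (4 - 3 * γ)) = yF γ := by
  have ha : 0 < 2 - γ := by linarith
  have hd : 0 < 4 - 3 * γ := by linarith
  have hn : 0 < 3 / (4 - 3 * γ) := by positivity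
  have hyf : 0 ≤ yF γ := by unfold yF; positivity
  rw [← sq_eq_sq₀ (sonicPos_pos h1 h2 hn).le hyf, sonicPos_sq h1 h2 hn]
  have h3 : sonicRho γ (3 / (4 - 3 * γ)) = (6 * Real.pi)⁻¹ := by
    rw [sonicRho, sonicD]
    field_simp
    ring
  rw [h3, yF, mul_pow, div_pow, Real.sq_sqrt (by positivity), Real.inv_rpow (by positivity)]
  field_simp

/-- The velocity is positive at a sonic point, and determines it. -/
lemma sonic_unique (h1 : 1 < γ) (h2 : γ < 4 / 3) {y r w : ℝ} (hy : 0 < y) (hr : 0 < r)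
    (hG : G γ y r w = 0) (hh : h γ r w = 0) :
    0 < w ∧ r = sonicRho γ w⁻¹ ∧ y = sonicPos γ w⁻¹ := by
  have hd : 0 < 4 - 3 * γ := by linarith
  have hw : 0 < w := by
    by_contra hw
    have h3 : 0 ≤ -(4 * Real.pi * r * w / (4 - 3 * γ)) := by
      rw [← neg_div]
      refine div_nonneg ?_ hd.le
      have : 0 < 4 * Real.pi * r := by positivity
      nlinarith
    rw [h] at hh
    -- For w ≤ 0 the density term of h is non-negative, while the rest is a quadratic in w with
    -- discriminant (γ-1)(9γ-17) < 0. Hence h > 0, a contradiction.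
    nlinarith [sq_nonneg (4 * w + (γ - 1)), mul_pos (sub_pos.2 h1) (show 0 < 17 - 9 * γ by linarith)]
  have hn : 0 < w⁻¹ := inv_pos.2 hw
  have hrho : r = sonicRho γ w⁻¹ := by
    rw [h] at hh
    have h3 : 4 * Real.pi * r * w / (4 - 3 * γ) =
      2 * w ^ 2 + (γ - 1) * w + (γ - 1) * (2 - γ) := by linarith
    rw [div_eq_iff hd.ne'] at h3
    rw [sonicRho, sonicD, eq_div_iff (by positivity)]
    field_simp
    linarith
  refine ⟨hw, hrho, ?_⟩
  rw [← sq_eq_sq₀ hy.le (sonicPos_pos h1 h2 hn).le, sonicPos_sq h1 h2 hn, ← hrho]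
  rw [G] at hG
  field_simp
  linarith

end SonicPoint

/-! ### The singular system for the difference quotients is a Briot-Bouquet family. -/

section SingularSystem

variable {𝕜 : Type*} [Field 𝕜]

/-- The right-hand side of the system for the difference quotients `Y` of the four unknowns
`1 / ω`, `4πρ / ((4 - 3γ) ω)`, `ρ' / ρ` (scaled by `K`) and `t / ν` (scaled by `K ^ 2`) at the sonic
point with values `P`. -/
def singularField (γ K : 𝕜) (P : Fin 4 → 𝕜) (t : 𝕜) (Y : Fin 4 → 𝕜) : Fin 4 → 𝕜 :=
  let n := P 0 + t * Y 0
  let D := P 1 + t * Y 1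
  let p := P 2 + t * (K * Y 2)
  let σ := P 3 + t * (K ^ 2 * Y 3)
  let ℓ := 2 * (4 - 3 * γ) * n - 4 - (γ + 1) * p
  let ℓ₁ := 2 * (4 - 3 * γ) * Y 0 - (γ + 1) * (K * Y 2)
  let e₁ := ((γ - 1) * Y 0 + 2 * (γ - 1) * (2 - γ) * Y 0 * (n + P 0)) * (3 - (4 - 3 * γ) * n + p) +
    ((γ - 1) * P 0 + 2 * (γ - 1) * (2 - γ) * P 0 ^ 2) * (K * Y 2 - (4 - 3 * γ) * Y 0) -
    Y 1 * (3 - (4 - 3 * γ) * n + 2 * p) - P 1 * (2 * (K * Y 2) - (4 - 3 * γ) * Y 0)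
  let Γ₁ := e₁ + ℓ₁ * p + (2 * (4 - 3 * γ) * P 0 - 4 - (γ + 1) * P 2) * (K * Y 2)
  ![n * (3 - (4 - 3 * γ) * n + p) - Y 0,
    D * (3 - (4 - 3 * γ) * n + 2 * p) - Y 1,
    K⁻¹ * (σ * Γ₁ + ℓ * p) - Y 2,
    (K ^ 2)⁻¹ * (σ * (K ^ 2 * Y 3 * ℓ + P 3 * ℓ₁) + σ * ℓ) - Y 3]

lemma singularField_ofReal (γ K : ℝ) (P Y : Fin 4 → ℝ) (t : ℝ) :
    singularField (γ : ℂ) K (fun i => (P i : ℂ)) t (fun i => (Y i : ℂ)) =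
      fun i => ((singularField γ K P t Y i : ℝ) : ℂ) := by
  funext i
  fin_cases i <;> simp [singularField]

lemma contDiff_singularField (γ K : ℂ) :
    ContDiff ℂ 2 (fun x : (Fin 4 → ℂ) × ℂ × (Fin 4 → ℂ) => singularField γ K x.1 x.2.1 x.2.2) := by
  rw [contDiff_pi]
  intro i
  fin_cases i <;> simp [singularField] <;> fun_prop

/-- The values of the four unknowns at the sonic point with `1 / ω = n`. -/
def sonicParam (γ n : ℝ) : Fin 4 → ℝ := ![n, sonicD γ n, sonicP γ n, -(sonicL γ n)⁻¹]

/-- In the maximum norm each diagonal entry is at most c - 1 in modulus; for c - 1 + κ this uses -κ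
≤ c ≤ 2c - 2. The scaling by K makes each coupling term at most 1/4, and no row has more than two.
-/
lemma norm_singular_coupling {c : ℕ} {κ C₁ C₂ C₃ C₄ K : ℝ} (hκ : κ ≤ 0) (hc : -κ ≤ c) (hc2 : 2 ≤ c)
    (hK : 1 ≤ K) (h1 : 4 * |C₁| ≤ K) (h2 : 4 * |C₂| ≤ K) (h3 : 4 * |C₃| ≤ K) (h4 : 4 * |C₄| ≤ K)
    (Z : Fin 4 → ℂ) :
    ‖(![((c : ℂ) - 1) * Z 0, ((c : ℂ) - 1) * Z 1,
      ((c : ℂ) - 1 + κ) * Z 2 + (K : ℂ)⁻¹ * (C₁ * Z 0 + C₂ * Z 1),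
      ((c : ℂ) - 2) * Z 3 + ((K : ℂ) ^ 2)⁻¹ * C₃ * Z 0 + (K : ℂ)⁻¹ * C₄ * Z 2] : Fin 4 → ℂ)‖ ≤
      (c - 1 / 2) * ‖Z‖ := by
  have hc2' : (2 : ℝ) ≤ c := by exact_mod_cast hc2
  have hK0 : 0 < K := by linarith
  have hZ : ∀ i, ‖Z i‖ ≤ ‖Z‖ := norm_le_pi_norm Z
  have hZ0 := norm_nonneg Z
  have hb : ∀ C : ℝ, 4 * |C| ≤ K → ∀ i, ‖((K⁻¹ : ℝ) : ℂ) * (C * Z i)‖ ≤ 1 / 4 * ‖Z‖ := by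
    intro C hC i
    rw [norm_mul, norm_mul, Complex.norm_real, Complex.norm_real, Real.norm_eq_abs,
      Real.norm_eq_abs, abs_of_pos (inv_pos.2 hK0), ← mul_assoc]
    have : K⁻¹ * |C| ≤ 1 / 4 := by
      rw [inv_mul_le_iff₀ hK0]; linarith
    exact mul_le_mul this (hZ i) (norm_nonneg _) (by norm_num)
  rw [pi_norm_le_iff_of_nonneg (by nlinarith)]
  intro i
  have hcc : ∀ x : ℝ, |x| ≤ c - 1 → ∀ i, ‖(x : ℂ) * Z i‖ ≤ (c - 1) * ‖Z‖ := by
    intro x hx i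
    rw [norm_mul, Complex.norm_real, Real.norm_eq_abs]
    exact mul_le_mul hx (hZ i) (norm_nonneg _) (by linarith)
  fin_cases i
  · have := hcc (c - 1) (by rw [abs_of_nonneg (by linarith)]) 0
    push_cast at this
    simp only [Fin.zero_eta, Matrix.cons_val_zero]
    linarith
  · have := hcc (c - 1) (by rw [abs_of_nonneg (by linarith)]) 1
    push_cast at this
    simp only [Fin.mk_one, Matrix.cons_val_one, Matrix.cons_val_zero]
    linarith
  · have e1 := hcc (c - 1 + κ) (by rw [abs_le]; constructor <;> linarith) 2
    have e2 := hb C₁ h1 0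
    have e3 := hb C₂ h2 1
    push_cast at e1 e2 e3
    simp only [Fin.reduceFinMk, Matrix.cons_val]
    rw [mul_add]
    have := norm_add_le (((c : ℂ) - 1 + κ) * Z 2) ((K : ℂ)⁻¹ * (C₁ * Z 0) + (K : ℂ)⁻¹ * (C₂ * Z 1))
    have := norm_add_le ((K : ℂ)⁻¹ * (C₁ * Z 0)) ((K : ℂ)⁻¹ * (C₂ * Z 1))
    linarith
  · have e1 := hcc (c - 2) (by rw [abs_of_nonneg (by linarith)]; linarith) 3
    have h5 : 4 * |K⁻¹ * C₃| ≤ K := by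
      rw [abs_mul, abs_of_pos (inv_pos.2 hK0)]
      have : K⁻¹ * |C₃| ≤ 1 * |C₃| := by
        gcongr
        exact inv_le_one_of_one_le₀ hK
      linarith
    have e2 := hb _ h5 0
    have e3 := hb C₄ h4 2
    push_cast at e1 e2 e3
    simp only [Fin.reduceFinMk, Matrix.cons_val]
    have e4 : ((K : ℂ) ^ 2)⁻¹ * C₃ * Z 0 = (K : ℂ)⁻¹ * ((K : ℂ)⁻¹ * C₃ * Z 0) := by
      rw [pow_two, mul_inv]; ring
    rw [e4, mul_assoc _ (C₄ : ℂ)]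
    have := norm_add_le (((c : ℂ) - 2) * Z 3 + (K : ℂ)⁻¹ * ((K : ℂ)⁻¹ * C₃ * Z 0))
      ((K : ℂ)⁻¹ * (C₄ * Z 2))
    have := norm_add_le (((c : ℂ) - 2) * Z 3) ((K : ℂ)⁻¹ * ((K : ℂ)⁻¹ * C₃ * Z 0))
    linarith

/-- At t = 0 the field is affine in Y with a lower triangular linear part. The shifted diagonal is c
- 1, c - 1, c - 1 + κ, c - 2, where κ is s times the square root of the discriminant at the LPH
root, hence non-positive. -/
lemma singularField_zero_sub {γ K n D p s : ℂ} (hK : K ≠ 0)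
    (hs : s * (2 * (4 - 3 * γ) * n - 4 - (γ + 1) * p) = -1)
    (hD : D = 2 + (γ - 1) * n + (γ - 1) * (2 - γ) * n ^ 2) (c : ℂ) (Y Z : Fin 4 → ℂ) :
    (singularField γ K ![n, D, p, s] 0 Y + c • Y) - (singularField γ K ![n, D, p, s] 0 Z + c • Z) =
    ![(c - 1) * (Y - Z) 0, (c - 1) * (Y - Z) 1,
      (c - 1 + s * ((9 - 7 * γ) * n - 8 - 2 * (γ + 1) * p)) * (Y - Z) 2 +
        K⁻¹ * (s * (((γ - 1) + 4 * (γ - 1) * (2 - γ) * n) * (3 - (4 - 3 * γ) * n + p) -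
          ((γ - 1) * n + 2 * (γ - 1) * (2 - γ) * n ^ 2) * (4 - 3 * γ) + D * (4 - 3 * γ) +
          2 * (4 - 3 * γ) * p) * (Y - Z) 0 + -(s * (3 - (4 - 3 * γ) * n + 2 * p)) * (Y - Z) 1),
      (c - 2) * (Y - Z) 3 + (K ^ 2)⁻¹ * (2 * (4 - 3 * γ) * s ^ 2) * (Y - Z) 0 +
        K⁻¹ * (-(s ^ 2 * (γ + 1))) * (Y - Z) 2] := by
  funext i
  fin_cases i
  · simp [singularField, Matrix.vecHead, Matrix.vecTail]; ring
  · simp [singularField, Matrix.vecHead, Matrix.vecTail]; ring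
  · simp [singularField, Matrix.vecHead, Matrix.vecTail]
    subst hD
    field_simp
    ring
  · simp [singularField, Matrix.vecHead, Matrix.vecTail]
    field_simp
    linear_combination (K ^ 2 * (Y 3 - Z 3)) * hs

/-- The singular system at the sonic points is a Briot-Bouquet family. -/
lemma exists_isBriotBouquetFamily {γ : ℝ} (h1 : 1 < γ) (h2 : γ < 4 / 3) :
    ∃ (c : ℕ) (K : ℝ), 0 < K ∧ IsBriotBouquetFamily (singularField (γ : ℂ) (K : ℂ))
      ((fun n i => (sonicParam γ n i : ℂ)) '' sonicRange γ) c := by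
  have hL0 : ∀ n ∈ sonicRange γ, sonicL γ n ≠ 0 := fun n hn => (sonicL_pos h1 h2 hn).ne'
  have hcL : ContinuousOn (fun n => (sonicL γ n)⁻¹) (sonicRange γ) :=
    continuous_sonicL.continuousOn.inv₀ hL0
  have hcP := continuous_sonicP (γ := γ)
  have hcD := continuous_sonicD (γ := γ)
  have hJ : IsCompact (sonicRange γ) := isCompact_Icc
  have bound : ∀ f : ℝ → ℝ, ContinuousOn f (sonicRange γ) → ∃ B, ∀ n ∈ sonicRange γ, |f n| ≤ B :=
    fun f hf => hJ.exists_bound_of_continuousOn hf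
  obtain ⟨B₀, hB₀⟩ := bound (fun n => -(sonicL γ n)⁻¹ *
    ((9 - 7 * γ) * n - 8 - 2 * (γ + 1) * sonicP γ n)) (by fun_prop)
  obtain ⟨B₁, hB₁⟩ := bound (fun n => -(sonicL γ n)⁻¹ *
    (((γ - 1) + 4 * (γ - 1) * (2 - γ) * n) * (3 - (4 - 3 * γ) * n + sonicP γ n) -
      ((γ - 1) * n + 2 * (γ - 1) * (2 - γ) * n ^ 2) * (4 - 3 * γ) + sonicD γ n * (4 - 3 * γ) +
          2 * (4 - 3 * γ) * sonicP γ n)) (by fun_prop)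
  obtain ⟨B₂, hB₂⟩ := bound (fun n => -(-(sonicL γ n)⁻¹ *
    (3 - (4 - 3 * γ) * n + 2 * sonicP γ n))) (by fun_prop)
  obtain ⟨B₃, hB₃⟩ := bound (fun n => 2 * (4 - 3 * γ) * (-(sonicL γ n)⁻¹) ^ 2) (by fun_prop)
  obtain ⟨B₄, hB₄⟩ := bound (fun n => -((-(sonicL γ n)⁻¹) ^ 2 * (γ + 1))) (by fun_prop)
  -- The shift c dominates |κ| uniformly in n, and K dominates the off-diagonal coefficients. The
  -- two choices are independent.
  obtain ⟨c, hc⟩ := exists_nat_ge (B₀ + 2)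
  set K : ℝ := 1 + 4 * (|B₁| + |B₂| + |B₃| + |B₄|) with hK
  have hKpos : 0 < K := by positivity
  have hB₀' : 0 ≤ B₀ := by
    have h3 : (1 / (2 - γ) : ℝ) ∈ sonicRange γ := by
      refine ⟨le_rfl, ?_⟩
      rw [div_le_div_iff₀ (by linarith) (by linarith)]
      linarith
    exact (abs_nonneg _).trans (hB₀ _ h3)
  have hc2 : 2 ≤ c := by
    have : (2 : ℝ) ≤ c := by linarith
    exact_mod_cast this
  refine ⟨c, K, hKpos, by omega, hJ.image_of_continuousOn ?_, contDiff_singularField _ _, ?_⟩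
  · rw [continuousOn_pi]
    intro i
    refine Complex.continuous_ofReal.comp_continuousOn ?_
    fin_cases i <;> simp [sonicParam] <;> fun_prop
  · rintro _ ⟨n, hn, rfl⟩ Y Z
    have hP : (fun i => (sonicParam γ n i : ℂ)) = ![(n : ℂ), (sonicD γ n : ℂ), (sonicP γ n : ℂ),
        ((-(sonicL γ n)⁻¹ : ℝ) : ℂ)] := by
      funext i
      fin_cases i <;> simp [sonicParam]
    have hs : -(sonicL γ n)⁻¹ * (2 * (4 - 3 * γ) * n - 4 - (γ + 1) * sonicP γ n) = -1 := by
      rw [← sonicL, neg_mul, inv_mul_cancel₀ (hL0 n hn)]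
    have hκ : -(sonicL γ n)⁻¹ * ((9 - 7 * γ) * n - 8 - 2 * (γ + 1) * sonicP γ n) ≤ 0 := by
      rw [← sonicP_sqrt h1]
      have := mul_nonneg (inv_pos.2 (sonicL_pos h1 h2 hn)).le (Real.sqrt_nonneg (sonicDisc γ n))
      linarith
    beta_reduce
    rw [hP, singularField_zero_sub (by exact_mod_cast hKpos.ne') (by exact_mod_cast hs)
      (by rw [sonicD]; push_cast; rfl)]
    have habs : ∀ {x B : ℝ}, |x| ≤ B → |B| ≤ |B₁| + |B₂| + |B₃| + |B₄| → 4 * |x| ≤ K := by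
      intro x B hx hB
      have := le_abs_self B
      linarith
    have := abs_nonneg B₁
    have := abs_nonneg B₂
    have := abs_nonneg B₃
    have := abs_nonneg B₄
    have key := norm_singular_coupling (c := c) (K := K) hκ
      (by have := neg_le_abs (-(sonicL γ n)⁻¹ *
            ((9 - 7 * γ) * n - 8 - 2 * (γ + 1) * sonicP γ n))
          have := hB₀ n hn
          linarith) hc2 (by linarith) (habs (hB₁ n hn) (by linarith))
      (habs (hB₂ n hn) (by linarith)) (habs (hB₃ n hn) (by linarith))
      (habs (hB₄ n hn) (by linarith)) (Y - Z)
    push_cast at key ⊢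
    exact key

end SingularSystem

/-! ### Backward continuous dependence away from the sonic point. -/

section RegularFlow

variable {E : Type*} [NormedAddCommGroup E] [NormedSpace ℝ E] [FiniteDimensional ℝ E]

/-- Backward continuous dependence of solutions of an autonomous system on their final value, up
to the time to which the perturbed solution exists. -/
theorem dist_lt_of_solutions {V : E → E} {Ω : Set E} (hΩ : IsOpen Ω) (hV : ContDiffOn ℝ 1 V Ω)
    {X : ℝ → E} {a b : ℝ} (hX : ∀ t ∈ Icc a b, HasDerivAt X (V (X t)) t ∧ X t ∈ Ω)
    {ε : ℝ} (hε : 0 < ε) :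
    ∃ δ > 0, ∀ a' ∈ Icc a b, ∀ Y : ℝ → E,
      (∀ t ∈ Icc a' b, HasDerivAt Y (V (Y t)) t ∧ Y t ∈ Ω) → dist (X b) (Y b) ≤ δ →
      ∀ t ∈ Icc a' b, dist (X t) (Y t) < ε := by
  have : ProperSpace E := FiniteDimensional.proper ℝ E
  have hXc : ContinuousOn X (Icc a b) := fun t ht => (hX t ht).1.continuousAt.continuousWithinAt
  have hK : IsCompact (X '' Icc a b) := isCompact_Icc.image_of_continuousOn hXc
  obtain ⟨ε₁, hε₁, hsub⟩ := hK.exists_cthickening_subset_open hΩ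
    (by rintro _ ⟨t, ht, rfl⟩; exact (hX t ht).2)
  have hlip : LocallyLipschitzOn (Metric.cthickening ε₁ (X '' Icc a b)) V := by
    intro x hx
    obtain ⟨K, t, ht, hKt⟩ :=
      (hV.contDiffAt (hΩ.mem_nhds (hsub hx))).exists_lipschitzOnWith
    exact ⟨K, t, mem_nhdsWithin_of_mem_nhds ht, hKt⟩
  obtain ⟨L, hL⟩ := hlip.exists_lipschitzOnWith_of_compact hK.cthickening
  set η := min ε ε₁ with hη
  have hη0 : 0 < η := lt_min hε hε₁
  refine ⟨η * Real.exp (-(L * (b - a))) / 2, by positivity, fun a' ha' Y hY hXY => ?_⟩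
  set δ := η * Real.exp (-(L * (b - a))) / 2 with hδ
  have hYc : ContinuousOn Y (Icc a' b) := fun t ht => (hY t ht).1.continuousAt.continuousWithinAt
  have hXc' : ContinuousOn X (Icc a' b) := hXc.mono (Icc_subset_Icc_left ha'.1)
  by_contra! hcon
  obtain ⟨t₁, ht₁, hfar⟩ := hcon
  -- At the last time t₂ of S, both solutions have stayed in a compact tube on which V is Lipschitz
  -- throughout (t₂, b]. Grönwall in reversed time bounds the distance at t₂ by η/2, contradicting
  -- t₂ ∈ S.
  set S := {t ∈ Icc a' b | η ≤ dist (X t) (Y t)} with hS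
  have hSne : S.Nonempty := ⟨t₁, ht₁, (min_le_left _ _).trans hfar⟩
  have hSc : IsCompact S := by
    refine isCompact_Icc.of_isClosed_subset ?_ (sep_subset _ _)
    exact isClosed_Icc.isClosed_le continuousOn_const (continuous_dist.comp_continuousOn (hXc'.prodMk hYc))
  obtain ⟨t₂, ⟨ht₂, hfar₂⟩, hmax⟩ := hSc.exists_isGreatest hSne
  have hlt : ∀ t ∈ Ioc t₂ b, dist (X t) (Y t) < η := by
    intro t ht
    by_contra! h
    exact absurd (hmax ⟨⟨ht₂.1.trans ht.1.le, ht.2⟩, h⟩) (not_le.2 ht.1)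
  have hmem : ∀ s ∈ Ico 0 (b - t₂), b - s ∈ Icc a b ∧ b - s ∈ Icc a' b ∧ b - s ∈ Ioc t₂ b := by
    intro s hs
    have := ht₂.1
    have := ha'.1
    exact ⟨⟨by linarith [hs.2], by linarith [hs.1]⟩, ⟨by linarith [hs.2], by linarith [hs.1]⟩,
      ⟨by linarith [hs.2], by linarith [hs.1]⟩⟩
  have hrev : ∀ (W : ℝ → E) (s : ℝ), HasDerivAt W (V (W (b - s))) (b - s) →
      HasDerivWithinAt (fun s => W (b - s)) (-V (W (b - s))) (Ici s) s := by
    intro W s hW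
    have h1 : HasDerivAt (fun s : ℝ => b - s) (-1) s := (hasDerivAt_id s).const_sub b
    have h2 := (hW.scomp s h1).hasDerivWithinAt (s := Ici s)
    rw [neg_one_smul] at h2
    exact h2
  have hcont : ∀ (W : ℝ → E), ContinuousOn W (Icc a' b) →
      ContinuousOn (fun s => W (b - s)) (Icc 0 (b - t₂)) := by
    intro W hW
    refine hW.comp (by fun_prop) ?_
    intro s hs
    exact ⟨by linarith [hs.2, ht₂.1], by linarith [hs.1]⟩
  have hgr := dist_le_of_trajectories_ODE_of_mem (v := fun _ x => -V x) (K := L)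
    (s := fun _ => Metric.cthickening ε₁ (X '' Icc a b)) (a := 0) (b := b - t₂) (δ := δ)
    (f := fun s => X (b - s)) (g := fun s => Y (b - s)) (fun _ _ => hL.neg)
    (hcont X hXc') (fun s hs => hrev X s (hX _ (hmem s hs).1).1)
    (fun s hs => Metric.self_subset_cthickening _ (mem_image_of_mem X (hmem s hs).1))
    (hcont Y hYc) (fun s hs => hrev Y s (hY _ (hmem s hs).2.1).1)
    (fun s hs => Metric.mem_cthickening_of_dist_le _ _ _ _ (mem_image_of_mem X (hmem s hs).1)
      (by rw [dist_comm]; exact (hlt _ (hmem s hs).2.2).le.trans (min_le_right _ _)))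
    (by simpa using hXY) (b - t₂) ⟨by linarith [ht₂.2], le_rfl⟩
  simp only [sub_sub_cancel, sub_zero] at hgr
  have h1 : Real.exp (L * (b - t₂)) ≤ Real.exp (L * (b - a)) := by
    refine Real.exp_le_exp.2 (mul_le_mul_of_nonneg_left ?_ L.2)
    linarith [ht₂.1, ha'.1]
  have h2 : δ * Real.exp (L * (b - t₂)) ≤ η / 2 := by
    calc δ * Real.exp (L * (b - t₂)) ≤ δ * Real.exp (L * (b - a)) := by
          have : 0 ≤ δ := by positivity
          gcongr
      _ = η / 2 * (Real.exp (-(L * (b - a))) * Real.exp (L * (b - a))) := by rw [hδ]; ring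
      _ = η / 2 := by rw [← Real.exp_add]; simp
  linarith

lemma eqOn_of_solutions {V : E → E} {Ω : Set E} (hΩ : IsOpen Ω) (hV : ContDiffOn ℝ 1 V Ω)
    {X Y : ℝ → E} {a b : ℝ} (hX : ∀ t ∈ Icc a b, HasDerivAt X (V (X t)) t ∧ X t ∈ Ω)
    (hY : ∀ t ∈ Icc a b, HasDerivAt Y (V (Y t)) t ∧ Y t ∈ Ω) (hXY : X b = Y b) {t : ℝ}
    (ht : t ∈ Icc a b) : X t = Y t := by
  by_contra hne
  obtain ⟨δ, hδ, h⟩ := dist_lt_of_solutions hΩ hV hX (dist_pos.2 hne)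
  exact lt_irrefl _ (h a ⟨le_rfl, ht.1.trans ht.2⟩ Y hY (by rw [hXY, dist_self]; exact hδ.le) t ht)

end RegularFlow

/-! ### The autonomous system and its LPH trajectories. -/

section Trajectory

/-- `2 + (γ-1) n + (γ-1)(2-γ) n² - D`, the multiple `h / ω²` of `h`. -/
def energy (γ : ℝ) (x : ℝ × ℝ × ℝ) : ℝ :=
  2 + (γ - 1) * x.1 + (γ - 1) * (2 - γ) * x.1 ^ 2 - x.2.1

/-- The logarithmic slope of the density. -/
def slope (γ : ℝ) (x : ℝ × ℝ × ℝ) : ℝ := energy γ x / x.2.2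

/-- The autonomous vector field of the system in logarithmic time, in the unknowns `1 / ω`,
`4πρ / ((4 - 3γ) ω)` and `γ ρ^(γ-1) / (y ω)² - 1`. -/
def field (γ : ℝ) (x : ℝ × ℝ × ℝ) : ℝ × ℝ × ℝ :=
  (x.1 * (3 - (4 - 3 * γ) * x.1 + slope γ x), x.2.1 * (3 - (4 - 3 * γ) * x.1 + 2 * slope γ x),
    -((1 + x.2.2) * (2 * (4 - 3 * γ) * x.1 - 4 - (γ + 1) * slope γ x)))

/-- The subsonic region. -/
def subsonicRegion : Set (ℝ × ℝ × ℝ) := {x | 0 < x.2.2}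

lemma isOpen_subsonicRegion : IsOpen subsonicRegion := isOpen_lt (by fun_prop) (by fun_prop)

lemma contDiffOn_slope (γ : ℝ) : ContDiffOn ℝ 1 (slope γ) subsonicRegion := by
  unfold slope energy
  exact ContDiffOn.div (by fun_prop) (by fun_prop) fun x hx => ne_of_gt hx

lemma contDiffOn_field (γ : ℝ) : ContDiffOn ℝ 1 (field γ) subsonicRegion := by
  have := contDiffOn_slope γ
  unfold field
  fun_prop

/-- A subsonic trajectory on `(τ, 0)` that emanates from the sonic point with `1 / ω = n` along the
Larson-Penston-Hunter branch. -/
structure IsTraj (γ n τ : ℝ) (X : ℝ → ℝ × ℝ × ℝ) : Prop where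
  subsonic : ∀ t ∈ Ioo τ 0, X t ∈ subsonicRegion
  solves : ∀ t ∈ Ioo τ 0, HasDerivAt X (field γ (X t)) t
  germ : ∃ C, ∀ᶠ t in 𝓝[<] (0 : ℝ), |(X t).1 - n| ≤ C * |t| ∧ |(X t).2.1 - sonicD γ n| ≤ C * |t| ∧
    |slope γ (X t) - sonicP γ n| ≤ C * |t| ∧ |t / (X t).2.2 + (sonicL γ n)⁻¹| ≤ C * |t|

/-- A solution of the desingularized system on both sides of the sonic point. -/
structure IsLocalSolution (γ n r : ℝ) (N D p V : ℝ → ℝ) : Prop where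
  analytic_N : AnalyticAt ℝ N 0
  analytic_D : AnalyticAt ℝ D 0
  N_zero : N 0 = n
  D_zero : D 0 = sonicD γ n
  p_zero : p 0 = sonicP γ n
  V_zero : V 0 = 0
  N_pos : ∀ t ∈ Ioo (-r) r, 0 < N t
  D_pos : ∀ t ∈ Ioo (-r) r, 0 < D t
  V_pos : ∀ t ∈ Ioo (-r) 0, 0 < V t
  deriv_N : ∀ t ∈ Ioo (-r) r, HasDerivAt N (N t * (3 - (4 - 3 * γ) * N t + p t)) t
  deriv_D : ∀ t ∈ Ioo (-r) r, HasDerivAt D (D t * (3 - (4 - 3 * γ) * N t + 2 * p t)) t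
  deriv_V : ∀ t ∈ Ioo (-r) r,
    HasDerivAt V (-((1 + V t) * (2 * (4 - 3 * γ) * N t - 4 - (γ + 1) * p t))) t
  energy_eq : ∀ t ∈ Ioo (-r) r,
    V t * p t = 2 + (γ - 1) * N t + (γ - 1) * (2 - γ) * N t ^ 2 - D t

end Trajectory

/-! ### From the singular system to the desingularized one. -/

section LocalSolution

variable {γ n K r : ℝ}

lemma hasDerivAt_const_add_mul {f : ℝ → ℝ} {f' x₀ t v : ℝ} (hf : HasDerivAt f f' t)
    (hv : f t + t * f' = v) : HasDerivAt (fun t => x₀ + t * f t) v t := by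
  have h : HasDerivAt (fun t => x₀ + t * f t) _ t := ((hasDerivAt_id t).mul hf).const_add x₀
  refine h.congr_deriv ?_
  rw [← hv]
  simp

/-- A real solution of the singular system yields a solution of the desingularized system. -/
lemma isLocalSolution_of_singular (h1 : 1 < γ) (h2 : γ < 4 / 3) (hn : n ∈ sonicRange γ) (hK : 0 < K)
    {y y' : ℝ → Fin 4 → ℝ} (hr : 0 < r) (hA : ∀ i, AnalyticAt ℝ (fun t => y t i) 0)
    (hd : ∀ t ∈ Ioo (-r) r, ∀ i, HasDerivAt (fun t => y t i) (y' t i) t)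
    (he : ∀ t ∈ Ioo (-r) r, ∀ i, t * y' t i = singularField γ K (sonicParam γ n) t (y t) i)
    (hN : ∀ t ∈ Ioo (-r) r, 0 < n + t * y t 0)
    (hD : ∀ t ∈ Ioo (-r) r, 0 < sonicD γ n + t * y t 1)
    (hσ : ∀ t ∈ Ioo (-r) r, -(sonicL γ n)⁻¹ + t * (K ^ 2 * y t 3) < 0) :
    IsLocalSolution γ n r (fun t => n + t * y t 0) (fun t => sonicD γ n + t * y t 1)
      (fun t => sonicP γ n + t * (K * y t 2))
      (fun t => t / (-(sonicL γ n)⁻¹ + t * (K ^ 2 * y t 3))) := by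
  have hL := sonicL_pos h1 h2 hn
  have hσL : -(sonicL γ n)⁻¹ * (2 * (4 - 3 * γ) * n - 4 - (γ + 1) * sonicP γ n) = -1 := by
    rw [← sonicL, neg_mul, inv_mul_cancel₀ hL.ne']
  have hquad := sonicP_quadratic h1 h2 hn
  have h0 : (0 : ℝ) ∈ Ioo (-r) r := ⟨by linarith, hr⟩
  set σ : ℝ → ℝ := fun t => -(sonicL γ n)⁻¹ + t * (K ^ 2 * y t 3) with hσd
  set N : ℝ → ℝ := fun t => n + t * y t 0 with hNd
  set D : ℝ → ℝ := fun t => sonicD γ n + t * y t 1 with hDd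
  set p : ℝ → ℝ := fun t => sonicP γ n + t * (K * y t 2) with hpd
  have eN : ∀ t, N t = n + t * y t 0 := fun t => rfl
  have eD : ∀ t, D t = sonicD γ n + t * y t 1 := fun t => rfl
  have ep : ∀ t, p t = sonicP γ n + t * (K * y t 2) := fun t => rfl
  have eσ : ∀ t, σ t = -(sonicL γ n)⁻¹ + t * (K ^ 2 * y t 3) := fun t => rfl
  have hdN : ∀ t ∈ Ioo (-r) r, HasDerivAt N (N t * (3 - (4 - 3 * γ) * N t + p t)) t := by
    intro t ht
    refine hasDerivAt_const_add_mul (hd t ht 0) ?_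
    rw [he t ht 0]
    simp only [singularField, sonicParam, Matrix.cons_val_zero, Matrix.cons_val, ← eN, ← ep]
    ring
  have hdD : ∀ t ∈ Ioo (-r) r, HasDerivAt D (D t * (3 - (4 - 3 * γ) * N t + 2 * p t)) t := by
    intro t ht
    refine hasDerivAt_const_add_mul (hd t ht 1) ?_
    rw [he t ht 1]
    simp only [singularField, sonicParam, Matrix.cons_val_zero, Matrix.cons_val_one,
      Matrix.cons_val, ← eN, ← ep, ← eD]
    ring
  have hdp : ∀ t ∈ Ioo (-r) r, ∃ p', HasDerivAt p p' t ∧ t * p' = σ t *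
      (((γ - 1) * N t + 2 * (γ - 1) * (2 - γ) * N t ^ 2) * (3 - (4 - 3 * γ) * N t + p t) -
        D t * (3 - (4 - 3 * γ) * N t + 2 * p t) +
        (2 * (4 - 3 * γ) * N t - 4 - (γ + 1) * p t) * p t) +
        t * (2 * (4 - 3 * γ) * N t - 4 - (γ + 1) * p t) * p t := by
    intro t ht
    refine ⟨_, hasDerivAt_const_add_mul ((hd t ht 2).const_mul K) rfl, ?_⟩
    have h3 : t * (K * y' t 2) = K * (t * y' t 2) := by ring
    rw [h3, he t ht 2]
    simp only [singularField, sonicParam, Matrix.cons_val_zero, Matrix.cons_val_one,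
      Matrix.cons_val, ← eN, ← ep, ← eD, ← eσ]
    have h5 : ∀ A B : ℝ, K * B + K * (K⁻¹ * A - B) = A := fun A B => by field_simp; ring
    rw [h5, mul_add, eN, eD, ep]
    -- The part of order zero in t vanishes because the LPH slope solves its quadratic equation.
    -- This is what permits the division by t in the third component of `singularField`.
    linear_combination (norm := skip) (σ t) * hquad
    rw [sonicD]
    ring
  have hdσ : ∀ t ∈ Ioo (-r) r, ∃ σ', HasDerivAt σ σ' t ∧ t * σ' = σ t *
      (1 + σ t * (2 * (4 - 3 * γ) * N t - 4 - (γ + 1) * p t)) +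
        t * σ t * (2 * (4 - 3 * γ) * N t - 4 - (γ + 1) * p t) := by
    intro t ht
    refine ⟨_, hasDerivAt_const_add_mul ((hd t ht 3).const_mul (K ^ 2)) rfl, ?_⟩
    have h3 : t * (K ^ 2 * y' t 3) = K ^ 2 * (t * y' t 3) := by ring
    rw [h3, he t ht 3]
    simp only [singularField, sonicParam, Matrix.cons_val_zero, Matrix.cons_val_one,
      Matrix.cons_val, ← eN, ← ep, ← eD, ← eσ]
    have h5 : ∀ A B : ℝ, K ^ 2 * B + K ^ 2 * ((K ^ 2)⁻¹ * A - B) = A := fun A B => by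
      field_simp; ring
    rw [h5, mul_add, eN, ep]
    linear_combination (norm := skip) (-(σ t)) * hσL
    rw [eσ]
    ring
  have hdV : ∀ t ∈ Ioo (-r) r, HasDerivAt (fun t => t / σ t)
      (-((1 + t / σ t) * (2 * (4 - 3 * γ) * N t - 4 - (γ + 1) * p t))) t := by
    intro t ht
    obtain ⟨σ', hσ', heσ⟩ := hdσ t ht
    have hne : σ t ≠ 0 := (hσ t ht).ne
    have h : HasDerivAt (fun t => t / σ t) _ t := (hasDerivAt_id t).div hσ' hne
    refine h.congr_deriv ?_
    simp only [id]
    rw [heσ]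
    field_simp
    ring
  refine ⟨?_, ?_, by simp [hNd], by simp [hDd], by simp [hpd], by simp, hN, hD, ?_, hdN, hdD, hdV, ?_⟩
  · exact analyticAt_const.add (analyticAt_id.mul (hA 0))
  · exact analyticAt_const.add (analyticAt_id.mul (hA 1))
  · intro t ht
    exact div_pos_of_neg_of_neg ht.2 (hσ t ⟨ht.1, ht.2.trans hr⟩)
  -- In the singular system p is an independent unknown. That it is the slope is recovered as a
  -- conservation law: Vp minus the energy has derivative zero and vanishes at t = 0.
  · set Q : ℝ → ℝ := fun t => t / σ t * p t -
      (2 + (γ - 1) * N t + (γ - 1) * (2 - γ) * N t ^ 2 - D t) with hQ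
    have hdQ : ∀ t ∈ Ioo (-r) r, HasDerivAt Q 0 t := by
      intro t ht
      obtain ⟨p', hp', hep⟩ := hdp t ht
      have hne : σ t ≠ 0 := (hσ t ht).ne
      have h : HasDerivAt Q _ t := ((hdV t ht).mul hp').sub
        (((((hdN t ht).const_mul (γ - 1)).const_add 2).add
          (((hdN t ht).pow 2).const_mul ((γ - 1) * (2 - γ)))).sub (hdD t ht))
      refine h.congr_deriv ?_
      have h3 : t / σ t * p' = ((((γ - 1) * N t + 2 * (γ - 1) * (2 - γ) * N t ^ 2) *
        (3 - (4 - 3 * γ) * N t + p t) - D t * (3 - (4 - 3 * γ) * N t + 2 * p t) +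
        (2 * (4 - 3 * γ) * N t - 4 - (γ + 1) * p t) * p t) +
        t / σ t * (2 * (4 - 3 * γ) * N t - 4 - (γ + 1) * p t) * p t) := by
        rw [div_mul_eq_mul_div, hep]
        field_simp
      rw [h3]
      push_cast
      ring
    have hconst : ∀ t ∈ Ioo (-r) r, Q t = Q 0 := by
      intro t ht
      refine isOpen_Ioo.is_const_of_deriv_eq_zero isPreconnected_Ioo
        (fun s hs => (hdQ s hs).differentiableAt.differentiableWithinAt)
        (fun s hs => (hdQ s hs).deriv) ht h0
    intro t ht
    have h3 := hconst t ht
    have h4 : Q 0 = 0 := by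
      simp [hQ, hNd, hDd, sonicD]
    rw [h4] at h3
    exact sub_eq_zero.1 h3

lemma IsLocalSolution.isTraj {N D p V : ℝ → ℝ} (h : IsLocalSolution γ n r N D p V) (hr : 0 < r)
    {C : ℝ} (hC : ∀ t ∈ Ioo (-r) 0, |N t - n| ≤ C * |t| ∧ |D t - sonicD γ n| ≤ C * |t| ∧
      |p t - sonicP γ n| ≤ C * |t| ∧ |t / V t + (sonicL γ n)⁻¹| ≤ C * |t|) :
    IsTraj γ n (-r) (fun t => (N t, D t, V t)) := by
  have hsl : ∀ t ∈ Ioo (-r) 0, slope γ (N t, D t, V t) = p t := by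
    intro t ht
    rw [slope, energy, div_eq_iff (h.V_pos t ht).ne', mul_comm (p t)]
    exact (h.energy_eq t ⟨ht.1, ht.2.trans hr⟩).symm
  refine ⟨h.V_pos, fun t ht => ?_, C, ?_⟩
  · have ht' : t ∈ Ioo (-r) r := ⟨ht.1, ht.2.trans hr⟩
    rw [field, hsl t ht]
    exact (h.deriv_N t ht').prodMk ((h.deriv_D t ht').prodMk (h.deriv_V t ht'))
  · filter_upwards [Ioo_mem_nhdsLT (show -r < 0 by linarith)] with t ht
    rw [hsl t ht]
    exact hC t ht

end LocalSolution

/-! ### From trajectories back to the singular system. -/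

section LocalFamily

variable {γ n K r : ℝ}

lemma hasDerivAt_diffQuot {g : ℝ → ℝ} {g' g₀ κ t : ℝ} (hg : HasDerivAt g g' t) (ht : t ≠ 0) :
    ∃ f', HasDerivAt (fun t => κ⁻¹ * ((g t - g₀) / t)) f' t ∧
      t * f' = κ⁻¹ * g' - κ⁻¹ * ((g t - g₀) / t) := by
  refine ⟨_, (((hg.sub_const g₀).div (hasDerivAt_id t) ht).const_mul κ⁻¹), ?_⟩
  simp only [id]
  field_simp

/-- The scaled difference quotients of the four unknowns along a trajectory. -/
def trajQuot (γ n K : ℝ) (X : ℝ → ℝ × ℝ × ℝ) (t : ℝ) : Fin 4 → ℝ :=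
  ![1⁻¹ * (((X t).1 - n) / t), 1⁻¹ * (((X t).2.1 - sonicD γ n) / t),
    K⁻¹ * ((slope γ (X t) - sonicP γ n) / t),
    (K ^ 2)⁻¹ * ((t / (X t).2.2 - -(sonicL γ n)⁻¹) / t)]

/-- The converse of `isLocalSolution_of_singular`. It brings an arbitrary trajectory, not assumed
analytic at 0, under the uniqueness theorem for Briot-Bouquet systems. -/
lemma trajQuot_solves (h1 : 1 < γ) (h2 : γ < 4 / 3) (hn : n ∈ sonicRange γ) (hK : 0 < K)
    {X : ℝ → ℝ × ℝ × ℝ} {t : ℝ} (ht : t < 0) (hX : X t ∈ subsonicRegion)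
    (hd : HasDerivAt X (field γ (X t)) t) (i : Fin 4) :
    ∃ f', HasDerivAt (fun t => trajQuot γ n K X t i) f' t ∧
      t * f' = singularField γ K (sonicParam γ n) t (trajQuot γ n K X t) i := by
  have ht0 : t ≠ 0 := ht.ne
  have hV : (X t).2.2 ≠ 0 := ne_of_gt hX
  have hL := sonicL_pos h1 h2 hn
  have hσL : -(sonicL γ n)⁻¹ * (2 * (4 - 3 * γ) * n - 4 - (γ + 1) * sonicP γ n) = -1 := by
    rw [← sonicL, neg_mul, inv_mul_cancel₀ hL.ne']
  have hquad := sonicP_quadratic h1 h2 hn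
  have hdN : HasDerivAt (fun t => (X t).1) (field γ (X t)).1 t := hd.fst
  have hdD : HasDerivAt (fun t => (X t).2.1) (field γ (X t)).2.1 t := hd.snd.fst
  have hdV : HasDerivAt (fun t => (X t).2.2) (field γ (X t)).2.2 t := hd.snd.snd
  have hdE : HasDerivAt (fun t => energy γ (X t))
      (((γ - 1) + 2 * (γ - 1) * (2 - γ) * (X t).1) * (field γ (X t)).1 - (field γ (X t)).2.1) t := by
    have h : HasDerivAt (fun t => energy γ (X t)) _ t := (((hdN.const_mul (γ - 1)).const_add 2).add
      ((hdN.pow 2).const_mul ((γ - 1) * (2 - γ)))).sub hdD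
    refine h.congr_deriv ?_
    push_cast
    ring
  have hdp : HasDerivAt (fun t => slope γ (X t)) _ t := hdE.div hdV hV
  have hdσ : HasDerivAt (fun t => t / (X t).2.2) _ t := (hasDerivAt_id t).div hdV hV
  have hE : energy γ (X t) = slope γ (X t) * (X t).2.2 := by
    rw [slope, div_mul_cancel₀ _ hV]
  set N := (X t).1 with hN
  set D := (X t).2.1 with hD
  set V := (X t).2.2 with hVd
  set p := slope γ (X t) with hp
  set σ := t / V with hσ
  have e0 : n + t * trajQuot γ n K X t 0 = N := by
    simp only [trajQuot, Matrix.cons_val_zero]; field_simp; ring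
  have e1 : sonicD γ n + t * trajQuot γ n K X t 1 = D := by
    simp only [trajQuot, Matrix.cons_val_zero, Matrix.cons_val_one]; field_simp; ring
  have e2 : sonicP γ n + t * (K * trajQuot γ n K X t 2) = p := by
    simp only [trajQuot, Matrix.cons_val]; field_simp; ring
  have e3 : -(sonicL γ n)⁻¹ + t * (K ^ 2 * trajQuot γ n K X t 3) = σ := by
    simp only [trajQuot, Matrix.cons_val]
    rw [mul_inv_cancel_left₀ (by positivity), mul_div_cancel₀ _ ht0]
    ring
  fin_cases i
  · obtain ⟨f', hf', he⟩ := hasDerivAt_diffQuot (g₀ := n) (κ := 1) hdN ht0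
    refine ⟨f', hf', ?_⟩
    rw [he]
    simp only [Fin.zero_eta, singularField, sonicParam, Matrix.cons_val_zero, Matrix.cons_val, e0, e2]
    simp only [trajQuot, Matrix.cons_val_zero, field, ← hN, ← hp]
    ring
  · obtain ⟨f', hf', he⟩ := hasDerivAt_diffQuot (g₀ := sonicD γ n) (κ := 1) hdD ht0
    refine ⟨f', hf', ?_⟩
    rw [he]
    simp only [Fin.mk_one, singularField, sonicParam, Matrix.cons_val_zero, Matrix.cons_val_one,
      Matrix.cons_val, e0, e1, e2]
    simp only [trajQuot, Matrix.cons_val_zero, Matrix.cons_val_one, field, ← hN, ← hp, ← hD]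
    ring
  · obtain ⟨f', hf', he⟩ := hasDerivAt_diffQuot (g₀ := sonicP γ n) (κ := K) hdp ht0
    refine ⟨f', hf', ?_⟩
    rw [he]
    simp only [Fin.reduceFinMk, singularField, sonicParam, Matrix.cons_val_zero,
      Matrix.cons_val_one, Matrix.cons_val, e0, e1, e2, e3]
    have e4 : K⁻¹ * ((slope γ (X t) - sonicP γ n) / t) = trajQuot γ n K X t 2 := by
      simp only [trajQuot, Matrix.cons_val]
    rw [e4]
    congr 2
    rw [hE]
    simp only [field, ← hN, ← hp, ← hD, ← hVd]
    have e5 : t = σ * V := by rw [hσ]; field_simp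
    apply mul_left_cancel₀ ht0
    have e6 : ∀ a b : ℝ, t * ((a * V - p * V * b) / V ^ 2) = σ * (a - p * b) := by
      intro a b
      rw [hσ]; field_simp
    rw [e6]
    rw [← sub_eq_zero]
    set a := trajQuot γ n K X t 0
    set b := trajQuot γ n K X t 1
    set x := K * trajQuot γ n K X t 2
    have e7 : σ * (((γ - 1 + 2 * (γ - 1) * (2 - γ) * N) * (N * (3 - (4 - 3 * γ) * N + p)) -
        D * (3 - (4 - 3 * γ) * N + 2 * p)) -
        p * -((1 + V) * (2 * (4 - 3 * γ) * N - 4 - (γ + 1) * p))) =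
        σ * ((((γ - 1) * N + 2 * (γ - 1) * (2 - γ) * N ^ 2) * (3 - (4 - 3 * γ) * N + p)) -
        D * (3 - (4 - 3 * γ) * N + 2 * p) +
        p * (2 * (4 - 3 * γ) * N - 4 - (γ + 1) * p)) +
        t * (p * (2 * (4 - 3 * γ) * N - 4 - (γ + 1) * p)) := by
      linear_combination (-(p * (2 * (4 - 3 * γ) * N - 4 - (γ + 1) * p))) * e5
    rw [e7]
    have e8 : ∀ A B : ℝ, t * (σ * A + B) = σ * (t * A) + t * B := fun A B => by ring
    rw [e8, add_sub_add_comm]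
    have e9 : t * (p * (2 * (4 - 3 * γ) * N - 4 - (γ + 1) * p)) -
        t * ((2 * (4 - 3 * γ) * N - 4 - (γ + 1) * p) * p) = 0 := by ring
    rw [e9, add_zero, ← mul_sub]
    refine mul_eq_zero_of_right _ ?_
    rw [← e0, ← e1, ← e2]
    linear_combination (norm := skip) (-1) * hquad
    rw [sonicD]
    ring
  · obtain ⟨f', hf', he⟩ := hasDerivAt_diffQuot (g₀ := -(sonicL γ n)⁻¹) (κ := K ^ 2) hdσ ht0
    refine ⟨f', hf', ?_⟩
    rw [he]
    simp only [Fin.reduceFinMk, singularField, sonicParam, Matrix.cons_val_zero,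
      Matrix.cons_val_one, Matrix.cons_val, e0, e1, e2, e3]
    have e4 : (K ^ 2)⁻¹ * ((σ - -(sonicL γ n)⁻¹) / t) = trajQuot γ n K X t 3 := by
      simp only [trajQuot, Matrix.cons_val, hσ, hVd]
    rw [e4]
    congr 2
    simp only [field, id, ← hN, ← hp, ← hD, ← hVd]
    apply mul_left_cancel₀ ht0
    set ℓ := 2 * (4 - 3 * γ) * N - 4 - (γ + 1) * p with hℓ
    have e6 : t * ((1 * V - t * -((1 + V) * ℓ)) / V ^ 2) = σ * (1 + σ * ℓ) + t * σ * ℓ := by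
      rw [hσ]; field_simp; ring
    rw [e6]
    have e8 : 1 + σ * ℓ = t * (K ^ 2 * trajQuot γ n K X t 3 * ℓ + -(sonicL γ n)⁻¹ *
        (2 * (4 - 3 * γ) * trajQuot γ n K X t 0 - (γ + 1) * (K * trajQuot γ n K X t 2))) := by
      rw [hℓ, ← e0, ← e2, ← e3]
      linear_combination hσL
    rw [e8]
    ring

end LocalFamily

/-! ### The uniform family of local trajectories and its continuity in n. -/

section LocalFamily

variable {γ : ℝ}

lemma continuousOn_sonicParam (h1 : 1 < γ) (h2 : γ < 4 / 3) :
    ContinuousOn (sonicParam γ) (sonicRange γ) := by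
  have hcL : ContinuousOn (fun n => (sonicL γ n)⁻¹) (sonicRange γ) :=
    continuous_sonicL.continuousOn.inv₀ fun n hn => (sonicL_pos h1 h2 hn).ne'
  have hcP := continuous_sonicP (γ := γ)
  have hcD := continuous_sonicD (γ := γ)
  rw [continuousOn_pi]
  intro i
  fin_cases i <;> simp [sonicParam] <;> fun_prop

/-- The imaginary parts of the coordinates. -/
def imPart : (Fin 4 → ℂ) →L[ℝ] (Fin 4 → ℝ) :=
  ContinuousLinearMap.pi fun i => Complex.imCLM.comp (ContinuousLinearMap.proj i)

lemma imPart_eq_zero {Y : Fin 4 → ℂ} (hY : imPart Y = 0) : Y = fun i => ((Y i).re : ℂ) := by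
  funext i
  have : (Y i).im = 0 := congrFun hY i
  exact Complex.ext (by simp) (by simp [this])

lemma isLeftSolution_ofReal {K r C : ℝ} {P : Fin 4 → ℝ} {y : ℝ → Fin 4 → ℝ}
    (hb : ∀ t ∈ Ioo (-r) 0, ∀ i, |y t i| ≤ C) (hC : 0 ≤ C)
    (hs : ∀ t ∈ Ioo (-r) 0, ∀ i, ∃ f', HasDerivAt (fun t => y t i) f' t ∧
      t * f' = singularField γ K P t (y t) i) :
    IsLeftSolution (singularField (γ : ℂ) (K : ℂ) fun i => (P i : ℂ)) r C
      (fun t i => (y t i : ℂ)) := by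
  refine ⟨fun t ht => ?_, fun t ht => ?_⟩
  · rw [pi_norm_le_iff_of_nonneg hC]
    intro i
    rw [Complex.norm_real]
    exact hb t ht i
  · choose f' hf' he using hs t ht
    refine ⟨fun i => (f' i : ℂ), ?_, ?_⟩
    · rw [hasDerivAt_pi]
      exact fun i => (hf' i).ofReal_comp
    · rw [singularField_ofReal]
      funext i
      rw [← he i]
      simp

/-- The map from the values at the sonic point and the difference quotients to the unknowns. -/
def quotState (K : ℝ) (P : Fin 4 → ℝ) (t : ℝ) (y : Fin 4 → ℝ) : ℝ × ℝ × ℝ :=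
  (P 0 + t * y 0, P 1 + t * y 1, t / (P 3 + t * (K ^ 2 * y 3)))

lemma quotState_trajQuot {n K t : ℝ} (hK : 0 < K) {X : ℝ → ℝ × ℝ × ℝ} (ht : t < 0) :
    quotState K (sonicParam γ n) t (trajQuot γ n K X t) = X t := by
  have ht0 : t ≠ 0 := ht.ne
  have e3 : -(sonicL γ n)⁻¹ + t * (K ^ 2 * trajQuot γ n K X t 3) = t / (X t).2.2 := by
    simp only [trajQuot, Matrix.cons_val]
    rw [mul_inv_cancel_left₀ (by positivity), mul_div_cancel₀ _ ht0]
    ring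
  simp only [quotState, sonicParam, Matrix.cons_val_zero, Matrix.cons_val_one, Matrix.cons_val, e3]
  simp only [trajQuot, Matrix.cons_val_zero, Matrix.cons_val_one]
  rw [div_div_cancel₀ ht0]
  ext
  · simp only []; field_simp; ring
  · simp only []; field_simp; ring
  · rfl

/-- Only the quotient t/σ is delicate. With both denominators below -s, the difference of the
quotients is at most |t| times the difference of the denominators divided by s². -/
lemma quotState_close {K s ε : ℝ} (hs : 0 < s) (hε : 0 < ε) :
    ∃ η > 0, ∀ P Q y z : Fin 4 → ℝ, ∀ t : ℝ, |t| ≤ 1 → (∀ i, |P i - Q i| ≤ η) →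
      (∀ i, |y i - z i| ≤ η) → P 3 + t * (K ^ 2 * y 3) < -s → Q 3 + t * (K ^ 2 * z 3) < -s →
      dist (quotState K P t y) (quotState K Q t z) ≤ ε := by
  refine ⟨min (ε / 2) (ε * s ^ 2 / (1 + K ^ 2)), by positivity, ?_⟩
  intro P Q y z t ht hP hy h1 h2
  set η := min (ε / 2) (ε * s ^ 2 / (1 + K ^ 2)) with hη
  have hη1 : η ≤ ε / 2 := min_le_left _ _
  have hη2 : η * (1 + K ^ 2) ≤ ε * s ^ 2 := by
    rw [← le_div_iff₀ (by positivity)]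
    exact min_le_right _ _
  have hty : ∀ i, |t * (y i - z i)| ≤ η := fun i => by
    rw [abs_mul]
    nlinarith [abs_nonneg t, hy i, abs_nonneg (y i - z i)]
  have hlin : ∀ i, |P i + t * y i - (Q i + t * z i)| ≤ ε := fun i => by
    have : P i + t * y i - (Q i + t * z i) = (P i - Q i) + t * (y i - z i) := by ring
    rw [this]
    have := abs_add_le (P i - Q i) (t * (y i - z i))
    linarith [hP i, hty i]
  simp only [quotState, Prod.dist_eq, Real.dist_eq]
  refine max_le (hlin 0) (max_le (hlin 1) ?_)
  set a := P 3 + t * (K ^ 2 * y 3) with ha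
  set b := Q 3 + t * (K ^ 2 * z 3) with hb
  have hab : |b - a| ≤ ε * s ^ 2 := by
    have e : b - a = -((P 3 - Q 3) + K ^ 2 * (t * (y 3 - z 3))) := by rw [ha, hb]; ring
    rw [e, abs_neg]
    have h3 := abs_add_le (P 3 - Q 3) (K ^ 2 * (t * (y 3 - z 3)))
    rw [abs_mul, abs_of_nonneg (sq_nonneg K)] at h3
    have h4 := mul_le_mul_of_nonneg_left (hty 3) (sq_nonneg K)
    linarith [hP 3]
  have ha0 : a ≠ 0 := by linarith
  have hb0 : b ≠ 0 := by linarith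
  have e : t / a - t / b = t * (b - a) / (a * b) := by field_simp
  rw [e, abs_div, abs_mul, div_le_iff₀ (by positivity)]
  have h5 : s ^ 2 ≤ |a * b| := by
    rw [abs_of_pos (by nlinarith)]
    nlinarith
  calc |t| * |b - a| ≤ 1 * (ε * s ^ 2) := mul_le_mul ht hab (abs_nonneg _) (by norm_num)
    _ ≤ ε * |a * b| := by nlinarith

/-- The local Larson-Penston-Hunter trajectories: they exist on an interval that does not depend on
the sonic point, depend continuously on it, and are unique. -/
theorem exists_localFamily (h1 : 1 < γ) (h2 : γ < 4 / 3) :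
    ∃ r > 0, ∃ Z : ℝ → ℝ → ℝ × ℝ × ℝ,
      (∀ n ∈ sonicRange γ, IsTraj γ n (-r) (Z n) ∧ ∃ N D p V, IsLocalSolution γ n r N D p V ∧
        ∀ t ∈ Ioo (-r) 0, Z n t = (N t, D t, V t)) ∧
      (∀ n ∈ sonicRange γ, ∀ ε > 0, ∃ δ > 0, ∀ n' ∈ sonicRange γ, |n' - n| < δ →
        ∀ t ∈ Ioo (-r) 0, dist (Z n t) (Z n' t) ≤ ε) ∧
      ∀ n ∈ sonicRange γ, ∀ τ < 0, ∀ X, IsTraj γ n τ X → ∀ t ∈ Ioo (max τ (-r)) 0, X t = Z n t := by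
  obtain ⟨c, K, hK, hfam⟩ := exists_isBriotBouquetFamily h1 h2
  obtain ⟨R, r₀, hr₀, hR, hex⟩ := hfam.exists_solution imPart (by
    rintro _ ⟨n, hn, rfl⟩ t Y hY
    rw [imPart_eq_zero hY, singularField_ofReal]
    funext i
    simp [imPart])
  obtain ⟨Lm, hLm⟩ := (isCompact_Icc : IsCompact (sonicRange γ)).exists_bound_of_continuousOn
    (continuous_sonicL (γ := γ)).continuousOn
  have hk : 0 < 2 - γ := by linarith
  -- 2s is a uniform lower bound of 1/L. Below, m is a lower bound for n ≥ 1/(2-γ), for D(0) ≥ 2 and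
  -- for half of 2s, and r is so small that the corrections, at most rR or K²rR, stay below m. So N,
  -- D > 0 and σ < -s on all of (-r, r).
  set s := (|Lm| + 1)⁻¹ / 2 with hs
  have hs0 : 0 < s := by positivity
  set m := min (1 / (2 - γ)) (min 2 s) with hm
  have hm0 : 0 < m := by positivity
  set r := min (min r₀ 1) (m / ((R + 1) * (1 + K ^ 2))) with hrdef
  have hr : 0 < r := by positivity
  have hr1 : r ≤ 1 := (min_le_left _ _).trans (min_le_right _ _)
  have hrm : r * ((R + 1) * (1 + K ^ 2)) ≤ m := by
    rw [← le_div_iff₀ (by positivity)]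
    exact min_le_right _ _
  obtain ⟨hl, hex⟩ := hex r ⟨hr, (min_le_left _ _).trans (min_le_left _ _)⟩
  have hex' : ∀ n, ∃ Y : ℂ → Fin 4 → ℂ, n ∈ sonicRange γ →
      (DifferentiableOn ℂ Y (Metric.ball 0 r) ∧
      (∀ t ∈ Metric.ball (0 : ℂ) r, ‖Y t‖ ≤ R) ∧
      (∀ t ∈ Metric.ball (0 : ℂ) r, t • deriv Y t =
        singularField (γ : ℂ) (K : ℂ) (fun i => (sonicParam γ n i : ℂ)) t (Y t)) ∧
      ∀ t : ℝ, (t : ℂ) ∈ Metric.ball (0 : ℂ) r → imPart (Y t) = 0) := by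
    intro n
    by_cases hn : n ∈ sonicRange γ
    · obtain ⟨Y, hY⟩ := hex _ (mem_image_of_mem _ hn)
      exact ⟨Y, fun _ => hY⟩
    · exact ⟨0, fun h => absurd h hn⟩
  choose Yc hYc using hex'
  set y : ℝ → ℝ → Fin 4 → ℝ := fun n t i => (Yc n t i).re with hy
  set y' : ℝ → ℝ → Fin 4 → ℝ := fun n t i => (deriv (Yc n) t i).re with hy'
  have hball : ∀ t ∈ Ioo (-r) r, (t : ℂ) ∈ Metric.ball (0 : ℂ) r := by
    intro t ht
    rw [mem_ball_zero_iff, Complex.norm_real, Real.norm_eq_abs, abs_lt]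
    exact ht
  have hreal : ∀ n ∈ sonicRange γ, ∀ t ∈ Ioo (-r) r, Yc n t = fun i => (y n t i : ℂ) :=
    fun n hn t ht => imPart_eq_zero ((hYc n hn).2.2.2 t (hball t ht))
  have hdiff : ∀ n ∈ sonicRange γ, ∀ t ∈ Metric.ball (0 : ℂ) r, DifferentiableAt ℂ (Yc n) t :=
    fun n hn t ht => ((hYc n hn).1 t ht).differentiableAt (Metric.isOpen_ball.mem_nhds ht)
  have hyd : ∀ n ∈ sonicRange γ, ∀ t ∈ Ioo (-r) r, ∀ i,
      HasDerivAt (fun t => y n t i) (y' n t i) t := by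
    intro n hn t ht i
    have h3 := hasDerivAt_pi.1 (hdiff n hn t (hball t ht)).hasDerivAt i
    exact h3.real_of_complex
  have hye : ∀ n ∈ sonicRange γ, ∀ t ∈ Ioo (-r) r, ∀ i,
      t * y' n t i = singularField γ K (sonicParam γ n) t (y n t) i := by
    intro n hn t ht i
    have h3 := (hYc n hn).2.2.1 t (hball t ht)
    rw [hreal n hn t ht, singularField_ofReal] at h3
    have h4 := congrArg Complex.re (congrFun h3 i)
    simpa using h4
  have hyb : ∀ n ∈ sonicRange γ, ∀ t ∈ Ioo (-r) r, ∀ i, |y n t i| ≤ R := by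
    intro n hn t ht i
    have h3 := (hYc n hn).2.1 t (hball t ht)
    exact (Complex.abs_re_le_norm _).trans ((norm_le_pi_norm _ i).trans h3)
  have hyA : ∀ n ∈ sonicRange γ, ∀ i, AnalyticAt ℝ (fun t => y n t i) 0 := by
    intro n hn i
    have h3 : DifferentiableOn ℂ (fun t => Yc n t i) (Metric.ball 0 r) := fun t ht =>
      (differentiableAt_pi.1 (hdiff n hn t ht) i).differentiableWithinAt
    have h4 : AnalyticAt ℂ (fun t => Yc n t i) ((0 : ℝ) : ℂ) :=
      h3.analyticAt (Metric.isOpen_ball.mem_nhds (by simpa using hr))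
    exact h4.re_ofReal
  have hsm : ∀ n ∈ sonicRange γ, ∀ t ∈ Ioo (-r) r, ∀ i, |t * y n t i| ≤ r * R ∧
      |t * (K * y n t i)| ≤ K * (r * R) ∧ |t * (K ^ 2 * y n t i)| ≤ K ^ 2 * (r * R) := by
    intro n hn t ht i
    have h3 : |t| ≤ r := (abs_lt.2 ht).le
    have h4 : |t * y n t i| ≤ r * R := by
      rw [abs_mul]
      exact mul_le_mul h3 (hyb n hn t ht i) (abs_nonneg _) hr.le
    refine ⟨h4, ?_, ?_⟩
    · rw [mul_left_comm, abs_mul, abs_of_pos hK]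
      exact mul_le_mul_of_nonneg_left h4 hK.le
    · rw [mul_left_comm, abs_mul, abs_of_pos (by positivity : 0 < K ^ 2)]
      exact mul_le_mul_of_nonneg_left h4 (by positivity)
  have hrR : r * R < m ∧ K ^ 2 * (r * R) < m := by
    have : 0 < r * (1 + K ^ 2) := by positivity
    have : 0 ≤ r * R := by positivity
    have : 0 ≤ r * R * K ^ 2 := by positivity
    have h5 : r * ((R + 1) * (1 + K ^ 2)) = r * R + r * R * K ^ 2 + r * (1 + K ^ 2) := by ring
    constructor <;> linarith
  have hN : ∀ n ∈ sonicRange γ, ∀ t ∈ Ioo (-r) r, 0 < n + t * y n t 0 := by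
    intro n hn t ht
    have h3 := (abs_le.1 (hsm n hn t ht 0).1).1
    have h4 : m ≤ 1 / (2 - γ) := min_le_left _ _
    linarith [hn.1, hrR.1]
  have hD : ∀ n ∈ sonicRange γ, ∀ t ∈ Ioo (-r) r, 0 < sonicD γ n + t * y n t 1 := by
    intro n hn t ht
    have h3 := (abs_le.1 (hsm n hn t ht 1).1).1
    have h4 : m ≤ 2 := (min_le_right _ _).trans (min_le_left _ _)
    have h5 : 2 ≤ sonicD γ n := by
      have := pos_of_mem_sonicRange h1 h2 hn
      have h6 : 0 ≤ (γ - 1) * n := mul_nonneg (by linarith) this.le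
      have h7 : 0 ≤ (γ - 1) * (2 - γ) * n ^ 2 :=
        mul_nonneg (mul_nonneg (by linarith) hk.le) (sq_nonneg n)
      rw [sonicD]
      linarith
    linarith [hrR.1]
  have hσ : ∀ n ∈ sonicRange γ, ∀ t ∈ Ioo (-r) r,
      -(sonicL γ n)⁻¹ + t * (K ^ 2 * y n t 3) < -s := by
    intro n hn t ht
    have h3 := (abs_le.1 (hsm n hn t ht 3).2.2).2
    have h4 : m ≤ s := (min_le_right _ _).trans (min_le_right _ _)
    have h5 : (|Lm| + 1)⁻¹ ≤ (sonicL γ n)⁻¹ := by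
      refine inv_anti₀ (sonicL_pos h1 h2 hn) ?_
      have h6 := hLm n hn
      rw [Real.norm_eq_abs] at h6
      linarith [le_abs_self (sonicL γ n), le_abs_self Lm]
    have h6 : (|Lm| + 1)⁻¹ = 2 * s := by rw [hs]; ring
    linarith [hrR.2]
  set Z : ℝ → ℝ → ℝ × ℝ × ℝ := fun n t => quotState K (sonicParam γ n) t (y n t) with hZ
  have hloc : ∀ n ∈ sonicRange γ, IsLocalSolution γ n r (fun t => n + t * y n t 0)
      (fun t => sonicD γ n + t * y n t 1) (fun t => sonicP γ n + t * (K * y n t 2))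
      (fun t => t / (-(sonicL γ n)⁻¹ + t * (K ^ 2 * y n t 3))) := fun n hn =>
    isLocalSolution_of_singular h1 h2 hn hK hr (hyA n hn) (hyd n hn) (hye n hn) (hN n hn)
      (hD n hn) fun t ht => (hσ n hn t ht).trans (by linarith)
  have hZtraj : ∀ n ∈ sonicRange γ, IsTraj γ n (-r) (Z n) := by
    intro n hn
    refine (hloc n hn).isTraj hr (C := (1 + K + K ^ 2) * R) ?_
    intro t ht
    have ht' : t ∈ Ioo (-r) r := ⟨ht.1, ht.2.trans hr⟩
    have hb := hyb n hn t ht'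
    have h3 : ∀ i, |t * y n t i| ≤ R * |t| := fun i => by
      rw [abs_mul, mul_comm]
      exact mul_le_mul_of_nonneg_right (hb i) (abs_nonneg t)
    have h4 : 0 ≤ R * |t| := by positivity
    have h5 : 0 ≤ K * (R * |t|) := by positivity
    have h6 : 0 ≤ K ^ 2 * (R * |t|) := by positivity
    have h7 : (1 + K + K ^ 2) * R * |t| = R * |t| + K * (R * |t|) + K ^ 2 * (R * |t|) := by ring
    rw [h7]
    refine ⟨?_, ?_, ?_, ?_⟩
    · rw [add_sub_cancel_left]
      linarith [h3 0]
    · rw [add_sub_cancel_left]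
      linarith [h3 1]
    · rw [add_sub_cancel_left, mul_left_comm, abs_mul, abs_of_pos hK]
      have := mul_le_mul_of_nonneg_left (h3 2) hK.le
      linarith
    · have hne : -(sonicL γ n)⁻¹ + t * (K ^ 2 * y n t 3) ≠ 0 := by
        have := hσ n hn t ht'
        linarith
      rw [div_div_cancel₀ ht.2.ne, add_comm, ← add_assoc, add_neg_cancel, zero_add,
        mul_left_comm, abs_mul, abs_of_pos (by positivity : 0 < K ^ 2)]
      have := mul_le_mul_of_nonneg_left (h3 3) (by positivity : 0 ≤ K ^ 2)
      linarith
  have hleft : ∀ n ∈ sonicRange γ, ∀ r' ≤ r, ∀ C, R ≤ C → IsLeftSolution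
      (singularField (γ : ℂ) (K : ℂ) fun i => (sonicParam γ n i : ℂ)) r' C
      (fun t i => (y n t i : ℂ)) := by
    intro n hn r' hr' C hC
    have hsub : ∀ t ∈ Ioo (-r') 0, t ∈ Ioo (-r) r := fun t ht => ⟨by linarith [ht.1], ht.2.trans hr⟩
    exact isLeftSolution_ofReal (fun t ht i => (hyb n hn t (hsub t ht) i).trans hC) (hR.trans hC)
      fun t ht i => ⟨_, hyd n hn t (hsub t ht) i, hye n hn t (hsub t ht) i⟩
  refine ⟨r, hr, Z, fun n hn => ⟨hZtraj n hn, _, _, _, _, hloc n hn, fun t _ => rfl⟩, ?_, ?_⟩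
  · intro n hn ε hε
    obtain ⟨η, hη, hclose⟩ := quotState_close (K := K) hs0 hε
    obtain ⟨δ₁, hδ₁, hδ₁'⟩ := hfam.close_of_isLeftSolution hl (mem_image_of_mem _ hn) hη
    have hcont := continuousOn_sonicParam h1 h2 n hn
    rw [Metric.continuousWithinAt_iff] at hcont
    obtain ⟨δ, hδ, hδ'⟩ := hcont (min η δ₁) (lt_min hη hδ₁)
    refine ⟨δ, hδ, fun n' hn' hnn t ht => ?_⟩
    have hP := hδ' hn' (by rwa [Real.dist_eq])
    have hPi : ∀ i, |sonicParam γ n' i - sonicParam γ n i| < min η δ₁ := fun i =>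
      (dist_le_pi_dist (sonicParam γ n') (sonicParam γ n) i).trans_lt hP
    have ht' : t ∈ Ioo (-r) r := ⟨ht.1, ht.2.trans hr⟩
    refine hclose _ _ _ _ t ?_ (fun i => ?_) (fun i => ?_) (hσ n hn t ht') (hσ n' hn' t ht')
    · rw [abs_of_neg ht.2]
      linarith [ht.1]
    · rw [abs_sub_comm]
      exact ((hPi i).trans_le (min_le_left _ _)).le
    · have h3 := hδ₁' _ (mem_image_of_mem _ hn') (by
        rw [dist_pi_lt_iff hδ₁]
        intro i
        rw [Complex.dist_eq, ← Complex.ofReal_sub, Complex.norm_real]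
        exact (hPi i).trans_le (min_le_right _ _)) _ _ (hleft n hn r le_rfl R le_rfl)
        (hleft n' hn' r le_rfl R le_rfl) t ht
      have h4 := (norm_le_pi_norm _ i).trans h3
      simp only [Pi.sub_apply] at h4
      rwa [← Complex.ofReal_sub, Complex.norm_real] at h4
  · intro n hn τ hτ X hX t ht
    obtain ⟨C, hC⟩ := hX.germ
    obtain ⟨ρ, hρ, hρC⟩ := mem_nhdsLT_iff_exists_Ioo_subset.1 hC
    -- C' bounds the difference quotients of both X (through its germ) and Z. The singular
    -- uniqueness applies only on (-q, 0), with q depending on X; from there ordinary uniqueness in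
    -- the subsonic region carries the equality to the left.
    set C' := max R ((1 + K⁻¹ + (K ^ 2)⁻¹) * |C|) with hC'
    obtain ⟨r₁, hr₁, huniq⟩ := hfam.eq_of_isLeftSolution C'
    set q := min (min r₁ r) (min (-ρ) (-τ)) with hq
    have hq0 : 0 < q := lt_min (lt_min hr₁ hr) (lt_min (neg_pos.2 hρ) (neg_pos.2 hτ))
    have hq1 : q ≤ r₁ := (min_le_left _ _).trans (min_le_left _ _)
    have hq2 : q ≤ r := (min_le_left _ _).trans (min_le_right _ _)
    have hq3 : q ≤ -ρ := (min_le_right _ _).trans (min_le_left _ _)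
    have hq4 : q ≤ -τ := (min_le_right _ _).trans (min_le_right _ _)
    have hXs : ∀ t ∈ Ioo (-q) 0, t ∈ Ioo τ 0 := fun t ht => ⟨by linarith [ht.1], ht.2⟩
    have hW : IsLeftSolution (singularField (γ : ℂ) (K : ℂ) fun i => (sonicParam γ n i : ℂ)) q C'
        (fun t i => (trajQuot γ n K X t i : ℂ)) := by
      refine isLeftSolution_ofReal (fun t ht i => ?_) (hR.trans (le_max_left _ _))
        fun t ht i => trajQuot_solves h1 h2 hn hK ht.2 (hX.subsonic t (hXs t ht))
          (hX.solves t (hXs t ht)) i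
      refine le_trans ?_ (le_max_right _ _)
      obtain ⟨g0, g1, g2, g3⟩ := hρC (show t ∈ Ioo ρ 0 from ⟨by linarith [ht.1], ht.2⟩)
      have ht0 : 0 < |t| := abs_pos.2 ht.2.ne
      have hdiv : ∀ a : ℝ, |a| ≤ C * |t| → |a / t| ≤ |C| := fun a ha => by
        rw [abs_div, div_le_iff₀ ht0]
        exact ha.trans (mul_le_mul_of_nonneg_right (le_abs_self C) ht0.le)
      have hi1 : 0 ≤ K⁻¹ * |C| := by positivity
      have hi2 : 0 ≤ (K ^ 2)⁻¹ * |C| := by positivity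
      have hi3 := abs_nonneg C
      have e : (1 + K⁻¹ + (K ^ 2)⁻¹) * |C| = |C| + K⁻¹ * |C| + (K ^ 2)⁻¹ * |C| := by ring
      rw [e]
      fin_cases i
      · simp only [Fin.zero_eta, trajQuot, Matrix.cons_val_zero, inv_one, one_mul]
        linarith [hdiv _ g0]
      · simp only [Fin.mk_one, trajQuot, Matrix.cons_val_zero, Matrix.cons_val_one, inv_one, one_mul]
        linarith [hdiv _ g1]
      · simp only [Fin.reduceFinMk, trajQuot, Matrix.cons_val]
        rw [abs_mul, abs_of_pos (inv_pos.2 hK)]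
        have := mul_le_mul_of_nonneg_left (hdiv _ g2) (inv_pos.2 hK).le
        linarith
      · simp only [Fin.reduceFinMk, trajQuot, Matrix.cons_val]
        rw [sub_neg_eq_add, abs_mul, abs_of_pos (by positivity : 0 < (K ^ 2)⁻¹)]
        have := mul_le_mul_of_nonneg_left (hdiv _ g3) (by positivity : 0 ≤ (K ^ 2)⁻¹)
        linarith
    have hnear : ∀ t ∈ Ioo (-q) 0, X t = Z n t := by
      intro t ht
      have h3 := huniq q ⟨hq0, hq1⟩ _ (mem_image_of_mem _ hn) _ _ hW
        (hleft n hn q hq2 C' (le_max_left _ _)) t ht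
      have h4 : trajQuot γ n K X t = y n t := by
        funext i
        exact_mod_cast congrFun h3 i
      rw [← quotState_trajQuot (γ := γ) (n := n) (X := X) hK ht.2, h4]
    by_cases htq : -q < t
    · exact hnear t ⟨htq, ht.2⟩
    · have hb : -q / 2 ∈ Ioo (-q) 0 := ⟨by linarith, by linarith⟩
      have hsub : ∀ u ∈ Icc t (-q / 2), u ∈ Ioo τ 0 ∧ u ∈ Ioo (-r) 0 := fun u hu =>
        ⟨⟨(le_max_left _ _).trans_lt (ht.1.trans_le hu.1), hu.2.trans_lt hb.2⟩,
          ⟨(le_max_right _ _).trans_lt (ht.1.trans_le hu.1), hu.2.trans_lt hb.2⟩⟩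
      refine eqOn_of_solutions isOpen_subsonicRegion (contDiffOn_field γ)
        (fun u hu => ⟨hX.solves u (hsub u hu).1, hX.subsonic u (hsub u hu).1⟩)
        (fun u hu => ⟨(hZtraj n hn).solves u (hsub u hu).2, (hZtraj n hn).subsonic u (hsub u hu).2⟩)
        (hnear _ hb) ⟨le_rfl, by linarith⟩

/-- Trajectories depend continuously on the sonic point, up to the time to which they exist. -/
theorem IsTraj.dist_lt (h1 : 1 < γ) (h2 : γ < 4 / 3) {n τ τ₁ : ℝ} (hn : n ∈ sonicRange γ)
    {X : ℝ → ℝ × ℝ × ℝ} (hX : IsTraj γ n τ X) (hτ : τ < τ₁) (hτ₁ : τ₁ < 0) {ε : ℝ} (hε : 0 < ε) :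
    ∃ δ > 0, ∀ n' ∈ sonicRange γ, |n' - n| < δ → ∀ τ' < 0, ∀ X', IsTraj γ n' τ' X' →
      ∀ t ∈ Ioo (max τ₁ τ') 0, dist (X t) (X' t) < ε := by
  obtain ⟨r, hr, Z, hZ, hclose, huniq⟩ := exists_localFamily h1 h2
  -- On [b, 0) the local family controls the distance, uniformly up to the sonic point; to the left
  -- of b the flow is regular and b serves as its final time.
  set b := max τ₁ (-r) / 2 with hb
  have hb1 : max τ₁ (-r) < 0 := max_lt hτ₁ (by linarith)
  have hb0 : b < 0 := by rw [hb]; linarith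
  have hb2 : max τ₁ (-r) < b := by rw [hb]; linarith
  have hbτ : τ₁ < b := (le_max_left _ _).trans_lt hb2
  have hbr : -r < b := (le_max_right _ _).trans_lt hb2
  have hXs : ∀ t ∈ Icc τ₁ b, t ∈ Ioo τ 0 := fun t ht => ⟨hτ.trans_le ht.1, ht.2.trans_lt hb0⟩
  obtain ⟨δ₁, hδ₁, h3⟩ := dist_lt_of_solutions isOpen_subsonicRegion (contDiffOn_field γ)
    (fun t ht => ⟨hX.solves t (hXs t ht), hX.subsonic t (hXs t ht)⟩) hε
  obtain ⟨δ, hδ, h4⟩ := hclose n hn (min (ε / 2) δ₁) (by positivity)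
  refine ⟨δ, hδ, fun n' hn' hnn τ' hτ' X' hX' => ?_⟩
  have hnear : ∀ t ∈ Ioo (max τ₁ τ') 0, b ≤ t → dist (X t) (X' t) ≤ min (ε / 2) δ₁ := by
    intro t ht hbt
    have e1 := huniq n hn τ (hτ.trans hτ₁) X hX t
      ⟨max_lt (by linarith) (by linarith), ht.2⟩
    have e2 := huniq n' hn' τ' hτ' X' hX' t
      ⟨max_lt ((le_max_right _ _).trans_lt ht.1) (by linarith), ht.2⟩
    rw [e1, e2]
    exact h4 n' hn' hnn t ⟨by linarith, ht.2⟩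
  intro t ht
  by_cases hbt : b ≤ t
  · exact (hnear t ht hbt).trans_lt ((min_le_left _ _).trans_lt (by linarith))
  · push Not at hbt
    have ht1 : τ₁ < t := (le_max_left _ _).trans_lt ht.1
    have ht2 : τ' < t := (le_max_right _ _).trans_lt ht.1
    refine h3 t ⟨ht1.le, hbt.le⟩ X' (fun u hu => ?_) ?_ t ⟨le_rfl, hbt.le⟩
    · have hu' : u ∈ Ioo τ' 0 := ⟨ht2.trans_le hu.1, hu.2.trans_lt hb0⟩
      exact ⟨hX'.solves u hu', hX'.subsonic u hu'⟩
    · exact (hnear b ⟨max_lt hbτ (ht2.trans hbt), hb0⟩ le_rfl).trans (min_le_right _ _)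

end LocalFamily

/-! ### Translation between (ρ, ω) and the autonomous unknowns. -/

section Translation

variable {γ : ℝ}

/-- The unknowns of the autonomous system along a solution, in logarithmic time from `z`. -/
def lphState (γ z : ℝ) (ρ ω : ℝ → ℝ) (t : ℝ) : ℝ × ℝ × ℝ :=
  ((ω (z * Real.exp t))⁻¹,
    4 * Real.pi * ρ (z * Real.exp t) / ((4 - 3 * γ) * ω (z * Real.exp t)),
    γ * ρ (z * Real.exp t) ^ (γ - 1) / ((z * Real.exp t) ^ 2 * ω (z * Real.exp t) ^ 2) - 1)

lemma hasDerivAt_comp_mul_exp {f : ℝ → ℝ} {f' z t : ℝ} (hz : z ≠ 0)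
    (hf : HasDerivAt f (f' / (z * Real.exp t)) (z * Real.exp t)) :
    HasDerivAt (fun t => f (z * Real.exp t)) f' t := by
  have h1 : HasDerivAt (fun t => z * Real.exp t) (z * Real.exp t) t :=
    (Real.hasDerivAt_exp t).const_mul z
  have h2 : HasDerivAt (fun t => f (z * Real.exp t)) _ t := HasDerivAt.comp t hf h1
  refine h2.congr_deriv ?_
  have := Real.exp_ne_zero t
  field_simp

/-- The slope p is left free so that one computation serves both subsonic points, with p = `slope`,
and the sonic point t = 0, with p = `sonicP`. -/
lemma hasDerivAt_lphState {z t p : ℝ} {ρ ω : ℝ → ℝ} (h2 : γ < 4 / 3) (hz : 0 < z)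
    (hρ : 0 < ρ (z * Real.exp t)) (hω : 0 < ω (z * Real.exp t))
    (hdρ : HasDerivAt ρ (ρ (z * Real.exp t) * p / (z * Real.exp t)) (z * Real.exp t))
    (hdω : HasDerivAt ω ((4 - 3 * γ - 3 * ω (z * Real.exp t) - ω (z * Real.exp t) * p) /
      (z * Real.exp t)) (z * Real.exp t)) :
    HasDerivAt (lphState γ z ρ ω)
      ((lphState γ z ρ ω t).1 * (3 - (4 - 3 * γ) * (lphState γ z ρ ω t).1 + p),
        (lphState γ z ρ ω t).2.1 * (3 - (4 - 3 * γ) * (lphState γ z ρ ω t).1 + 2 * p),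
        -((1 + (lphState γ z ρ ω t).2.2) *
          (2 * (4 - 3 * γ) * (lphState γ z ρ ω t).1 - 4 - (γ + 1) * p))) t := by
  have e1 := hasDerivAt_comp_mul_exp hz.ne' hdρ
  have e2 := hasDerivAt_comp_mul_exp hz.ne' hdω
  have e3 : HasDerivAt (fun t => z * Real.exp t) (z * Real.exp t) t :=
    (Real.hasDerivAt_exp t).const_mul z
  have hd : 4 - 3 * γ ≠ 0 := by linarith
  have hy : 0 < z * Real.exp t := by positivity
  have f1 := e2.inv hω.ne'
  have f2 := (e1.const_mul (4 * Real.pi)).div (e2.const_mul (4 - 3 * γ))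
    (mul_ne_zero hd hω.ne')
  have f3 := (((e1.rpow_const (p := γ - 1) (Or.inl hρ.ne')).const_mul γ).div
    ((e3.fun_pow 2).fun_mul (e2.fun_pow 2)) (mul_ne_zero (pow_ne_zero 2 hy.ne') (pow_ne_zero 2 hω.ne'))).sub_const 1
  have f := f1.prodMk (f2.prodMk f3)
  refine (HasDerivAt.congr_deriv (f := lphState γ z ρ ω) f ?_)
  rw [Real.rpow_sub_one hρ.ne']
  simp only [lphState]
  set r := ρ (z * Real.exp t)
  set w := ω (z * Real.exp t)
  set y := z * Real.exp t
  ext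
  · simp only []
    field_simp
    ring
  · simp only []
    field_simp
    ring
  · simp only []
    push_cast
    field_simp
    ring

lemma slope_lphState {z t : ℝ} {ρ ω : ℝ → ℝ} (h2 : γ < 4 / 3) (hz : 0 < z)
    (hω : 0 < ω (z * Real.exp t)) :
    (lphState γ z ρ ω t).2.2 =
      G γ (z * Real.exp t) (ρ (z * Real.exp t)) (ω (z * Real.exp t)) /
        ((z * Real.exp t) ^ 2 * ω (z * Real.exp t) ^ 2) ∧
    slope γ (lphState γ z ρ ω t) =
      (z * Real.exp t) ^ 2 * h γ (ρ (z * Real.exp t)) (ω (z * Real.exp t)) /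
        G γ (z * Real.exp t) (ρ (z * Real.exp t)) (ω (z * Real.exp t)) := by
  have hy : 0 < z * Real.exp t := by positivity
  have hV : (lphState γ z ρ ω t).2.2 =
      G γ (z * Real.exp t) (ρ (z * Real.exp t)) (ω (z * Real.exp t)) /
        ((z * Real.exp t) ^ 2 * ω (z * Real.exp t) ^ 2) := by
    simp only [lphState, G]
    field_simp
  refine ⟨hV, ?_⟩
  have hE : energy γ (lphState γ z ρ ω t) =
      h γ (ρ (z * Real.exp t)) (ω (z * Real.exp t)) / ω (z * Real.exp t) ^ 2 := by
    simp only [energy, lphState, h]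
    have hd : 4 - 3 * γ ≠ 0 := by linarith
    generalize 4 - 3 * γ = d at hd
    field_simp
    ring
  rw [slope, hE, hV]
  by_cases hG : G γ (z * Real.exp t) (ρ (z * Real.exp t)) (ω (z * Real.exp t)) = 0
  · simp [hG]
  · field_simp

/-- The germ condition on t/V is of first order, but V itself vanishes to first order, so V must be
known up to O(t²). -/
lemma exists_second_order_bound {f : ℝ → ℝ} {f' : ℝ} (hf : ContDiffAt ℝ 2 f 0)
    (hf' : HasDerivAt f f' 0) :
    ∃ C > 0, ∀ᶠ t in 𝓝 (0 : ℝ), |f t - f 0 - f' * t| ≤ C * t ^ 2 := by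
  have hd1 : ContDiffAt ℝ 1 (deriv f) 0 := hf.derivWithin (by norm_num)
  have h0 : deriv f 0 = f' := hf'.deriv
  obtain ⟨K, hK0, hK⟩ := (hd1.differentiableAt (by norm_num)).hasDerivAt.isBigO_sub.exists_pos
  have h1 : ∀ᶠ t in 𝓝 (0 : ℝ), DifferentiableAt ℝ f t :=
    (hf.eventually (by simp)).mono fun t ht => ht.differentiableAt (by norm_num)
  obtain ⟨ε, hε, hb⟩ := Metric.eventually_nhds_iff_ball.1 (hK.bound.and h1)
  refine ⟨K, hK0, Metric.eventually_nhds_iff_ball.2 ⟨ε, hε, fun t ht => ?_⟩⟩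
  have hsub : ∀ s ∈ uIcc 0 t, |s| ≤ |t| := fun s hs => by
    have := abs_sub_left_of_mem_uIcc hs
    simpa using this
  have ht' : |t| < ε := by simpa using ht
  have := (convex_uIcc (0 : ℝ) t).norm_image_sub_le_of_norm_hasDerivWithin_le
    (f := fun s => f s - f' * s) (f' := fun s => deriv f s - f' * 1) (C := K * |t|)
    (fun s hs => ((hb s (by simpa using (hsub s hs).trans_lt ht')).2.hasDerivAt.sub
      ((hasDerivAt_id s).const_mul f')).hasDerivWithinAt)
    (fun s hs => by
      have h2 := (hb s (by simpa using (hsub s hs).trans_lt ht')).1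
      rw [h0] at h2
      simp only [sub_zero, Real.norm_eq_abs] at h2
      rw [mul_one, Real.norm_eq_abs]
      exact h2.trans (mul_le_mul_of_nonneg_left (hsub s hs) hK0.le)) left_mem_uIcc right_mem_uIcc
  simp only [Real.norm_eq_abs, mul_zero, sub_zero] at this
  calc |f t - f 0 - f' * t| = |f t - f' * t - f 0| := by ring_nf
    _ ≤ _ := this
    _ = K * t ^ 2 := by rw [mul_assoc, abs_mul_abs_self, sq]

lemma exists_bound_of_hasDerivAt {f : ℝ → ℝ} {f' : ℝ} (hf : HasDerivAt f f' 0) :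
    ∃ C > 0, ∀ᶠ t in 𝓝[<] (0 : ℝ), |f t - f 0| ≤ C * |t| := by
  obtain ⟨C, hC, h⟩ := hf.isBigO_sub.exists_pos
  refine ⟨C, hC, (h.bound.filter_mono nhdsWithin_le_nhds).mono fun t ht => ?_⟩
  simpa using ht

/-- The sum equals (V + ℓt)/(Vℓ), whose numerator is O(t²), and V ≥ ℓ|t|/2 near 0. -/
lemma exists_bound_div_add_inv {V : ℝ → ℝ} {ℓ C : ℝ} (hℓ : 0 < ℓ) (hC : 0 < C)
    (h : ∀ᶠ t in 𝓝[<] (0 : ℝ), |V t + ℓ * t| ≤ C * t ^ 2) :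
    ∃ C' > 0, ∀ᶠ t in 𝓝[<] (0 : ℝ), |t / V t + ℓ⁻¹| ≤ C' * |t| := by
  have hsmall : ∀ᶠ t in 𝓝[<] (0 : ℝ), t ∈ Ioo (-(ℓ / (2 * C))) 0 :=
    Ioo_mem_nhdsLT (by rw [neg_lt_zero]; positivity)
  have hC' : 0 < 2 * C / ℓ ^ 2 := by positivity
  refine ⟨2 * C / ℓ ^ 2, hC', ?_⟩
  filter_upwards [h, hsmall] with t e1 hts
  have ht0 := hts.2
  have e2 : C * -t ≤ ℓ / 2 := by
    have := hts.1
    rw [neg_lt, lt_div_iff₀ (by positivity)] at this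
    linarith
  have e3 : ℓ / 2 * -t ≤ V t := by
    have := neg_abs_le (V t + ℓ * t)
    nlinarith
  have hVpos : 0 < V t := lt_of_lt_of_le (by nlinarith) e3
  have e4 : t / V t + ℓ⁻¹ = (V t + ℓ * t) / (V t * ℓ) := by
    field_simp
    ring
  rw [e4, abs_div, abs_of_pos (mul_pos hVpos hℓ), div_le_iff₀ (by positivity), abs_of_neg ht0]
  refine e1.trans ?_
  calc C * t ^ 2 = 2 * C / ℓ ^ 2 * -t * (ℓ / 2 * -t * ℓ) := by field_simp
    _ ≤ _ := by
      have : 0 ≤ 2 * C / ℓ ^ 2 * -t := mul_nonneg hC'.le (by linarith)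
      gcongr

/-- The density of a subsonic extension stays positive. -/
lemma IsSubsonicLPH.rho_pos {z a : ℝ} {ρ ω : ℝ → ℝ} (h1 : 1 < γ)
    (H : IsSubsonicLPH γ z a ρ ω) : ∀ y ∈ Ioo a z, 0 < ρ y := by
  intro y hy
  by_contra! hneg
  have hcont : ContinuousOn ρ (Icc y z) := by
    intro x hx
    rcases eq_or_lt_of_le hx.2 with rfl | hxz
    · exact H.lph.analytic_rho.continuousAt.continuousWithinAt
    · exact (H.solves x ⟨hy.1.trans_le hx.1, hxz⟩).1.continuousAt.continuousWithinAt
  obtain ⟨x, hx, hx0⟩ : ∃ x ∈ Ioo a z, 0 < ρ x ∧ y < x := by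
    have e1 : ∀ᶠ x in 𝓝[<] z, 0 < ρ x :=
      (H.lph.analytic_rho.continuousAt.eventually (lt_mem_nhds H.lph.rho_pos)).filter_mono
        nhdsWithin_le_nhds
    have e2 : ∀ᶠ x in 𝓝[<] z, x ∈ Ioo y z := Ioo_mem_nhdsLT hy.2
    obtain ⟨x, e3, e4⟩ := (e1.and e2).exists
    exact ⟨x, ⟨hy.1.trans e4.1, e4.2⟩, e3, e4.1⟩
  obtain ⟨u, hu, hu0⟩ := intermediate_value_Icc hx0.2.le
    (hcont.mono (Icc_subset_Icc_right hx.2.le)) ⟨hneg, hx0.1.le⟩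
  have hsub : ∀ s ∈ Icc u x, s ∈ Ioo a z := fun s hs =>
    ⟨hy.1.trans_le (hu.1.trans hs.1), hs.2.trans_lt hx.2⟩
  have hρc : ContinuousOn ρ (Icc u x) := fun s hs =>
    (H.solves s (hsub s hs)).1.continuousAt.continuousWithinAt
  have hωc : ContinuousOn ω (Icc u x) := fun s hs =>
    (H.solves s (hsub s hs)).2.continuousAt.continuousWithinAt
  have hpow : ContinuousOn (fun s => ρ s ^ (γ - 1)) (Icc u x) :=
    hρc.rpow_const fun s _ => Or.inr (by linarith)
  have hGc : ContinuousOn (fun s => G γ s (ρ s) (ω s)) (Icc u x) := by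
    unfold G
    fun_prop
  have hhc : ContinuousOn (fun s => h γ (ρ s) (ω s)) (Icc u x) := by
    unfold h
    fun_prop
  have hc : ContinuousOn (fun s => s * h γ (ρ s) (ω s) / G γ s (ρ s) (ω s)) (Icc u x) :=
    (continuousOn_id.mul hhc).div hGc fun s hs => (H.subsonic s (hsub s hs)).ne'
  obtain ⟨K, hK⟩ := isCompact_Icc.exists_bound_of_continuousOn hc
  -- The equation for ρ is linear with a continuous coefficient on [u, x], so the zero at u
  -- propagates to the right up to x, where ρ > 0.
  have := norm_le_gronwallBound_of_norm_deriv_right_le (δ := 0) (K := K) (ε := 0) hρc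
    (fun s hs => (H.solves s (hsub s ⟨hs.1, hs.2.le⟩)).1.hasDerivWithinAt) (by simp [hu0])
    (fun s hs => by
      have := mul_le_mul_of_nonneg_right (hK s ⟨hs.1, hs.2.le⟩) (norm_nonneg (ρ s))
      rw [← norm_mul] at this
      rw [add_zero]
      refine le_trans (le_of_eq (congrArg _ ?_)) this
      ring) x ⟨hu.2, le_rfl⟩
  rw [gronwallBound_ε0_δ0] at this
  exact absurd (norm_le_zero_iff.1 this) hx0.1.ne'

/-- A subsonic extension of a solution of Larson-Penston-Hunter type is a trajectory, as long as
its velocity is positive. -/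
theorem IsSubsonicLPH.isTraj {z a b n : ℝ} {ρ ω : ℝ → ℝ} (h1 : 1 < γ) (h2 : γ < 4 / 3)
    (H : IsSubsonicLPH γ z a ρ ω) (hz : 0 < z) (hn : n ∈ sonicRange γ) (hωz : ω z = n⁻¹)
    (hb : 0 < b) (hab : a ≤ b) (hbz : b < z) (hω : ∀ y ∈ Ioo b z, 0 < ω y) :
    IsTraj γ n (Real.log (b / z)) (lphState γ z ρ ω) := by
  have hd : 4 - 3 * γ ≠ 0 := by linarith
  have hn0 := pos_of_mem_sonicRange h1 h2 hn
  have hℓ := sonicL_pos h1 h2 hn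
  have hω0 : 0 < ω z := by rw [hωz]; positivity
  have hρ0 := H.lph.rho_pos
  have hρz := (sonic_unique h1 h2 hz hρ0 H.lph.sonic H.lph.regular).2.1
  rw [hωz, inv_inv] at hρz
  have hmem : ∀ t ∈ Ioo (Real.log (b / z)) 0, z * Real.exp t ∈ Ioo b z := by
    intro t ht
    constructor
    · have := (Real.log_lt_iff_lt_exp (by positivity)).1 ht.1
      rwa [div_lt_iff₀ hz, mul_comm] at this
    · have := Real.exp_lt_one_iff.2 ht.2
      nlinarith
  have hmem' : ∀ t ∈ Ioo (Real.log (b / z)) 0, z * Real.exp t ∈ Ioo a z := fun t ht =>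
    ⟨hab.trans_lt (hmem t ht).1, (hmem t ht).2⟩
  have hτ : Real.log (b / z) < 0 := Real.log_neg (by positivity) (by rwa [div_lt_one hz])
  have hnear : ∀ᶠ t in 𝓝[<] (0 : ℝ), t ∈ Ioo (Real.log (b / z)) 0 := Ioo_mem_nhdsLT hτ
  have hGpos : ∀ t ∈ Ioo (Real.log (b / z)) 0, 0 < G γ (z * Real.exp t)
      (ρ (z * Real.exp t)) (ω (z * Real.exp t)) := fun t ht => H.subsonic _ (hmem' t ht)
  have hsl := fun t (ht : t ∈ Ioo (Real.log (b / z)) 0) =>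
    slope_lphState (γ := γ) (ρ := ρ) h2 hz (hω _ (hmem t ht))
  have hd0 : HasDerivAt (lphState γ z ρ ω) _ 0 :=
    hasDerivAt_lphState (t := 0) (p := sonicP γ n) h2 hz (by simpa using hρ0) (by simpa using hω0)
    (by
      have := H.lph.analytic_rho.differentiableAt.hasDerivAt
      rw [H.lph.deriv_rho, hωz, R₁_inv h1 h2 hn] at this
      simpa using this)
    (by
      have := H.lph.analytic_omega.differentiableAt.hasDerivAt
      rw [H.lph.deriv_omega, W₁, hωz, R₁_inv h1 h2 hn] at this
      simpa [hωz] using this)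
  have hX0 : lphState γ z ρ ω 0 = (n, sonicD γ n, 0) := by
    have hV := (slope_lphState (γ := γ) (ρ := ρ) (t := 0) h2 hz (by simpa using hω0)).1
    simp only [Real.exp_zero, mul_one, H.lph.sonic, zero_div] at hV
    refine Prod.ext ?_ (Prod.ext ?_ hV)
    · simp [lphState, hωz]
    · simp only [lphState, Real.exp_zero, mul_one, hωz, hρz, sonicRho]
      field_simp
  rw [hX0] at hd0
  refine ⟨fun t ht => ?_, fun t ht => ?_, ?_⟩
  · change 0 < (lphState γ z ρ ω t).2.2
    rw [(hsl t ht).1]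
    have := hGpos t ht
    have := hω _ (hmem t ht)
    positivity
  · have hG := hGpos t ht
    have hs := H.solves _ (hmem' t ht)
    have hy : 0 < z * Real.exp t := by positivity
    have := hasDerivAt_lphState (t := t) (p := slope γ (lphState γ z ρ ω t)) h2 hz
      (H.rho_pos h1 _ (hmem' t ht)) (hω _ (hmem t ht))
      (by
        rw [(hsl t ht).2]
        refine hs.1.congr_deriv ?_
        field_simp)
      (by
        rw [(hsl t ht).2]
        refine hs.2.congr_deriv ?_
        field_simp)
    exact this
  · have hφ : AnalyticAt ℝ (fun t => z * Real.exp t) 0 := by fun_prop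
    have hφ0 : z * Real.exp 0 = z := by simp
    have hρa : AnalyticAt ℝ (fun t => ρ (z * Real.exp t)) 0 :=
      AnalyticAt.comp (g := ρ) (by rw [hφ0]; exact H.lph.analytic_rho) hφ
    have hωa : AnalyticAt ℝ (fun t => ω (z * Real.exp t)) 0 :=
      AnalyticAt.comp (g := ω) (by rw [hφ0]; exact H.lph.analytic_omega) hφ
    have hρda : AnalyticAt ℝ (fun t => deriv ρ (z * Real.exp t)) 0 :=
      AnalyticAt.comp (g := deriv ρ) (by rw [hφ0]; exact H.lph.analytic_rho.deriv) hφ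
    -- The slope is 0/0 at the sonic point, but for t < 0 it equals yρ'/ρ, which is analytic at y⋆;
    -- this gives its germ bound.
    have hqa : AnalyticAt ℝ
        (fun t => z * Real.exp t * deriv ρ (z * Real.exp t) / ρ (z * Real.exp t)) 0 :=
      (hφ.mul hρda).div hρa (by rw [hφ0]; exact hρ0.ne')
    have hVs : ContDiffAt ℝ 2 (fun t => (lphState γ z ρ ω t).2.2) 0 := by
      have e1 := hρa.contDiffAt (n := 2)
      have e2 := hωa.contDiffAt (n := 2)
      have e3 := hφ.contDiffAt (n := 2)
      simp only [lphState]
      refine ((contDiffAt_const.mul (e1.rpow_const_of_ne ?_)).div ((e3.pow 2).mul (e2.pow 2))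
        ?_).sub contDiffAt_const
      · rw [hφ0]; exact hρ0.ne'
      · simp only [hφ0]; positivity
    have hNd : HasDerivAt (fun t => (lphState γ z ρ ω t).1) _ 0 :=
      hasFDerivAt_fst.comp_hasDerivAt (0 : ℝ) hd0
    have hX2 := hasFDerivAt_snd.comp_hasDerivAt (0 : ℝ) hd0
    have hDd : HasDerivAt (fun t => (lphState γ z ρ ω t).2.1) _ 0 :=
      hasFDerivAt_fst.comp_hasDerivAt (0 : ℝ) hX2
    have hVd : HasDerivAt (fun t => (lphState γ z ρ ω t).2.2) _ 0 :=
      hasFDerivAt_snd.comp_hasDerivAt (0 : ℝ) hX2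
    obtain ⟨C₁, hC₁, b₁⟩ := exists_bound_of_hasDerivAt hNd
    obtain ⟨C₂, hC₂, b₂⟩ := exists_bound_of_hasDerivAt hDd
    obtain ⟨C₃, hC₃, b₃⟩ := exists_bound_of_hasDerivAt hqa.differentiableAt.hasDerivAt
    obtain ⟨C₄, hC₄, b₄⟩ := exists_second_order_bound hVs hVd
    replace b₄ := b₄.filter_mono (nhdsWithin_le_nhds (s := Iio 0))
    have b₄' : ∀ᶠ t in 𝓝[<] (0 : ℝ),
        |(lphState γ z ρ ω t).2.2 + sonicL γ n * t| ≤ C₄ * t ^ 2 := b₄.mono fun t ht => by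
      refine le_of_eq_of_le (congrArg _ ?_) ht
      simp only [hX0, sonicL, ContinuousLinearMap.coe_snd']
      ring
    obtain ⟨C₅, hC₅, b₅⟩ := exists_bound_div_add_inv hℓ hC₄ b₄'
    refine ⟨C₁ + C₂ + C₃ + C₅, ?_⟩
    filter_upwards [b₁, b₂, b₃, b₅, hnear] with t b₁ b₂ b₃ b₅ ht
    have hle : ∀ C, C ≤ C₁ + C₂ + C₃ + C₅ → ∀ x, x ≤ C * |t| →
        x ≤ (C₁ + C₂ + C₃ + C₅) * |t| := fun C hC x hx =>
      hx.trans (mul_le_mul_of_nonneg_right hC (abs_nonneg t))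
    simp only [hX0] at b₁ b₂
    refine ⟨hle C₁ (by linarith) _ b₁, hle C₂ (by linarith) _ b₂, hle C₃ (by linarith) _ ?_,
      hle (C₅) (by linarith) _ ?_⟩
    · have e1 : slope γ (lphState γ z ρ ω t) =
          z * Real.exp t * deriv ρ (z * Real.exp t) / ρ (z * Real.exp t) := by
        have := H.rho_pos h1 _ (hmem' t ht)
        rw [(hsl t ht).2, (H.solves _ (hmem' t ht)).1.deriv]
        field_simp
      have e2 : z * Real.exp 0 * deriv ρ (z * Real.exp 0) / ρ (z * Real.exp 0) = sonicP γ n := by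
        rw [hφ0, H.lph.deriv_rho, hωz, R₁_inv h1 h2 hn]
        field_simp
      rw [e2] at b₃
      rw [e1]
      exact b₃
    · exact b₅

/-- A local solution of the desingularized system is of Larson-Penston-Hunter type. -/
theorem IsLocalSolution.exists_isSubsonicLPH {n r : ℝ} {N D p V : ℝ → ℝ} (h1 : 1 < γ)
    (h2 : γ < 4 / 3) (hn : n ∈ sonicRange γ) (hr : 0 < r) (H : IsLocalSolution γ n r N D p V) :
    ∃ ρ ω : ℝ → ℝ, IsSubsonicLPH γ (sonicPos γ n) (sonicPos γ n * Real.exp (-r)) ρ ω ∧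
      ∀ t, ω (sonicPos γ n * Real.exp t) = (N t)⁻¹ := by
  have hn0 := pos_of_mem_sonicRange h1 h2 hn
  have hz := sonicPos_pos h1 h2 hn0
  have hzsq := sonicPos_sq h1 h2 hn0
  have hd : 0 < 4 - 3 * γ := by linarith
  set z := sonicPos γ n with hzdef
  set R : ℝ → ℝ := fun t => (4 - 3 * γ) * D t / (4 * Real.pi * N t) with hR
  have hRpos : ∀ t ∈ Ioo (-r) r, 0 < R t := fun t ht => by
    have := H.N_pos t ht
    have := H.D_pos t ht
    simp only [hR]
    positivity
  have hRd : ∀ t ∈ Ioo (-r) r, HasDerivAt R (R t * p t) t := fun t ht => by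
    have hN := H.N_pos t ht
    have := ((H.deriv_D t ht).const_mul (4 - 3 * γ)).div ((H.deriv_N t ht).const_mul (4 * Real.pi))
      (by positivity)
    refine this.congr_deriv ?_
    simp only [hR]
    field_simp
    ring
  set M : ℝ → ℝ := fun t => γ * R t ^ (γ - 1) * N t ^ 2 / (z * Real.exp t) ^ 2 with hM
  have hMpos : ∀ t ∈ Ioo (-r) r, 0 < M t := fun t ht => by
    have := H.N_pos t ht
    have := hRpos t ht
    simp only [hM]
    positivity
  have hMd : ∀ t ∈ Ioo (-r) r,
      HasDerivAt M (-(M t * (2 * (4 - 3 * γ) * N t - 4 - (γ + 1) * p t))) t := fun t ht => by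
    have hRt := hRpos t ht
    have e3 : HasDerivAt (fun t => z * Real.exp t) (z * Real.exp t) t :=
      (Real.hasDerivAt_exp t).const_mul z
    have hy : 0 < z * Real.exp t := by positivity
    have f1 := (((hRd t ht).rpow_const (p := γ - 1) (Or.inl hRt.ne')).const_mul γ).mul
      ((H.deriv_N t ht).pow 2)
    have f2 := f1.div (e3.pow 2) (pow_ne_zero 2 hy.ne')
    refine HasDerivAt.congr_deriv (f := M) f2 ?_
    rw [Real.rpow_sub_one hRt.ne']
    simp only [hM, Pi.pow_apply, Pi.mul_apply]
    field_simp
    ring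
  have h0mem : (0 : ℝ) ∈ Ioo (-r) r := ⟨by linarith, hr⟩
  -- M and 1 + V solve the same linear equation and agree at t = 0. So the abstract unknown V is
  -- indeed the one computed from ρ and ω.
  have hMV : ∀ t ∈ Ioo (-r) r, M t = 1 + V t := by
    have hq : ∀ t ∈ Ioo (-r) r, HasDerivAt (fun t => (1 + V t) / M t) 0 t := fun t ht => by
      have := (((H.deriv_V t ht).const_add 1).div (hMd t ht) (hMpos t ht).ne')
      refine this.congr_deriv ?_
      rw [div_eq_zero_iff]
      left
      ring
    intro t ht
    have := isOpen_Ioo.is_const_of_deriv_eq_zero isPreconnected_Ioo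
      (fun s hs => (hq s hs).differentiableAt.differentiableWithinAt)
      (fun s hs => (hq s hs).deriv) ht h0mem
    have hR0 : R 0 = sonicRho γ n := by simp [hR, H.D_zero, H.N_zero, sonicRho]
    have hM0 : M 0 = 1 := by
      simp only [hM, Real.exp_zero, mul_one, hzsq, hR0, H.N_zero]
      have := sonicRho_pos h1 h2 hn0
      rw [div_eq_one_iff_eq (by positivity)]
      ring
    simp only [hM0, H.V_zero, add_zero, div_one] at this
    rw [div_eq_one_iff_eq (hMpos t ht).ne'] at this
    exact this.symm
  have hlog : ∀ t, Real.log (z * Real.exp t / z) = t := fun t => by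
    rw [mul_div_cancel_left₀ _ hz.ne', Real.log_exp]
  have hG : ∀ t ∈ Ioo (-r) r, G γ (z * Real.exp t) (R t) (N t)⁻¹ =
      (z * Real.exp t) ^ 2 * (N t)⁻¹ ^ 2 * V t := fun t ht => by
    have hN := H.N_pos t ht
    have e := hMV t ht
    have hV : V t = M t - 1 := by linarith
    rw [hV, G]
    simp only [hM]
    field_simp
  have hh : ∀ t ∈ Ioo (-r) r, h γ (R t) (N t)⁻¹ = (N t)⁻¹ ^ 2 * (V t * p t) := fun t ht => by
    have hN := H.N_pos t ht
    rw [H.energy_eq t ht, h]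
    simp only [hR]
    have hd := hd.ne'
    generalize 4 - 3 * γ = d at hd
    field_simp
    ring
  have hlogd : ∀ y, 0 < y → HasDerivAt (fun y => Real.log (y / z)) (1 / y) y := fun y hy => by
    have := ((hasDerivAt_id y).div_const z).log (by simp only [id]; positivity)
    refine this.congr_deriv ?_
    simp only [id]
    field_simp
  have hρd : ∀ t ∈ Ioo (-r) r, HasDerivAt (fun y => R (Real.log (y / z)))
      (R t * p t / (z * Real.exp t)) (z * Real.exp t) := fun t ht => by
    have e := HasDerivAt.comp (z * Real.exp t) (h₂ := R) (h := fun y => Real.log (y / z))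
      (by rw [hlog]; exact hRd t ht) (hlogd _ (by positivity))
    refine e.congr_deriv ?_
    ring
  have hωd : ∀ t ∈ Ioo (-r) r, HasDerivAt (fun y => (N (Real.log (y / z)))⁻¹)
      ((4 - 3 * γ - 3 * (N t)⁻¹ - (N t)⁻¹ * p t) / (z * Real.exp t)) (z * Real.exp t) :=
    fun t ht => by
    have hN := H.N_pos t ht
    have e := HasDerivAt.comp (z * Real.exp t) (h₂ := fun t => (N t)⁻¹)
      (h := fun y => Real.log (y / z))
      (by rw [hlog]; exact (H.deriv_N t ht).inv hN.ne') (hlogd _ (by positivity))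
    refine e.congr_deriv ?_
    field_simp
    ring
  have hexp : ∀ y, 0 < y → y = z * Real.exp (Real.log (y / z)) := fun y hy => by
    rw [Real.exp_log (by positivity)]
    field_simp
  have hlog1 : AnalyticAt ℝ (fun y => Real.log (y / z)) z :=
    AnalyticAt.comp (g := Real.log) (by rw [div_self hz.ne']; exact analyticAt_log one_pos) (by fun_prop)
  have hNz : Real.log (z / z) = 0 := by rw [div_self hz.ne', Real.log_one]
  have hNan : AnalyticAt ℝ (fun y => N (Real.log (y / z))) z :=
    AnalyticAt.comp (g := N) (by rw [hNz]; exact H.analytic_N) hlog1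
  have hDan : AnalyticAt ℝ (fun y => D (Real.log (y / z))) z :=
    AnalyticAt.comp (g := D) (by rw [hNz]; exact H.analytic_D) hlog1
  have hmem : ∀ y, 0 < y → z * Real.exp (-r) < y → y < z * Real.exp r →
      Real.log (y / z) ∈ Ioo (-r) r := fun y hy ha hb => by
    constructor
    · rw [Real.lt_log_iff_exp_lt (by positivity), lt_div_iff₀ hz]; linarith
    · rw [Real.log_lt_iff_lt_exp (by positivity), div_lt_iff₀ hz]; linarith
  refine ⟨fun y => R (Real.log (y / z)), fun y => (N (Real.log (y / z)))⁻¹,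
    ⟨⟨?_, ?_, ?_, ?_, ?_, ?_, ?_, ?_⟩, ?_, ?_⟩, ?_⟩
  · exact (analyticAt_const.mul hDan).div (analyticAt_const.mul hNan)
      (by rw [hNz, H.N_zero]; positivity)
  · exact hNan.inv (by rw [hNz, H.N_zero]; positivity)
  · simp only [hNz]
    exact hRpos 0 h0mem
  · have := hG 0 h0mem
    simp only [hNz]
    simpa [H.V_zero] using this
  · have := hh 0 h0mem
    simp only [hNz]
    simpa [H.V_zero] using this
  · have := (hρd 0 h0mem).deriv
    simp only [hNz]
    simp only [Real.exp_zero, mul_one] at this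
    rw [this, H.N_zero, R₁_inv h1 h2 hn, H.p_zero]
  · have := (hωd 0 h0mem).deriv
    simp only [hNz]
    simp only [Real.exp_zero, mul_one] at this
    rw [this, W₁, H.N_zero, R₁_inv h1 h2 hn, H.p_zero]
  · have e1 : ∀ᶠ y in 𝓝 z, y ∈ Ioo (z * Real.exp (-r)) (z * Real.exp r) := by
      refine Ioo_mem_nhds ?_ ?_
      · have : Real.exp (-r) < 1 := by rw [Real.exp_lt_one_iff]; linarith
        nlinarith
      · have : 1 < Real.exp r := by rw [Real.one_lt_exp_iff]; exact hr
        nlinarith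
    filter_upwards [e1, lt_mem_nhds hz] with y hy hy0
    have ht := hmem y hy0 hy.1 hy.2
    have hye := hexp y hy0
    set t := Real.log (y / z) with htdef
    clear_value t
    subst hye
    have hN := H.N_pos t ht
    unfold SolvesMulAt
    rw [(hρd t ht).deriv, (hωd t ht).deriv]
    simp only [hlog]
    rw [hG t ht, hh t ht]
    constructor
    · field_simp
    · field_simp
  · intro y hy
    have hy0 : 0 < y := lt_trans (by positivity) hy.1
    have ht := hmem y hy0 hy.1 (hy.2.trans (by nlinarith [Real.add_one_le_exp r]))
    have ht' : Real.log (y / z) < 0 := Real.log_neg (by positivity) ((div_lt_one hz).2 hy.2)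
    have := hG _ ht
    rw [← hexp y hy0] at this
    rw [this]
    have := H.V_pos _ ⟨ht.1, ht'⟩
    have := H.N_pos _ ht
    positivity
  · intro y hy
    have hy0 : 0 < y := lt_trans (by positivity) hy.1
    have ht := hmem y hy0 hy.1 (hy.2.trans (by nlinarith [Real.add_one_le_exp r]))
    have ht' : Real.log (y / z) < 0 := Real.log_neg (by positivity) ((div_lt_one hz).2 hy.2)
    have hye := hexp y hy0
    set t := Real.log (y / z) with htdef
    clear_value t
    subst hye
    have hN := H.N_pos t ht
    have hV := H.V_pos t ⟨ht.1, ht'⟩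
    unfold SolvesAt
    simp only [hlog]
    rw [hG t ht, hh t ht]
    constructor
    · refine (hρd t ht).congr_deriv ?_
      field_simp
    · refine (hωd t ht).congr_deriv ?_
      field_simp
  · intro t
    simp only [hlog]

end Translation

/-! ### Invariance of the number of simple zeros in a family. -/

section ZeroCount

variable {I : Set ℝ} {g g' : ℝ → ℝ → ℝ} {T : ℝ → ℝ}

/-- A simple zero persists under small perturbations of the parameter, and stays locally unique. -/
lemma exists_unique_zero_near {n a : ℝ}
    (hT : ∀ t, T n < t → ∀ᶠ n' in 𝓝[I] n, T n' < t)
    (hder : ∀ n ∈ I, ∀ t ∈ Ioo (T n) 0, HasDerivAt (g n) (g' n t) t)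
    (hg : ∀ t ∈ Ioo (T n) 0, Tendsto (fun x : ℝ × ℝ => g x.1 x.2) (𝓝[I] n ×ˢ 𝓝 t) (𝓝 (g n t)))
    (hg' : Tendsto (fun x : ℝ × ℝ => g' x.1 x.2) (𝓝[I] n ×ˢ 𝓝 a) (𝓝 (g' n a)))
    (hn : n ∈ I) (ha : a ∈ Ioo (T n) 0) (h0 : g n a = 0) (h1 : g' n a ≠ 0) :
    ∃ η₀ > 0, ∀ η ∈ Ioo 0 η₀, ∀ᶠ n' in 𝓝[I] n,
      ∃ t, (t ∈ Ioo (a - η) (a + η) ∧ g n' t = 0) ∧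
        ∀ s, s ∈ Ioo (a - η) (a + η) ∧ g n' s = 0 → s = t := by
  set c := g' n a with hc
  have e1 : ∀ᶠ x : ℝ × ℝ in 𝓝[I] n ×ˢ 𝓝 a, 0 < c * g' x.1 x.2 :=
    (hg'.const_mul c).eventually (lt_mem_nhds (mul_self_pos.2 h1))
  obtain ⟨U, hU, W, hW, hUW⟩ := (Filter.eventually_prod_iff.1 e1)
  obtain ⟨η₁, hη₁, hball⟩ := Metric.eventually_nhds_iff.1 hW
  obtain ⟨η₀, hη₀, hη₀1, hη₀2, hη₀3⟩ : ∃ η₀ > 0, η₀ ≤ η₁ ∧ T n < a - η₀ ∧ a + η₀ < 0 := by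
    refine ⟨min η₁ (min ((a - T n) / 2) (-a / 2)), ?_, min_le_left _ _, ?_, ?_⟩
    · have := ha.1
      have := ha.2
      refine lt_min hη₁ (lt_min ?_ ?_) <;> linarith
    · have := (min_le_right η₁ (min ((a - T n) / 2) (-a / 2))).trans (min_le_left _ _)
      have := ha.1
      linarith
    · have := (min_le_right η₁ (min ((a - T n) / 2) (-a / 2))).trans (min_le_right _ _)
      have := ha.2
      linarith
  refine ⟨η₀, hη₀, fun η hη => ?_⟩
  -- The factor c = g'(a) normalizes the sign, so c g is strictly increasing near a for every nearby
  -- parameter: one sign change, hence exactly one zero.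
  have hmono : ∀ n' ∈ I, U n' → T n' < a - η₀ →
      StrictMonoOn (fun t => c * g n' t) (Icc (a - η) (a + η)) := by
    intro n' hn' hUn hTn
    have hd : ∀ t ∈ Icc (a - η) (a + η), HasDerivAt (fun t => c * g n' t) (c * g' n' t) t :=
      fun t ht => (hder n' hn' t ⟨by linarith [ht.1, hη.2], by linarith [ht.2, hη.2]⟩).const_mul c
    refine strictMonoOn_of_deriv_pos (convex_Icc _ _)
      (fun t ht => (hd t ht).continuousAt.continuousWithinAt) fun t ht => ?_
    rw [interior_Icc] at ht
    rw [(hd t ⟨ht.1.le, ht.2.le⟩).deriv]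
    refine hUW hUn (hball ?_)
    rw [Real.dist_eq, abs_lt]
    constructor <;> linarith [ht.1, ht.2, hη.2]
  have hn0 := hmono n hn (hU.self_of_nhdsWithin hn) hη₀2
  have hη0 := hη.1
  have hl : c * g n (a - η) < 0 := by
    have := hn0 (a := a - η) (b := a) ⟨le_rfl, by linarith⟩ ⟨by linarith, by linarith⟩ (by linarith)
    simpa [h0] using this
  have hr : 0 < c * g n (a + η) := by
    have := hn0 (a := a) (b := a + η) ⟨by linarith, by linarith⟩ ⟨by linarith, by linarith⟩
      (by linarith)
    simpa [h0] using this
  have hpt : ∀ t ∈ Ioo (T n) 0, Tendsto (fun n' => c * g n' t) (𝓝[I] n) (𝓝 (c * g n t)) :=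
    fun t ht => ((hg t ht).comp (tendsto_id.prodMk tendsto_const_nhds)|>.const_mul c)
  have e2 := (hpt (a - η) ⟨by linarith [hη.2], by linarith [hη.2]⟩).eventually (gt_mem_nhds hl)
  have e3 := (hpt (a + η) ⟨by linarith [hη.2], by linarith [hη.2]⟩).eventually (lt_mem_nhds hr)
  filter_upwards [hU, e2, e3, hT _ hη₀2, self_mem_nhdsWithin] with n' hUn e2 e3 hTn hn'
  have hm := hmono n' hn' hUn hTn
  have hcont : ContinuousOn (fun t => c * g n' t) (Icc (a - η) (a + η)) := fun t ht =>
    ((hder n' hn' t ⟨by linarith [ht.1, hη.2], by linarith [ht.2, hη.2]⟩).const_mul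
      c).continuousAt.continuousWithinAt
  obtain ⟨t, ht, ht0⟩ := intermediate_value_Ioo (by linarith) hcont ⟨e2, e3⟩
  refine ⟨t, ⟨ht, ?_⟩, fun s hs => ?_⟩
  · exact (mul_eq_zero.1 ht0).resolve_left h1
  · refine hm.injOn ⟨hs.1.1.le, hs.1.2.le⟩ ⟨ht.1.le, ht.2.le⟩ ?_
    simp only at ht0
    simp only [hs.2, ht0, mul_zero]

/-- The number of zeros of a family of functions whose zeros are simple and stay away from the end
points of the domain is finite and does not depend on the parameter. -/
theorem finite_zeros_and_ncard_eq (hI : IsPreconnected I)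
    (hT : ∀ n ∈ I, ∀ t, T n < t → ∀ᶠ n' in 𝓝[I] n, T n' < t)
    (hsub : ∀ n ∈ I, ∃ α β, T n < α ∧ β < 0 ∧ ∀ᶠ n' in 𝓝[I] n,
      ∀ t ∈ Ioo (T n') 0, g n' t = 0 → t ∈ Icc α β)
    (hder : ∀ n ∈ I, ∀ t ∈ Ioo (T n) 0, HasDerivAt (g n) (g' n t) t)
    (hg : ∀ n ∈ I, ∀ t ∈ Ioo (T n) 0,
      Tendsto (fun x : ℝ × ℝ => g x.1 x.2) (𝓝[I] n ×ˢ 𝓝 t) (𝓝 (g n t)))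
    (hg' : ∀ n ∈ I, ∀ t ∈ Ioo (T n) 0,
      Tendsto (fun x : ℝ × ℝ => g' x.1 x.2) (𝓝[I] n ×ˢ 𝓝 t) (𝓝 (g' n t)))
    (hsimple : ∀ n ∈ I, ∀ t ∈ Ioo (T n) 0, g n t = 0 → g' n t ≠ 0) :
    (∀ n ∈ I, {t | t ∈ Ioo (T n) 0 ∧ g n t = 0}.Finite) ∧
    ∀ n ∈ I, ∀ n' ∈ I, {t | t ∈ Ioo (T n) 0 ∧ g n t = 0}.ncard =
      {t | t ∈ Ioo (T n') 0 ∧ g n' t = 0}.ncard := by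
  have hfin : ∀ n ∈ I, {t | t ∈ Ioo (T n) 0 ∧ g n t = 0}.Finite := by
    intro n hn
    obtain ⟨α, β, hα, hβ, hZ⟩ := hsub n hn
    have hZn := hZ.self_of_nhdsWithin hn
    have key : ({t | t ∈ Ioo (T n) 0 ∧ g n t = 0} ∩ Icc α β).Finite := by
      refine isCompact_Icc.induction_on
        (p := fun s => ({t | t ∈ Ioo (T n) 0 ∧ g n t = 0} ∩ s).Finite) (by simp) ?_ ?_ ?_
      · exact fun s t hst ht => ht.subset (inter_subset_inter_right _ hst)
      · intro s t hs ht
        rw [inter_union_distrib_left]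
        exact hs.union ht
      · intro t ht
        have ht' : t ∈ Ioo (T n) 0 := ⟨hα.trans_le ht.1, ht.2.trans_lt hβ⟩
        by_cases h0 : g n t = 0
        · obtain ⟨η₀, hη₀, hη⟩ := exists_unique_zero_near (hT n hn) hder (hg n hn) (hg' n hn t ht')
            hn ht' h0 (hsimple n hn t ht' h0)
          obtain ⟨u, -, hu⟩ := (hη (η₀ / 2) ⟨by linarith, by linarith⟩).self_of_nhdsWithin hn
          refine ⟨Ioo (t - η₀ / 2) (t + η₀ / 2),
            mem_nhdsWithin_of_mem_nhds (Ioo_mem_nhds (by linarith) (by linarith)), ?_⟩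
          exact (finite_singleton u).subset fun s hs => hu s ⟨hs.2, hs.1.2⟩
        · have := (hder n hn t ht').continuousAt.eventually_ne h0
          refine ⟨{s | g n s ≠ 0}, mem_nhdsWithin_of_mem_nhds this, ?_⟩
          convert finite_empty
          ext s
          simp only [mem_inter_iff, mem_ofPred_eq, mem_empty_iff_false, iff_false]
          rintro ⟨⟨-, h⟩, h'⟩
          exact h' h
    exact key.subset fun t ht => ⟨ht, hZn t ht.1 ht.2⟩
  refine ⟨hfin, ?_⟩
  -- A locally constant natural number is constant on a preconnected set. Locally, each old zero has
  -- exactly one successor in its own window, compactness excludes zeros in the rest of [α, β], and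
  -- `hsub` excludes them outside.
  suffices hloc : ∀ n ∈ I, ∀ᶠ n' in 𝓝[I] n, {t | t ∈ Ioo (T n') 0 ∧ g n' t = 0}.ncard =
      {t | t ∈ Ioo (T n) 0 ∧ g n t = 0}.ncard by
    intro n hn n' hn'
    refine hI.constant (Y := ℕ) (f := fun n : ℝ => {t | t ∈ Ioo (T n) 0 ∧ g n t = 0}.ncard) ?_ hn hn'
    intro m hm
    have := (hloc m hm).mono fun _ h => h.symm
    exact Tendsto.congr' this tendsto_const_nhds
  intro n hn
  set A := {t | t ∈ Ioo (T n) 0 ∧ g n t = 0} with hA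
  have hAfin : A.Finite := hfin n hn
  obtain ⟨α, β, hα, hβ, hZ⟩ := hsub n hn
  choose! η₀ hη₀ hη using fun a (ha : a ∈ A) => exists_unique_zero_near (hT n hn) hder (hg n hn)
    (hg' n hn a ha.1) hn ha.1 ha.2 (hsimple n hn a ha.1 ha.2)
  obtain ⟨η, hηpos, hηlt, hηsep⟩ : ∃ η > 0, (∀ a ∈ A, η < η₀ a) ∧
      (∀ a ∈ A, a ∈ Ioo (T n + η) (-η)) ∧ ∀ a ∈ A, ∀ b ∈ A, a ≠ b → 2 * η < |a - b| := by
    have e0 : ∀ᶠ η in 𝓝[>] (0 : ℝ), 0 < η := self_mem_nhdsWithin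
    have hlin : ∀ {c : ℝ}, 0 < c → ∀ᶠ η in 𝓝[>] (0 : ℝ), 2 * η < c := fun {c} hc => by
      filter_upwards [Ioo_mem_nhdsGT (show (0 : ℝ) < c / 2 by linarith)] with η hη
      linarith [hη.2]
    have e1 : ∀ᶠ η in 𝓝[>] (0 : ℝ), ∀ a ∈ A, η < η₀ a :=
      (eventually_all_finite hAfin).2 fun a ha => by
        filter_upwards [hlin (hη₀ a ha), e0] with η h1 h2
        linarith
    have e2 : ∀ᶠ η in 𝓝[>] (0 : ℝ), ∀ a ∈ A, a ∈ Ioo (T n + η) (-η) :=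
      (eventually_all_finite hAfin).2 fun a ha => by
        filter_upwards [hlin (sub_pos.2 ha.1.1), hlin (neg_pos.2 ha.1.2), e0] with η h1 h2 h3
        constructor <;> linarith
    have e3 : ∀ᶠ η in 𝓝[>] (0 : ℝ), ∀ a ∈ A, ∀ b ∈ A, a ≠ b → 2 * η < |a - b| :=
      (eventually_all_finite hAfin).2 fun a _ => (eventually_all_finite hAfin).2 fun b _ => by
        by_cases hab : a = b
        · simp [hab]
        · filter_upwards [hlin (abs_pos.2 (sub_ne_zero.2 hab))] with η h1 _ using h1
    obtain ⟨η, h0, h1, h2, h3⟩ := (e0.and (e1.and (e2.and e3))).exists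
    exact ⟨η, h0, h1, h2, h3⟩
  have hex : ∀ᶠ n' in 𝓝[I] n, ∀ a ∈ A, ∃ t, (t ∈ Ioo (a - η) (a + η) ∧ g n' t = 0) ∧
        ∀ s, s ∈ Ioo (a - η) (a + η) ∧ g n' s = 0 → s = t :=
    (eventually_all_finite hAfin).2 fun a ha => hη a ha η ⟨hηpos, hηlt a ha⟩
  have hK : IsCompact (Icc α β \ ⋃ a ∈ A, Ioo (a - η) (a + η)) :=
    isCompact_Icc.diff (isOpen_biUnion fun _ _ => isOpen_Ioo)
  have hne : ∀ᶠ n' in 𝓝[I] n, ∀ t ∈ Icc α β \ ⋃ a ∈ A, Ioo (a - η) (a + η), g n' t ≠ 0 := by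
    suffices hP : ∀ t ∈ Icc α β \ ⋃ a ∈ A, Ioo (a - η) (a + η),
        ∀ᶠ x : ℝ × ℝ in 𝓝[I] n ×ˢ 𝓝 t, g x.1 x.2 ≠ 0 by
      simp only [← eventually_iSup, ← hK.prod_nhdsSet_eq_biSup] at hP
      exact hP.curry.mono fun _ h => h.self_of_nhdsSet
    intro t ht
    have ht' : t ∈ Ioo (T n) 0 := ⟨hα.trans_le ht.1.1, ht.1.2.trans_lt hβ⟩
    refine (hg n hn t ht').eventually_ne fun h0 => ht.2 ?_
    exact mem_biUnion (show t ∈ A from ⟨ht', h0⟩) ⟨by linarith, by linarith⟩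
  have hTs : ∀ᶠ n' in 𝓝[I] n, ∀ a ∈ A, T n' < a - η :=
    (eventually_all_finite hAfin).2 fun a ha => hT n hn _ (by linarith [(hηsep.1 a ha).1])
  filter_upwards [hex, hne, hTs, hZ] with n' hex hne hTs hZ
  choose t ht hu using hex
  symm
  refine ncard_congr (fun a ha => t a ha) (fun a ha => ?_) (fun a b ha hb hab => ?_)
    (fun s hs => ?_)
  · have h1 := (ht a ha).1
    exact ⟨⟨(hTs a ha).trans h1.1, by linarith [h1.2, (hηsep.1 a ha).2]⟩, (ht a ha).2⟩
  · by_contra hne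
    have h1 := (ht a ha).1
    have h2 := (ht b hb).1
    have h3 := hηsep.2 a ha b hb hne
    rw [hab] at h1
    rw [lt_abs] at h3
    rcases h3 with h3 | h3 <;> linarith [h1.1, h1.2, h2.1, h2.2]
  · have h1 : s ∈ ⋃ a ∈ A, Ioo (a - η) (a + η) := by
      by_contra h
      exact hne s ⟨hZ s hs.1 hs.2, h⟩ hs.2
    obtain ⟨a, ha, hsa⟩ := mem_iUnion₂.1 h1
    exact ⟨a, ha, (hu a ha s ⟨hsa, hs.2⟩).symm⟩

end ZeroCount

/-! ### Uniqueness for planar linear systems. -/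

section LinearSystem

/-- A solution of a linear system of two equations that vanishes at a point vanishes to its
right. -/
lemma eq_zero_of_linear_system {φ ψ a b c e : ℝ → ℝ} {s t : ℝ} (hst : s ≤ t)
    (hφ : ∀ x ∈ Icc s t, HasDerivAt φ (a x * φ x + b x * ψ x) x)
    (hψ : ∀ x ∈ Icc s t, HasDerivAt ψ (c x * φ x + e x * ψ x) x)
    (ha : ContinuousOn a (Icc s t)) (hb : ContinuousOn b (Icc s t))
    (hc : ContinuousOn c (Icc s t)) (he : ContinuousOn e (Icc s t))
    (hφ0 : φ s = 0) (hψ0 : ψ s = 0) : φ t = 0 ∧ ψ t = 0 := by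
  obtain ⟨A, hA⟩ := isCompact_Icc.exists_bound_of_continuousOn ha
  obtain ⟨B, hB⟩ := isCompact_Icc.exists_bound_of_continuousOn hb
  obtain ⟨C, hC⟩ := isCompact_Icc.exists_bound_of_continuousOn hc
  obtain ⟨E, hE⟩ := isCompact_Icc.exists_bound_of_continuousOn he
  have hder : ∀ x ∈ Icc s t, HasDerivAt (fun x => (φ x, ψ x))
      (a x * φ x + b x * ψ x, c x * φ x + e x * ψ x) x := fun x hx => (hφ x hx).prodMk (hψ x hx)
  have := norm_le_gronwallBound_of_norm_deriv_right_le (δ := 0) (K := A + B + C + E) (ε := 0)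
    (f := fun x => (φ x, ψ x)) (a := s) (b := t)
    (fun x hx => (hder x hx).continuousAt.continuousWithinAt)
    (fun x hx => (hder x ⟨hx.1, hx.2.le⟩).hasDerivWithinAt) (by simp [hφ0, hψ0])
    (fun x hx => by
      have hx' : x ∈ Icc s t := ⟨hx.1, hx.2.le⟩
      have h1 : ‖φ x‖ ≤ ‖(φ x, ψ x)‖ := le_max_left _ _
      have h2 : ‖ψ x‖ ≤ ‖(φ x, ψ x)‖ := le_max_right _ _
      set M := ‖(φ x, ψ x)‖
      have hb : ∀ {u v Q : ℝ}, ‖u‖ ≤ Q → ‖v‖ ≤ M → ‖u * v‖ ≤ Q * M := fun hu hv => by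
        rw [norm_mul]
        exact mul_le_mul hu hv (norm_nonneg _) ((norm_nonneg _).trans hu)
      have hM : 0 ≤ M := norm_nonneg _
      have hA0 := (norm_nonneg _).trans (hA x hx')
      have hB0 := (norm_nonneg _).trans (hB x hx')
      have hC0 := (norm_nonneg _).trans (hC x hx')
      have hE0 := (norm_nonneg _).trans (hE x hx')
      rw [add_zero]
      refine max_le ?_ ?_
      · refine (norm_add_le _ _).trans ?_
        have := hb (hA x hx') h1
        have := hb (hB x hx') h2
        nlinarith [mul_nonneg hC0 hM, mul_nonneg hE0 hM]
      · refine (norm_add_le _ _).trans ?_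
        have := hb (hC x hx') h1
        have := hb (hE x hx') h2
        nlinarith [mul_nonneg hA0 hM, mul_nonneg hB0 hM]) t ⟨hst, le_rfl⟩
  rw [gronwallBound_ε0_δ0] at this
  have h0 := norm_le_zero_iff.1 this
  exact ⟨congrArg Prod.fst h0, congrArg Prod.snd h0⟩

end LinearSystem

/-! ### Crossing the Friedman velocity; the fundamental set is non-empty. -/

section Crossing

variable {γ : ℝ}

lemma farField_lt_friedman (h1 : 1 < γ) (h2 : γ < 4 / 3) : 1 / (2 - γ) < 3 / (4 - 3 * γ) := by
  rw [div_lt_div_iff₀ (by linarith) (by linarith)]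
  linarith

lemma exists_sonicPos_eq (h1 : 1 < γ) (h2 : γ < 4 / 3) {z : ℝ} (hz : z ∈ Icc (yf γ) (yF γ)) :
    ∃ n ∈ sonicRange γ, sonicPos γ n = z := by
  rw [← sonicPos_farField h1 h2, ← sonicPos_friedman h1 h2] at hz
  exact intermediate_value_Icc (farField_lt_friedman h1 h2).le
    ((sonicPos_continuousOn h1 h2).mono fun n hn => pos_of_mem_sonicRange h1 h2 hn) hz

lemma sonicPos_lt_iff (h1 : 1 < γ) (h2 : γ < 4 / 3) {n n' : ℝ} (hn : n ∈ sonicRange γ)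
    (hn' : n' ∈ sonicRange γ) : sonicPos γ n < sonicPos γ n' ↔ n < n' :=
  (sonicPos_strictMonoOn h1 h2).lt_iff_lt (pos_of_mem_sonicRange h1 h2 hn)
    (pos_of_mem_sonicRange h1 h2 hn')

lemma farField_mem_sonicRange (h1 : 1 < γ) (h2 : γ < 4 / 3) : 1 / (2 - γ) ∈ sonicRange γ :=
  ⟨le_rfl, (farField_lt_friedman h1 h2).le⟩

lemma friedman_mem_sonicRange (h1 : 1 < γ) (h2 : γ < 4 / 3) : 3 / (4 - 3 * γ) ∈ sonicRange γ :=
  ⟨(farField_lt_friedman h1 h2).le, le_rfl⟩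

lemma yf_pos (h1 : 1 < γ) (h2 : γ < 4 / 3) : 0 < yf γ := by
  rw [← sonicPos_farField h1 h2]
  exact sonicPos_pos h1 h2 (pos_of_mem_sonicRange h1 h2 (farField_mem_sonicRange h1 h2))

/-- The extension witnessing `OmegaEq` starts at some a < y, and this a bounds the sonic time from
above. -/
lemma omegaEq_mem_Ioo {z y v : ℝ} (hyz : y < z) (h : OmegaEq γ z y v) :
    y ∈ Ioo (sonicTime γ z) z := by
  obtain ⟨a, ha, ρ, ω, H, -⟩ := h
  refine ⟨lt_of_le_of_lt (csInf_le ⟨0, fun b hb => hb.1.1.le⟩ ?_) ha.2, hyz⟩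
  exact ⟨⟨ha.1, ha.2.trans hyz⟩, ρ, ω, H⟩

/-- The solutions emanating from the sonic points near the Friedman one take the Friedman
velocity. -/
theorem exists_forall_mem_crossingSet (h1 : 1 < γ) (h2 : γ < 4 / 3) :
    ∃ δ > 0, ∀ n ∈ sonicRange γ, n < 3 / (4 - 3 * γ) → |n - 3 / (4 - 3 * γ)| < δ →
      sonicPos γ n ∈ crossingSet γ := by
  obtain ⟨r, hr, Z, hZ, hclose, -⟩ := exists_localFamily h1 h2
  have hF := friedman_mem_sonicRange h1 h2
  have hd : 0 < 4 - 3 * γ := by linarith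
  set nF := 3 / (4 - 3 * γ) with hnF
  have hdn : (4 - 3 * γ) * nF = 3 := by rw [hnF]; field_simp
  have hnF0 : 0 < nF := by positivity
  obtain ⟨-, N, D, p, V, hloc, hZN⟩ := hZ nF hF
  -- At n_F the derivative of N at 0 reduces to n_F times the LPH slope, which is negative; so N
  -- exceeds n_F just to the left of the sonic point.
  obtain ⟨t₁, ht₁, hN₁⟩ : ∃ t ∈ Ioo (-r) 0, nF < N t := by
    have hder := hloc.deriv_N 0 ⟨by linarith, hr⟩
    rw [hloc.N_zero, hloc.p_zero, hdn, sub_self, zero_add] at hder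
    have hneg : nF * sonicP γ nF < 0 := mul_neg_of_pos_of_neg hnF0 (sonicP_friedman h1 h2)
    have h3 := (hasDerivAt_iff_tendsto_slope.1 hder).eventually (gt_mem_nhds hneg)
    have h4 : ∀ᶠ t in 𝓝[<] (0 : ℝ), _ := h3.filter_mono (nhdsWithin_mono _ fun t ht => ne_of_lt ht)
    obtain ⟨t, h5, h6⟩ := (h4.and (Ioo_mem_nhdsLT (show -r < (0 : ℝ) by linarith))).exists
    refine ⟨t, h6, ?_⟩
    rw [slope_def_field, hloc.N_zero, sub_zero, div_neg_iff] at h5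
    rcases h5 with h5 | h5
    · linarith [h5.1]
    · linarith [h5.2, h6.2]
  obtain ⟨δ, hδ, h3⟩ := hclose nF hF ((N t₁ - nF) / 2) (by linarith)
  refine ⟨δ, hδ, fun n hn hlt hnn => ?_⟩
  obtain ⟨-, N', D', p', V', hloc', hZN'⟩ := hZ n hn
  have h4 := h3 n hn hnn t₁ ht₁
  rw [hZN t₁ ht₁, hZN' t₁ ht₁] at h4
  have h5 : |N t₁ - N' t₁| ≤ (N t₁ - nF) / 2 := (le_max_left _ _).trans h4
  have h6 : nF < N' t₁ := by linarith [le_abs_self (N t₁ - N' t₁)]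
  have hcont : ContinuousOn N' (Icc t₁ 0) := fun t ht =>
    (hloc'.deriv_N t ⟨by linarith [ht₁.1, ht.1], by linarith [ht.2]⟩).continuousAt.continuousWithinAt
  obtain ⟨t, ht, htN⟩ := intermediate_value_Ioo' ht₁.2.le hcont
    (show nF ∈ Ioo (N' 0) (N' t₁) from ⟨by rw [hloc'.N_zero]; exact hlt, h6⟩)
  obtain ⟨ρ, ω, H, hω⟩ := hloc'.exists_isSubsonicLPH h1 h2 hn hr
  have hz := sonicPos_pos h1 h2 (pos_of_mem_sonicRange h1 h2 hn)
  have hyz : sonicPos γ n * Real.exp t < sonicPos γ n := by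
    have := Real.exp_lt_one_iff.2 ht.2
    nlinarith
  have hOm : OmegaEq γ (sonicPos γ n) (sonicPos γ n * Real.exp t) (omegaF γ) := by
    refine ⟨sonicPos γ n * Real.exp (-r), ⟨by positivity, ?_⟩, ρ, ω, H, ?_⟩
    · exact mul_lt_mul_of_pos_left (Real.exp_lt_exp.2 (ht₁.1.trans ht.1)) hz
    · rw [hω, htN, hnF, omegaF, inv_div]
  refine ⟨⟨?_, ?_⟩, _, omegaEq_mem_Ioo hyz hOm, hOm⟩
  · rw [← sonicPos_farField h1 h2]
    exact (sonicPos_strictMonoOn h1 h2).monotoneOn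
      (pos_of_mem_sonicRange h1 h2 (farField_mem_sonicRange h1 h2))
      (pos_of_mem_sonicRange h1 h2 hn) hn.1
  · rw [← sonicPos_friedman h1 h2, sonicPos_lt_iff h1 h2 hn hF]
    exact hlt

theorem fundamentalSet_nonempty (h1 : 1 < γ) (h2 : γ < 4 / 3) : (fundamentalSet γ).Nonempty := by
  obtain ⟨δ, hδ, h3⟩ := exists_forall_mem_crossingSet h1 h2
  have hlt := farField_lt_friedman h1 h2
  set nF := 3 / (4 - 3 * γ) with hnF
  set n₁ := max (1 / (2 - γ)) (nF - δ / 2) with hn₁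
  have hn₁F : n₁ < nF := max_lt hlt (by linarith)
  have hn₁r : n₁ ∈ sonicRange γ := ⟨le_max_left _ _, hn₁F.le⟩
  have hF := friedman_mem_sonicRange h1 h2
  have h4 : ∀ n ∈ sonicRange γ, n₁ ≤ n → n < nF → sonicPos γ n ∈ crossingSet γ := by
    intro n hn hn1 hnF
    refine h3 n hn hnF ?_
    have := le_max_right (1 / (2 - γ)) (nF - δ / 2)
    rw [abs_lt]
    constructor <;> linarith
  refine ⟨sonicPos γ n₁, (h4 n₁ hn₁r le_rfl hn₁F).1, fun z hz => ?_⟩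
  obtain ⟨n, hn, rfl⟩ := exists_sonicPos_eq h1 h2
    (z := z) ⟨(h4 n₁ hn₁r le_rfl hn₁F).1.1.trans hz.1, hz.2.le⟩
  refine h4 n hn ?_ ?_
  · by_contra! h
    exact absurd hz.1 (not_le.2 ((sonicPos_lt_iff h1 h2 hn hn₁r).2 h))
  · rw [← sonicPos_lt_iff h1 h2 hn hF, sonicPos_friedman h1 h2]
    exact hz.2

/-- The trajectory `X` reaches the Friedman velocity for the first time, backward from the sonic
point, at time `T`. -/
structure IsFirstCrossing (γ n τ T : ℝ) (X : ℝ → ℝ × ℝ × ℝ) : Prop where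
  traj : IsTraj γ n τ X
  lt : τ < T
  neg : T < 0
  eq : (X T).1 = 3 / (4 - 3 * γ)
  pos : ∀ t ∈ Ioo τ 0, 0 < (X t).1
  lt_of_lt : ∀ t ∈ Ioo T 0, (X t).1 < 3 / (4 - 3 * γ)

theorem exists_isFirstCrossing (h1 : 1 < γ) (h2 : γ < 4 / 3) {n : ℝ} (hn : n ∈ sonicRange γ)
    (hc : sonicPos γ n ∈ crossingSet γ) : ∃ τ T X, IsFirstCrossing γ n τ T X := by
  obtain ⟨⟨-, hz2⟩, y₀, hy₀, a, ha, ρ, ω, H, hω⟩ := hc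
  have hn0 := pos_of_mem_sonicRange h1 h2 hn
  have hd : 0 < 4 - 3 * γ := by linarith
  have hz := sonicPos_pos h1 h2 hn0
  rw [← sonicPos_friedman h1 h2, sonicPos_lt_iff h1 h2 hn (friedman_mem_sonicRange h1 h2)] at hz2
  have hωz : ω (sonicPos γ n) = n⁻¹ := by
    obtain ⟨h3, h4, h5⟩ := sonic_unique h1 h2 hz H.lph.rho_pos H.lph.sonic H.lph.regular
    have := (sonicPos_strictMonoOn h1 h2).injOn hn0 (mem_Ioi.2 (inv_pos.2 h3)) h5
    rw [eq_comm, inv_eq_iff_eq_inv]; exact this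
  set z := sonicPos γ n with hzdef
  have hF0 : 0 < omegaF γ := by rw [omegaF]; positivity
  have hωzF : omegaF γ < ω z := by
    rw [hωz, omegaF, lt_inv_comm₀ (by positivity) hn0, inv_div]
    exact hz2
  have hcont : ContinuousOn ω (Icc y₀ z) := by
    intro x hx
    rcases eq_or_lt_of_le hx.2 with rfl | hxz
    · exact H.lph.analytic_omega.continuousAt.continuousWithinAt
    · exact (H.solves x ⟨ha.2.trans_le hx.1, hxz⟩).2.continuousAt.continuousWithinAt
  set S := Icc y₀ z ∩ ω ⁻¹' {omegaF γ} with hS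
  have hScomp : IsCompact S :=
    isCompact_Icc.of_isClosed_subset (hcont.preimage_isClosed_of_isClosed isClosed_Icc
      isClosed_singleton) inter_subset_left
  obtain ⟨y₁, hy₁, hmax⟩ := hScomp.exists_isGreatest ⟨y₀, ⟨le_rfl, hy₀.2.le⟩, hω⟩
  have hy₁z : y₁ < z := lt_of_le_of_ne hy₁.1.2 fun h => by
    have := hy₁.2
    rw [h] at this
    exact hωzF.ne' this
  have hgt : ∀ y ∈ Ioo y₁ z, omegaF γ < ω y := by
    intro y hy
    by_contra! hle
    obtain ⟨x, hx, hxω⟩ := intermediate_value_Icc hy.2.le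
      (hcont.mono (Icc_subset_Icc_left (hy₁.1.1.trans hy.1.le))) ⟨hle, hωzF.le⟩
    have := hmax ⟨⟨hy₁.1.1.trans (hy.1.le.trans hx.1), hx.2⟩, hxω⟩
    linarith [hy.1, hx.1]
  have hay₁ : a < y₁ := ha.2.trans_le hy₁.1.1
  have hy₁0 : 0 < y₁ := ha.1.trans hay₁
  -- The window reaches a little beyond the crossing, where ω is still positive. So T is an interior
  -- time, as the transversality argument at T requires.
  obtain ⟨b, hb, hbω⟩ : ∃ b ∈ Ioo a y₁, ∀ y ∈ Ioo b z, 0 < ω y := by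
    have h3 : ∀ᶠ y in 𝓝 y₁, 0 < ω y := by
      refine (H.solves y₁ ⟨hay₁, hy₁z⟩).2.continuousAt.eventually (lt_mem_nhds ?_)
      rw [show ω y₁ = omegaF γ from hy₁.2]
      exact hF0
    obtain ⟨l, u, hlu, h4⟩ := mem_nhds_iff_exists_Ioo_subset.1 h3
    refine ⟨max l ((a + y₁) / 2), ⟨?_, max_lt hlu.1 (by linarith)⟩, fun y hy => ?_⟩
    · exact lt_of_lt_of_le (by linarith) (le_max_right _ _)
    · by_cases hyy : y ≤ y₁
      · exact h4 ⟨(le_max_left _ _).trans_lt hy.1, hyy.trans_lt hlu.2⟩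
      · exact hF0.trans (hgt y ⟨not_le.1 hyy, hy.2⟩)
  have hb0 : 0 < b := ha.1.trans hb.1
  have hexp : ∀ t ∈ Ioo (Real.log (b / z)) 0, z * Real.exp t ∈ Ioo b z := by
    intro t ht
    constructor
    · have := (Real.log_lt_iff_lt_exp (by positivity)).1 ht.1
      rwa [div_lt_iff₀ hz, mul_comm] at this
    · have := Real.exp_lt_one_iff.2 ht.2
      nlinarith
  refine ⟨Real.log (b / z), Real.log (y₁ / z), lphState γ z ρ ω,
    H.isTraj h1 h2 hz hn hωz hb0 hb.1.le (hb.2.trans hy₁z) hbω, ?_, ?_, ?_, ?_, ?_⟩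
  · exact Real.log_lt_log (by positivity) (div_lt_div_of_pos_right hb.2 hz)
  · exact Real.log_neg (by positivity) ((div_lt_one hz).2 hy₁z)
  · simp only [lphState]
    rw [Real.exp_log (by positivity), mul_div_cancel₀ _ hz.ne', show ω y₁ = omegaF γ from hy₁.2,
      omegaF, inv_div]
  · intro t ht
    simp only [lphState]
    exact inv_pos.2 (hbω _ (hexp t ht))
  · intro t ht
    simp only [lphState]
    have h3 : z * Real.exp t ∈ Ioo y₁ z := by
      constructor
      · have := (Real.log_lt_iff_lt_exp (by positivity)).1 ht.1
        rwa [div_lt_iff₀ hz, mul_comm] at this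
      · have := Real.exp_lt_one_iff.2 ht.2
        nlinarith
    have h4 := hgt _ h3
    rw [inv_lt_comm₀ (hF0.trans h4) (by positivity), inv_div]
    exact h4

end Crossing

/-! ### Deviations from the far-field solution, and simplicity of the crossings. -/

section Deviation

variable {γ n τ : ℝ} {X : ℝ → ℝ × ℝ × ℝ}

lemma IsTraj.hasDerivAt_components (h : IsTraj γ n τ X) {t : ℝ} (ht : t ∈ Ioo τ 0) :
    HasDerivAt (fun t => (X t).1) (field γ (X t)).1 t ∧
    HasDerivAt (fun t => (X t).2.1) (field γ (X t)).2.1 t ∧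
    HasDerivAt (fun t => (X t).2.2) (field γ (X t)).2.2 t := by
  have h2 := hasFDerivAt_snd.comp_hasDerivAt t (h.solves t ht)
  have e1 : HasDerivAt (fun t => (X t).1) _ t :=
    hasFDerivAt_fst.comp_hasDerivAt t (h.solves t ht)
  have e2 : HasDerivAt (fun t => (X t).2.1) _ t := hasFDerivAt_fst.comp_hasDerivAt t h2
  have e3 : HasDerivAt (fun t => (X t).2.2) _ t := hasFDerivAt_snd.comp_hasDerivAt t h2
  exact ⟨e1, e2, e3⟩

lemma IsTraj.tendsto_fst (h : IsTraj γ n τ X) :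
    Tendsto (fun t => (X t).1) (𝓝[<] 0) (𝓝 n) := by
  obtain ⟨C, hC⟩ := h.germ
  rw [tendsto_iff_dist_tendsto_zero]
  have h3 : Tendsto (fun t : ℝ => C * |t|) (𝓝[<] 0) (𝓝 0) := by
    have : Tendsto (fun t : ℝ => C * |t|) (𝓝 0) (𝓝 (C * |0|)) := by
      apply Continuous.tendsto
      fun_prop
    simp only [abs_zero, mul_zero] at this
    exact this.mono_left nhdsWithin_le_nhds
  exact squeeze_zero' (Eventually.of_forall fun _ => dist_nonneg) (hC.mono fun t ht => ht.1) h3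

lemma IsTraj.fst_ne_of_forall {v t : ℝ} (h : IsTraj γ n τ X) (ht : t ∈ Ioo τ 0)
    (hv : ∀ s ∈ Ioo t 0, (X s).1 = v) : n = v := by
  refine tendsto_nhds_unique h.tendsto_fst (Tendsto.congr' ?_ tendsto_const_nhds)
  filter_upwards [Ioo_mem_nhdsLT ht.2] with s hs using (hv s hs).symm

/-- The relative deviation of `1 / ω` from its far-field value. -/
def devN (γ : ℝ) (x : ℝ × ℝ × ℝ) : ℝ := (2 - γ) * x.1 - 1

/-- The squared Mach number. -/
def mach (x : ℝ × ℝ × ℝ) : ℝ := (1 + x.2.2)⁻¹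

/-- The relative deviation of the product of density variable and squared Mach number from its
far-field value. -/
def devD (γ : ℝ) (x : ℝ × ℝ × ℝ) : ℝ := (2 - γ) / 2 * (x.2.1 * mach x) - 1

/-- The deviation of the logarithmic density slope from its far-field value. -/
def devP (γ : ℝ) (x : ℝ × ℝ × ℝ) : ℝ :=
  (-2 * devD γ x + mach x * (γ - 1) * (3 * devN γ x + devN γ x ^ 2)) / ((2 - γ) * (1 - mach x))

/-- Once the far-field slope is removed, what remains has no constant term in the two deviations.
This makes the system for them homogeneous. -/
lemma slope_eq_devP (h2 : γ < 4 / 3) {x : ℝ × ℝ × ℝ} (hx : x ∈ subsonicRegion) :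
    slope γ x = -(2 / (2 - γ)) + devP γ x := by
  have hx : 0 < x.2.2 := hx
  have hk : 2 - γ ≠ 0 := by linarith
  have h3 : 1 - mach x = x.2.2 / (1 + x.2.2) := by
    rw [mach]
    field_simp
    ring
  rw [devP, h3, slope, energy, devD, devN, mach]
  field_simp
  ring

lemma IsTraj.hasDerivAt_devN (h2 : γ < 4 / 3) (h : IsTraj γ n τ X) {t : ℝ} (ht : t ∈ Ioo τ 0) :
    HasDerivAt (fun t => devN γ (X t)) ((1 + devN γ (X t)) *
      (-((4 - 3 * γ) / (2 - γ) * devN γ (X t)) + devP γ (X t))) t := by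
  have hk : 2 - γ ≠ 0 := by linarith
  refine (((h.hasDerivAt_components ht).1.const_mul (2 - γ)).sub_const 1).congr_deriv ?_
  simp only [field]
  rw [slope_eq_devP h2 (h.subsonic t ht)]
  generalize devP γ (X t) = π
  rw [devN]
  field_simp
  ring

lemma IsTraj.hasDerivAt_mach (h2 : γ < 4 / 3) (h : IsTraj γ n τ X) {t : ℝ} (ht : t ∈ Ioo τ 0) :
    HasDerivAt (fun t => mach (X t)) (mach (X t) *
      (2 / (2 - γ) + 2 * ((4 - 3 * γ) / (2 - γ)) * devN γ (X t) - (γ + 1) * devP γ (X t))) t := by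
  have hk : 2 - γ ≠ 0 := by linarith
  have hV : 0 < (X t).2.2 := h.subsonic t ht
  refine (((h.hasDerivAt_components ht).2.2.const_add 1).inv (by positivity)).congr_deriv ?_
  simp only [field]
  rw [slope_eq_devP h2 (h.subsonic t ht)]
  generalize devP γ (X t) = π
  rw [devN, mach]
  field_simp
  ring

lemma IsTraj.hasDerivAt_devD (h2 : γ < 4 / 3) (h : IsTraj γ n τ X) {t : ℝ} (ht : t ∈ Ioo τ 0) :
    HasDerivAt (fun t => devD γ (X t)) ((1 + devD γ (X t)) *
      ((4 - 3 * γ) / (2 - γ) * devN γ (X t) - (γ - 1) * devP γ (X t))) t := by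
  have hk : 2 - γ ≠ 0 := by linarith
  refine ((((h.hasDerivAt_components ht).2.1.mul (h.hasDerivAt_mach h2 ht)).const_mul
    ((2 - γ) / 2)).sub_const 1).congr_deriv ?_
  simp only [field]
  rw [slope_eq_devP h2 (h.subsonic t ht)]
  generalize devP γ (X t) = π
  rw [devN, devD]
  generalize mach (X t) = m
  field_simp
  ring

lemma mach_mem_Ioo {x : ℝ × ℝ × ℝ} (hx : x ∈ subsonicRegion) : mach x ∈ Ioo 0 1 := by
  have hx : 0 < x.2.2 := hx
  exact ⟨by rw [mach]; positivity, inv_lt_one_of_one_lt₀ (by linarith)⟩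

/-- A trajectory does not meet the far-field solution unless it emanates from the same sonic
point. -/
lemma IsTraj.dev_ne_zero (h2 : γ < 4 / 3) (h : IsTraj γ n τ X) (hn : n ≠ 1 / (2 - γ)) {t : ℝ}
    (ht : t ∈ Ioo τ 0) (hX : devN γ (X t) = 0) : devD γ (X t) ≠ 0 := by
  intro hY
  have hk : 2 - γ ≠ 0 := by linarith
  refine hn (h.fst_ne_of_forall ht fun s hs => ?_)
  have hsub : ∀ x ∈ Icc t s, x ∈ Ioo τ 0 := fun x hx => ⟨ht.1.trans_le hx.1, hx.2.trans_lt hs.2⟩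
  have hN : ContinuousOn (fun x => devN γ (X x)) (Icc t s) := fun x hx =>
    (h.hasDerivAt_devN h2 (hsub x hx)).continuousAt.continuousWithinAt
  have hD : ContinuousOn (fun x => devD γ (X x)) (Icc t s) := fun x hx =>
    (h.hasDerivAt_devD h2 (hsub x hx)).continuousAt.continuousWithinAt
  have hM : ContinuousOn (fun x => mach (X x)) (Icc t s) := fun x hx =>
    (h.hasDerivAt_mach h2 (hsub x hx)).continuousAt.continuousWithinAt
  have hden : ∀ x ∈ Icc t s, (2 - γ) * (1 - mach (X x)) ≠ 0 := fun x hx =>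
    mul_ne_zero hk (by linarith [(mach_mem_Ioo (h.subsonic x (hsub x hx))).2])
  -- `devP` is a combination of `devN` and `devD` whose coefficients are continuous along the
  -- trajectory as long as the Mach number is below 1. So the deviations solve a homogeneous linear
  -- system and, once both zero, stay zero up to the sonic point.
  have hA : ContinuousOn (fun x => mach (X x) * (γ - 1) * (3 + devN γ (X x)) /
      ((2 - γ) * (1 - mach (X x)))) (Icc t s) := ContinuousOn.div (by fun_prop) (by fun_prop) hden
  have hB : ContinuousOn (fun x => -2 / ((2 - γ) * (1 - mach (X x)))) (Icc t s) :=
    ContinuousOn.div (by fun_prop) (by fun_prop) hden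
  have key := eq_zero_of_linear_system (φ := fun x => devN γ (X x)) (ψ := fun x => devD γ (X x))
    (a := fun x => (1 + devN γ (X x)) * (-((4 - 3 * γ) / (2 - γ)) +
      mach (X x) * (γ - 1) * (3 + devN γ (X x)) / ((2 - γ) * (1 - mach (X x)))))
    (b := fun x => (1 + devN γ (X x)) * (-2 / ((2 - γ) * (1 - mach (X x)))))
    (c := fun x => (1 + devD γ (X x)) * ((4 - 3 * γ) / (2 - γ) - (γ - 1) *
      (mach (X x) * (γ - 1) * (3 + devN γ (X x)) / ((2 - γ) * (1 - mach (X x))))))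
    (e := fun x => (1 + devD γ (X x)) * (-((γ - 1) * (-2 / ((2 - γ) * (1 - mach (X x)))))))
    hs.1.le
    (fun x hx => (h.hasDerivAt_devN h2 (hsub x hx)).congr_deriv (by simp only [devP]; ring))
    (fun x hx => (h.hasDerivAt_devD h2 (hsub x hx)).congr_deriv (by simp only [devP]; ring))
    (by fun_prop) (by fun_prop) (by fun_prop) (by fun_prop) hX hY
  have := key.1
  simp only [devN] at this
  rw [eq_div_iff hk]
  linarith

/-- The zeros of the deviation from the far-field velocity are simple. -/
lemma IsTraj.field_ne_zero_of_farField (h2 : γ < 4 / 3) (h : IsTraj γ n τ X)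
    (hn : n ≠ 1 / (2 - γ)) {t : ℝ} (ht : t ∈ Ioo τ 0) (hX : (X t).1 = 1 / (2 - γ)) :
    (field γ (X t)).1 ≠ 0 := by
  intro h0
  have hk : 2 - γ ≠ 0 := by linarith
  have hN : devN γ (X t) = 0 := by
    rw [devN, hX]
    field_simp
    ring
  have hm := mach_mem_Ioo (h.subsonic t ht)
  have hm' : 1 - mach (X t) ≠ 0 := by linarith [hm.2]
  -- Where N = n_f, the condition N' = 0 says `devP` = 0, which with `devN` = 0 forces `devD` = 0.
  refine h.dev_ne_zero h2 hn ht hN ?_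
  simp only [field] at h0
  rw [slope_eq_devP h2 (h.subsonic t ht), hX, devP, hN] at h0
  have h1 := (mul_eq_zero.1 h0).resolve_left (by positivity)
  field_simp at h1
  linarith

/-- A trajectory meets the Friedman velocity transversally, unless it emanates from the Friedman
sonic point. -/
lemma IsTraj.field_ne_zero_of_friedman (h2 : γ < 4 / 3) (h : IsTraj γ n τ X)
    (hn : n ≠ 3 / (4 - 3 * γ)) {t : ℝ} (ht : t ∈ Ioo τ 0) (hX : (X t).1 = 3 / (4 - 3 * γ)) :
    (field γ (X t)).1 ≠ 0 := by
  intro h0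
  have hd : 0 < 4 - 3 * γ := by linarith
  set nF := 3 / (4 - 3 * γ) with hnF
  have hdn : (4 - 3 * γ) * nF = 3 := by rw [hnF]; field_simp
  have hnF0 : 0 < nF := by positivity
  have hV : ∀ x ∈ Ioo τ 0, 0 < (X x).2.2 := fun x hx => h.subsonic x hx
  -- Where N = n_F, the condition N' = 0 says that the slope vanishes, so D has its Friedman value.
  -- The deviations of N and D from the Friedman values again solve a homogeneous linear system.
  have hD : (X t).2.1 - sonicD γ nF = 0 := by
    simp only [field, hX, hdn, slope, energy] at h0
    have h1 := (mul_eq_zero.1 h0).resolve_left hnF0.ne'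
    rw [sub_self, zero_add, div_eq_zero_iff] at h1
    have h3 := h1.resolve_right (hV t ht).ne'
    rw [sonicD]
    linarith
  refine hn (h.fst_ne_of_forall ht fun s hs => ?_)
  have hsub : ∀ x ∈ Icc t s, x ∈ Ioo τ 0 := fun x hx => ⟨ht.1.trans_le hx.1, hx.2.trans_lt hs.2⟩
  have c1 : ContinuousOn (fun x => (X x).1) (Icc t s) := fun x hx =>
    (h.hasDerivAt_components (hsub x hx)).1.continuousAt.continuousWithinAt
  have c2 : ContinuousOn (fun x => (X x).2.1) (Icc t s) := fun x hx =>
    (h.hasDerivAt_components (hsub x hx)).2.1.continuousAt.continuousWithinAt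
  have c3 : ContinuousOn (fun x => (X x).2.2⁻¹) (Icc t s) := fun x hx =>
    ((h.hasDerivAt_components (hsub x hx)).2.2.continuousAt.inv₀
      (hV x (hsub x hx)).ne').continuousWithinAt
  have key := eq_zero_of_linear_system (φ := fun x => (X x).1 - nF)
    (ψ := fun x => (X x).2.1 - sonicD γ nF)
    (a := fun x => (X x).1 * (-(4 - 3 * γ) +
      (γ - 1) * (1 + (2 - γ) * ((X x).1 + nF)) * (X x).2.2⁻¹))
    (b := fun x => (X x).1 * (-(X x).2.2⁻¹))
    (c := fun x => (X x).2.1 * (-(4 - 3 * γ) +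
      2 * ((γ - 1) * (1 + (2 - γ) * ((X x).1 + nF)) * (X x).2.2⁻¹)))
    (e := fun x => (X x).2.1 * (-(2 * (X x).2.2⁻¹)))
    hs.1.le
    (fun x hx => ((h.hasDerivAt_components (hsub x hx)).1.sub_const _).congr_deriv (by
      simp only [field, slope, energy, sonicD, div_eq_mul_inv]
      linear_combination -(X x).1 * hdn))
    (fun x hx => ((h.hasDerivAt_components (hsub x hx)).2.1.sub_const _).congr_deriv (by
      simp only [field, slope, energy, sonicD, div_eq_mul_inv]
      linear_combination -(X x).2.1 * hdn))
    (by fun_prop) (by fun_prop) (by fun_prop) (by fun_prop) (by simp only [hX, sub_self]) hD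
  linarith [key.1]

end Deviation

/-! ### Continuity of the crossing time and constancy of the number of far-field crossings. -/

section CrossingFamily

variable {γ : ℝ} {τ T : ℝ → ℝ} {X : ℝ → ℝ → ℝ × ℝ × ℝ}

/-- The open range of the values `1 / ω` at the sonic points strictly between the far-field and the
Friedman one. -/
def openRange (γ : ℝ) : Set ℝ := Ioo (1 / (2 - γ)) (3 / (4 - 3 * γ))

lemma openRange_subset : openRange γ ⊆ sonicRange γ := Ioo_subset_Icc_self

lemma abs_fst_sub_le_dist (x y : ℝ × ℝ × ℝ) : |x.1 - y.1| ≤ dist x y := le_max_left _ _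

/-- The base point n may be an end point of the open range; this is needed to compare with the
far-field trajectory. -/
lemma eventually_dist_lt (h1 : 1 < γ) (h2 : γ < 4 / 3)
    (hX : ∀ n ∈ openRange γ, IsFirstCrossing γ n (τ n) (T n) (X n)) {n τ₀ τ₁ : ℝ} {Y : ℝ → ℝ × ℝ × ℝ}
    (hn : n ∈ sonicRange γ) (hY : IsTraj γ n τ₀ Y) (hτ : τ₀ < τ₁) (hτ₁ : τ₁ < 0) {ε : ℝ}
    (hε : 0 < ε) :
    ∀ᶠ n' in 𝓝[openRange γ] n, n' ∈ openRange γ ∧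
      ∀ t, τ₁ < t → τ n' < t → t < 0 → dist (Y t) (X n' t) < ε := by
  obtain ⟨δ, hδ, h3⟩ := hY.dist_lt h1 h2 hn hτ hτ₁ hε
  filter_upwards [mem_nhdsWithin_of_mem_nhds (Metric.ball_mem_nhds n hδ), self_mem_nhdsWithin]
    with n' hb hn'
  have h4 := hX n' hn'
  exact ⟨hn', fun t ht ht' ht0 => h3 n' (openRange_subset hn') (by simpa [Real.dist_eq] using hb) _
    (h4.lt.trans h4.neg) _ h4.traj t ⟨max_lt ht ht', ht0⟩⟩

lemma IsTraj.continuousAt_fst {n τ t : ℝ} {X : ℝ → ℝ × ℝ × ℝ} (h : IsTraj γ n τ X)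
    (ht : t ∈ Ioo τ 0) : ContinuousAt (fun t => (X t).1) t :=
  (h.hasDerivAt_components ht).1.continuousAt

/-- Upper semicontinuity of T. On [t, 0) the reference trajectory stays below some M < n_F,
including in the limit at 0, so a nearby one cannot take the value n_F there. -/
lemma eventually_time_lt (h1 : 1 < γ) (h2 : γ < 4 / 3)
    (hX : ∀ n ∈ openRange γ, IsFirstCrossing γ n (τ n) (T n) (X n)) {n t : ℝ}
    (hn : n ∈ openRange γ) (ht : T n < t) : ∀ᶠ n' in 𝓝[openRange γ] n, T n' < t := by
  have hXn := hX n hn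
  rcases le_or_gt 0 t with ht0 | ht0
  · filter_upwards [self_mem_nhdsWithin] with n' hn' using (hX n' hn').neg.trans_le ht0
  set nF := 3 / (4 - 3 * γ) with hnF
  obtain ⟨M, hMF, hM⟩ : ∃ M < nF, ∀ s ∈ Ico t 0, (X n s).1 ≤ M := by
    have h3 : ∀ᶠ s in 𝓝[<] (0 : ℝ), (X n s).1 < (n + nF) / 2 :=
      hXn.traj.tendsto_fst.eventually (gt_mem_nhds (by linarith [hn.2]))
    obtain ⟨u, hu, h4⟩ := (mem_nhdsLT_iff_exists_Ioo_subset' ht0).1 h3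
    have h5 : ContinuousOn (fun s => (X n s).1) (Icc t (max t (u / 2))) := fun s hs =>
      (hXn.traj.continuousAt_fst ⟨hXn.lt.trans (ht.trans_le hs.1), hs.2.trans_lt
        (max_lt ht0 (by linarith [mem_Iio.1 hu]))⟩).continuousWithinAt
    obtain ⟨s₀, hs₀, hmax⟩ := isCompact_Icc.exists_isMaxOn
      (nonempty_Icc.2 (le_max_left t (u / 2))) h5
    have hs₀' : s₀ ∈ Ioo (T n) 0 := ⟨ht.trans_le hs₀.1, hs₀.2.trans_lt
        (max_lt ht0 (by linarith [mem_Iio.1 hu]))⟩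
    refine ⟨max ((n + nF) / 2) (X n s₀).1, max_lt (by linarith [hn.2]) (hXn.lt_of_lt _ hs₀'),
      fun s hs => ?_⟩
    by_cases hsu : s ≤ max t (u / 2)
    · exact (hmax ⟨hs.1, hsu⟩).trans (le_max_right _ _)
    · have : u / 2 < s := (le_max_right _ _).trans_lt (not_le.1 hsu)
      exact (h4 ⟨by linarith [mem_Iio.1 hu], hs.2⟩).le.trans (le_max_left _ _)
  filter_upwards [eventually_dist_lt h1 h2 hX (openRange_subset hn) hXn.traj hXn.lt hXn.neg
    (show 0 < nF - M by linarith)] with n' hn'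
  by_contra! hle
  have h3 := hX n' hn'.1
  have h4 := hn'.2 (T n') (ht.trans_le hle) h3.lt h3.neg
  have h5 := (abs_fst_sub_le_dist _ _).trans_lt h4
  rw [h3.eq] at h5
  have h6 := hM _ ⟨hle, h3.neg⟩
  linarith [(abs_lt.1 h5).1]

/-- Lower semicontinuity of T, which needs transversality: N exceeds n_F at some s just before T(n),
hence so does a nearby trajectory if it reaches back to s without having crossed. -/
lemma eventually_lt_time (h1 : 1 < γ) (h2 : γ < 4 / 3)
    (hX : ∀ n ∈ openRange γ, IsFirstCrossing γ n (τ n) (T n) (X n)) {n t : ℝ}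
    (hn : n ∈ openRange γ) (ht : t < T n) : ∀ᶠ n' in 𝓝[openRange γ] n, t < T n' := by
  have hXn := hX n hn
  wlog htτ : τ n < t generalizing t
  · obtain ⟨u, hu1, hu2⟩ := exists_between hXn.lt
    filter_upwards [this hu2 hu1] with n' hn'
    linarith
  set nF := 3 / (4 - 3 * γ) with hnF
  have hTmem : T n ∈ Ioo (τ n) 0 := ⟨hXn.lt, hXn.neg⟩
  have hder := (hXn.traj.hasDerivAt_components hTmem).1
  have hslope := hasDerivAt_iff_tendsto_slope.1 hder
  have hneg : (field γ (X n (T n))).1 < 0 := by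
    refine lt_of_le_of_ne ?_ (hXn.traj.field_ne_zero_of_friedman h2 hn.2.ne hTmem hXn.eq)
    refine le_of_tendsto (hslope.mono_left
      (nhdsWithin_mono (s := Ioi (T n)) _ fun s hs => ne_of_gt hs)) ?_
    filter_upwards [Ioo_mem_nhdsGT hXn.neg] with s hs
    rw [slope_def_field, hXn.eq]
    exact div_nonpos_of_nonpos_of_nonneg (by linarith [hXn.lt_of_lt s hs]) (by linarith [hs.1])
  obtain ⟨s, hs, hsF⟩ : ∃ s ∈ Ioo t (T n), nF < (X n s).1 := by
    have h4 : ∀ᶠ s in 𝓝[<] (T n), _ :=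
      (hslope.eventually (gt_mem_nhds hneg)).filter_mono (nhdsWithin_mono _ fun t ht => ne_of_lt ht)
    obtain ⟨s, h5, h6⟩ := (h4.and (Ioo_mem_nhdsLT ht)).exists
    refine ⟨s, h6, ?_⟩
    rw [slope_def_field, hXn.eq, div_neg_iff] at h5
    rcases h5 with h5 | h5
    · linarith [h5.1]
    · linarith [h5.2, h6.2]
  filter_upwards [eventually_dist_lt h1 h2 hX (openRange_subset hn) hXn.traj htτ
    (ht.trans hXn.neg) (show 0 < (X n s).1 - nF by linarith)] with n' hn'
  by_contra! hle
  have h3 := hX n' hn'.1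
  have h4 := hn'.2 s hs.1 (h3.lt.trans (hle.trans_lt hs.1)) (hs.2.trans hXn.neg)
  have h5 := (abs_fst_sub_le_dist _ _).trans_lt h4
  have h6 := h3.lt_of_lt s ⟨hle.trans_lt hs.1, hs.2.trans hXn.neg⟩
  linarith [(abs_lt.1 h5).2]

lemma tendsto_crossingFamily (h1 : 1 < γ) (h2 : γ < 4 / 3)
    (hX : ∀ n ∈ openRange γ, IsFirstCrossing γ n (τ n) (T n) (X n)) {n t : ℝ}
    (hn : n ∈ openRange γ) (ht : t ∈ Ioo (T n) 0) :
    Tendsto (fun x : ℝ × ℝ => X x.1 x.2) (𝓝[openRange γ] n ×ˢ 𝓝 t) (𝓝 (X n t)) := by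
  have hXn := hX n hn
  rw [Metric.tendsto_nhds]
  intro ε hε
  obtain ⟨u, hu1, hu2⟩ := exists_between ht.1
  have e1 := eventually_dist_lt h1 h2 hX (openRange_subset hn) hXn.traj hXn.lt hXn.neg (half_pos hε)
  have e2 := eventually_time_lt h1 h2 hX hn hu1
  have e3 : ∀ᶠ s in 𝓝 t, s ∈ Ioo u 0 := Ioo_mem_nhds hu2 ht.2
  have e4 : ∀ᶠ s in 𝓝 t, dist (X n s) (X n t) < ε / 2 :=
    (hXn.traj.solves t ⟨hXn.lt.trans ht.1, ht.2⟩).continuousAt.eventually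
      (Metric.ball_mem_nhds _ (half_pos hε))
  filter_upwards [(e1.and e2).prod_mk (e3.and e4)] with x hx
  obtain ⟨⟨⟨hx1, hx2⟩, hx3⟩, hx4, hx5⟩ := hx
  have h3 := hx2 x.2 (hu1.trans hx4.1) ((hX _ hx1).lt.trans (hx3.trans hx4.1)) hx4.2
  rw [dist_comm] at h3
  linarith [dist_triangle (X x.1 x.2) (X n x.2) (X n t)]

/-- Near T(n) the function N lies above the midpoint of n_f and n_F, and near 0 above that of n_f
and n. Closeness of trajectories therefore excludes zeros near both ends. -/
lemma exists_zeros_subset (h1 : 1 < γ) (h2 : γ < 4 / 3)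
    (hX : ∀ n ∈ openRange γ, IsFirstCrossing γ n (τ n) (T n) (X n)) {n : ℝ}
    (hn : n ∈ openRange γ) :
    ∃ α β, T n < α ∧ β < 0 ∧ ∀ᶠ n' in 𝓝[openRange γ] n,
      ∀ t ∈ Ioo (T n') 0, (X n' t).1 - 1 / (2 - γ) = 0 → t ∈ Icc α β := by
  have hXn := hX n hn
  have hlt := farField_lt_friedman h1 h2
  set nF := 3 / (4 - 3 * γ) with hnF
  set nf := 1 / (2 - γ) with hnf
  have hTmem : T n ∈ Ioo (τ n) 0 := ⟨hXn.lt, hXn.neg⟩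
  have e1 : ∀ᶠ s in 𝓝 (T n), (nf + nF) / 2 < (X n s).1 :=
    (hXn.traj.continuousAt_fst hTmem).eventually (lt_mem_nhds (by simp only [hXn.eq]; linarith))
  obtain ⟨l, hl, h3⟩ := (mem_nhdsLE_iff_exists_Ioc_subset' hXn.lt).1
    (e1.filter_mono (nhdsWithin_le_nhds (s := Iic (T n))))
  obtain ⟨α, hα, h4⟩ := (mem_nhdsGE_iff_exists_Ico_subset' hXn.neg).1
    (e1.filter_mono (nhdsWithin_le_nhds (s := Ici (T n))))
  have e2 : ∀ᶠ s in 𝓝[<] (0 : ℝ), (nf + n) / 2 < (X n s).1 :=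
    hXn.traj.tendsto_fst.eventually (lt_mem_nhds (by linarith [hn.1]))
  obtain ⟨β, hβ, h5⟩ := (mem_nhdsLT_iff_exists_Ioo_subset' hXn.neg).1 e2
  refine ⟨α, β, hα, hβ, ?_⟩
  obtain ⟨l', hl'⟩ := exists_between (max_lt hl hXn.lt)
  have hlτ : τ n < l' := (le_max_right _ _).trans_lt hl'.1
  filter_upwards [eventually_dist_lt h1 h2 hX (openRange_subset hn) hXn.traj hlτ
    (hl'.2.trans hXn.neg) (show 0 < min ((nF - nf) / 2) ((n - nf) / 2) from
      lt_min (by linarith) (by linarith [hn.1])), eventually_lt_time h1 h2 hX hn hl'.2]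
    with n' hn' hTn t ht ht0
  have h6 := hn'.2 t (hTn.trans ht.1) ((hX n' hn'.1).lt.trans ht.1) ht.2
  have h7 := (abs_fst_sub_le_dist _ _).trans_lt h6
  have h8 := (abs_lt.1 h7).2
  have h9 := h8.trans_le (min_le_left _ _)
  have h10 := h8.trans_le (min_le_right _ _)
  constructor
  · by_contra! hlt
    have : (nf + nF) / 2 < (X n t).1 := by
      by_cases hle : t ≤ T n
      · exact h3 ⟨(le_max_left _ _).trans_lt (hl'.1.trans (hTn.trans ht.1)), hle⟩
      · exact h4 ⟨(not_le.1 hle).le, hlt⟩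
    linarith
  · by_contra! hlt
    have : (nf + n) / 2 < (X n t).1 := h5 ⟨hlt, ht.2⟩
    linarith

/-- If all solutions strictly between the far-field and the Friedman one reach the Friedman
velocity, then before that they take the far-field velocity the same finite number of times. -/
theorem finite_crossings_and_ncard_eq (h1 : 1 < γ) (h2 : γ < 4 / 3)
    (hX : ∀ n ∈ openRange γ, IsFirstCrossing γ n (τ n) (T n) (X n)) :
    (∀ n ∈ openRange γ, {t | t ∈ Ioo (T n) 0 ∧ (X n t).1 - 1 / (2 - γ) = 0}.Finite) ∧
    ∀ n ∈ openRange γ, ∀ n' ∈ openRange γ,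
      {t | t ∈ Ioo (T n) 0 ∧ (X n t).1 - 1 / (2 - γ) = 0}.ncard =
      {t | t ∈ Ioo (T n') 0 ∧ (X n' t).1 - 1 / (2 - γ) = 0}.ncard := by
  have hmem : ∀ n ∈ openRange γ, ∀ t ∈ Ioo (T n) 0, t ∈ Ioo (τ n) 0 := fun n hn t ht =>
    ⟨(hX n hn).lt.trans ht.1, ht.2⟩
  refine finite_zeros_and_ncard_eq (I := openRange γ) (g := fun n t => (X n t).1 - 1 / (2 - γ))
    (g' := fun n t => (field γ (X n t)).1) (T := T) isPreconnected_Ioo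
    (fun n hn t ht => eventually_time_lt h1 h2 hX hn ht)
    (fun n hn => exists_zeros_subset h1 h2 hX hn)
    (fun n hn t ht => ((hX n hn).traj.hasDerivAt_components (hmem n hn t ht)).1.sub_const _)
    (fun n hn t ht => ?_) (fun n hn t ht => ?_) (fun n hn t ht h0 => ?_)
  · exact ((continuous_fst.tendsto _).comp (tendsto_crossingFamily h1 h2 hX hn ht)).sub_const _
  · have hc : ContinuousAt (field γ) (X n t) :=
      (contDiffOn_field γ).continuousOn.continuousAt
        (isOpen_subsonicRegion.mem_nhds ((hX n hn).traj.subsonic t (hmem n hn t ht)))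
    exact (continuous_fst.tendsto _).comp (hc.tendsto.comp (tendsto_crossingFamily h1 h2 hX hn ht))
  · exact (hX n hn).traj.field_ne_zero_of_farField h2 hn.1.ne' (hmem n hn t ht) (by linarith)

end CrossingFamily

/-! ### The far-field trajectory and trajectories that follow it. -/

section FarField

variable {γ : ℝ}

/-- The far-field trajectory. -/
def farTraj (γ t : ℝ) : ℝ × ℝ × ℝ :=
  (1 / (2 - γ), 2 / (2 - γ) * Real.exp (-(2 / (2 - γ)) * t), Real.exp (-(2 / (2 - γ)) * t) - 1)

lemma sonicD_farField (h2 : γ < 4 / 3) : sonicD γ (1 / (2 - γ)) = 2 / (2 - γ) := by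
  have hk : 2 - γ ≠ 0 := by linarith
  rw [sonicD]
  field_simp
  ring

lemma sonicL_farField (h1 : 1 < γ) (h2 : γ < 4 / 3) : sonicL γ (1 / (2 - γ)) = 2 / (2 - γ) := by
  have hk : 2 - γ ≠ 0 := by linarith
  rw [sonicL, sonicP_farField h1 h2]
  field_simp
  ring

lemma farTraj_mem (h2 : γ < 4 / 3) {t : ℝ} (ht : t < 0) : farTraj γ t ∈ subsonicRegion := by
  have hk : 0 < 2 - γ := by linarith
  have : 0 < -(2 / (2 - γ)) * t := mul_pos_of_neg_of_neg (by rw [neg_lt_zero]; positivity) ht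
  have h3 := Real.one_lt_exp_iff.2 this
  exact sub_pos.2 h3

lemma slope_farTraj (h2 : γ < 4 / 3) {t : ℝ} (ht : t < 0) :
    slope γ (farTraj γ t) = -(2 / (2 - γ)) := by
  have hk : 2 - γ ≠ 0 := by linarith
  have hV : 0 < Real.exp (-(2 / (2 - γ)) * t) - 1 := farTraj_mem h2 ht
  simp only [slope, energy, farTraj]
  rw [div_eq_iff hV.ne']
  generalize Real.exp _ = e
  field_simp
  ring

lemma isTraj_farTraj (h1 : 1 < γ) (h2 : γ < 4 / 3) (τ : ℝ) :
    IsTraj γ (1 / (2 - γ)) τ (farTraj γ) := by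
  have hk : 0 < 2 - γ := by linarith
  have hexp : ∀ t, HasDerivAt (fun t => Real.exp (-(2 / (2 - γ)) * t))
      (-(2 / (2 - γ)) * Real.exp (-(2 / (2 - γ)) * t)) t := fun t =>
    ((hasDerivAt_id t).const_mul (-(2 / (2 - γ)))).exp.congr_deriv (by simp only [id]; ring)
  refine ⟨fun t ht => farTraj_mem h2 ht.2, fun t ht => ?_, ?_⟩
  · have h3 : HasDerivAt (farTraj γ) _ t := (hasDerivAt_const t (1 / (2 - γ))).prodMk
      (((hexp t).const_mul (2 / (2 - γ))).prodMk ((hexp t).sub_const 1))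
    refine h3.congr_deriv ?_
    rw [field, slope_farTraj h2 ht.2]
    simp only [farTraj]
    generalize Real.exp _ = e
    refine Prod.ext ?_ (Prod.ext ?_ ?_)
    · simp only []
      field_simp
      ring
    · simp only []
      field_simp
      ring
    · simp only []
      field_simp
      ring
  · obtain ⟨C₁, hC₁, b₁⟩ := exists_bound_of_hasDerivAt ((hexp 0).const_mul (2 / (2 - γ)))
    have hV : ContDiffAt ℝ 2 (fun t => Real.exp (-(2 / (2 - γ)) * t) - 1) 0 := by fun_prop
    obtain ⟨C₂, hC₂, b₂⟩ := exists_second_order_bound hV ((hexp 0).sub_const 1)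
    have b₂' : ∀ᶠ t in 𝓝[<] (0 : ℝ), |(farTraj γ t).2.2 + 2 / (2 - γ) * t| ≤ C₂ * t ^ 2 :=
      (b₂.filter_mono nhdsWithin_le_nhds).mono fun t ht => by
        refine le_of_eq_of_le (congrArg _ ?_) ht
        simp only [farTraj, mul_zero, Real.exp_zero]
        ring
    obtain ⟨C₃, hC₃, b₃⟩ := exists_bound_div_add_inv (by positivity) hC₂ b₂'
    refine ⟨C₁ + C₃, ?_⟩
    filter_upwards [b₁, b₃, self_mem_nhdsWithin] with t b₁ b₃ ht
    have ht0 := abs_nonneg t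
    have e1 : 0 ≤ (C₁ + C₃) * |t| := by positivity
    rw [slope_farTraj h2 ht, sonicP_farField h1 h2, sonicD_farField h2, sonicL_farField h1 h2]
    refine ⟨by simpa [farTraj] using e1, ?_, by simpa using e1, ?_⟩
    · simp only [mul_zero, Real.exp_zero, mul_one] at b₁
      simp only [farTraj]
      nlinarith
    · nlinarith

lemma mach_farTraj (γ t : ℝ) : mach (farTraj γ t) = Real.exp (2 / (2 - γ) * t) := by
  rw [mach, farTraj, add_sub_cancel, ← Real.exp_neg]
  ring_nf

/-- The deviations from the far-field solution are controlled by the distance to it. -/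
lemma dev_le_of_dist_lt (h1 : 1 < γ) (h2 : γ < 4 / 3) {x : ℝ × ℝ × ℝ} {t ε : ℝ}
    (hx : x ∈ subsonicRegion) (ht : t < 0) (h : dist (farTraj γ t) x < ε) :
    |devN γ x| ≤ ε ∧ |devD γ x| ≤ 2 * ε ∧ |mach x - Real.exp (2 / (2 - γ) * t)| ≤ ε := by
  have hk : 0 < 2 - γ := by linarith
  have hm := mach_mem_Ioo hx
  have hm0 := mach_mem_Ioo (farTraj_mem h2 ht)
  rw [dist_comm] at h
  have hN : |x.1 - 1 / (2 - γ)| < ε := (le_max_left _ _).trans_lt h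
  have h' : dist x.2 (farTraj γ t).2 < ε := (le_max_right _ _).trans_lt h
  have hD : |x.2.1 - (farTraj γ t).2.1| < ε := (le_max_left _ _).trans_lt h'
  have hV : |x.2.2 - (farTraj γ t).2.2| < ε := (le_max_right _ _).trans_lt h'
  have hVp : 0 < x.2.2 := hx
  have hVp0 : 0 < (farTraj γ t).2.2 := farTraj_mem h2 ht
  have hε : 0 < ε := (abs_nonneg _).trans_lt hN
  have hdm : mach x - mach (farTraj γ t) =
      -((x.2.2 - (farTraj γ t).2.2) * (mach x * mach (farTraj γ t))) := by
    rw [mach, mach]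
    field_simp
    ring
  have hDm : (farTraj γ t).2.1 * mach (farTraj γ t) = 2 / (2 - γ) := by
    rw [mach]
    simp only [farTraj, add_sub_cancel]
    field_simp
  refine ⟨?_, ?_, ?_⟩
  · have : devN γ x = (2 - γ) * (x.1 - 1 / (2 - γ)) := by
      rw [devN]
      field_simp
    rw [this, abs_mul, abs_of_pos hk]
    nlinarith [abs_nonneg (x.1 - 1 / (2 - γ))]
  · have : devD γ x = (2 - γ) / 2 * ((x.2.1 - (farTraj γ t).2.1) * mach x) -
        (x.2.2 - (farTraj γ t).2.2) * mach x := by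
      have h3 : (2 - γ) / 2 * ((farTraj γ t).2.1 * mach x) =
          1 - (x.2.2 - (farTraj γ t).2.2) * mach x := by
        have h4 : mach x = mach (farTraj γ t) + (mach x - mach (farTraj γ t)) := by ring
        calc (2 - γ) / 2 * ((farTraj γ t).2.1 * mach x)
            = (2 - γ) / 2 * ((farTraj γ t).2.1 * (mach (farTraj γ t) +
              -((x.2.2 - (farTraj γ t).2.2) * (mach x * mach (farTraj γ t))))) := by
                rw [← hdm, ← h4]
          _ = (2 - γ) / 2 * ((farTraj γ t).2.1 * mach (farTraj γ t)) *
              (1 - (x.2.2 - (farTraj γ t).2.2) * mach x) := by ring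
          _ = _ := by rw [hDm]; field_simp
      rw [devD]
      linear_combination h3
    rw [this]
    have e1 : |(x.2.1 - (farTraj γ t).2.1) * mach x| ≤ ε := by
      rw [abs_mul, abs_of_pos hm.1]
      nlinarith [hm.1, hm.2, abs_nonneg (x.2.1 - (farTraj γ t).2.1)]
    have e2 : |(x.2.2 - (farTraj γ t).2.2) * mach x| ≤ ε := by
      rw [abs_mul, abs_of_pos hm.1]
      nlinarith [hm.1, hm.2, abs_nonneg (x.2.2 - (farTraj γ t).2.2)]
    refine (abs_sub _ _).trans ?_
    rw [abs_mul, abs_of_pos (show 0 < (2 - γ) / 2 by linarith)]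
    nlinarith [abs_nonneg ((x.2.1 - (farTraj γ t).2.1) * mach x)]
  · rw [← mach_farTraj, hdm, abs_neg, abs_mul, abs_of_pos (mul_pos hm.1 hm0.1)]
    have : mach x * mach (farTraj γ t) ≤ 1 := by nlinarith [hm.1, hm.2, hm0.1, hm0.2]
    nlinarith [abs_nonneg (x.2.2 - (farTraj γ t).2.2)]

/-- Solutions emanating from sonic points near the far-field one follow the far-field solution for
an arbitrarily long time. -/
theorem exists_near_farField (h1 : 1 < γ) (h2 : γ < 4 / 3) {τ T : ℝ → ℝ} {X : ℝ → ℝ → ℝ × ℝ × ℝ}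
    (hX : ∀ n ∈ openRange γ, IsFirstCrossing γ n (τ n) (T n) (X n)) {ε τ₁ : ℝ} (hε : 0 < ε)
    (hτ₁ : τ₁ < 0) :
    ∃ n ∈ openRange γ, T n ≤ τ₁ ∧ ∀ t ∈ Ioo τ₁ 0, |devN γ (X n t)| ≤ ε ∧ |devD γ (X n t)| ≤ ε ∧
      |mach (X n t) - Real.exp (2 / (2 - γ) * t)| ≤ ε := by
  have hlt := farField_lt_friedman h1 h2
  have hne : (𝓝[openRange γ] (1 / (2 - γ))).NeBot := left_nhdsWithin_Ioo_neBot hlt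
  obtain ⟨n, hn, h3⟩ := (eventually_dist_lt h1 h2 hX (farField_mem_sonicRange h1 h2)
    (isTraj_farTraj h1 h2 (τ₁ - 1)) (sub_one_lt τ₁) hτ₁
    (show 0 < min (ε / 2) (3 / (4 - 3 * γ) - 1 / (2 - γ)) from
      lt_min (by linarith) (by linarith))).exists
  have hXn := hX n hn
  -- The tolerance is at most n_F - n_f, so N cannot reach n_F while the trajectory follows the
  -- far-field one.
  have hT : T n ≤ τ₁ := by
    by_contra! hlt'
    have h4 := (abs_fst_sub_le_dist _ _).trans_lt (h3 (T n) hlt' hXn.lt hXn.neg)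
    rw [hXn.eq] at h4
    have h5 := (abs_lt.1 (h4.trans_le (min_le_right _ _))).1
    simp only [farTraj] at h5
    linarith
  refine ⟨n, hn, hT, fun t ht => ?_⟩
  have hτt : τ n < t := hXn.lt.trans (hT.trans_lt ht.1)
  obtain ⟨e1, e2, e3⟩ := dev_le_of_dist_lt h1 h2 (hXn.traj.subsonic t ⟨hτt, ht.2⟩) ht.2
    ((h3 t ht.1 hτt ht.2).trans_le (min_le_left _ _))
  exact ⟨e1.trans (by linarith), e2.trans (by linarith), e3.trans (by linarith)⟩

end FarField

/-! ### Linearization at small Mach number and the stable case γ > 6/5. -/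

section NearFarField

variable {γ : ℝ}

/-- Near the far-field solution and at small Mach numbers, the deviations solve a linear system with
constant coefficients up to small relative errors, and the Mach number increases. -/
lemma near_farField_estimates (h1 : 1 < γ) (h2 : γ < 4 / 3) {x : ℝ × ℝ × ℝ} {ε : ℝ}
    (hx : x ∈ subsonicRegion) (hε : ε ≤ 1 / 16) (hX : |devN γ x| ≤ ε) (hY : |devD γ x| ≤ ε)
    (hm : mach x ≤ ε) :
    (∃ e₁ e₂, (1 + devN γ x) * (-((4 - 3 * γ) / (2 - γ) * devN γ x) + devP γ x) =
        (-(4 - 3 * γ) * devN γ x - 2 * devD γ x + e₁) / (2 - γ) ∧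
      (1 + devD γ x) * ((4 - 3 * γ) / (2 - γ) * devN γ x - (γ - 1) * devP γ x) =
        ((4 - 3 * γ) * devN γ x + 2 * (γ - 1) * devD γ x + e₂) / (2 - γ) ∧
      |e₁| ≤ 7 * ε * (|devN γ x| + |devD γ x|) ∧ |e₂| ≤ 7 * ε * (|devN γ x| + |devD γ x|)) ∧
    0 ≤ 2 / (2 - γ) + 2 * ((4 - 3 * γ) / (2 - γ)) * devN γ x - (γ + 1) * devP γ x := by
  have hm0 := mach_mem_Ioo hx
  have hπ : devP γ x = (-2 * devD γ x + mach x * (γ - 1) * (3 * devN γ x + devN γ x ^ 2)) /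
    ((2 - γ) * (1 - mach x)) := rfl
  generalize devP γ x = π at *
  generalize devN γ x = X at *
  generalize devD γ x = Y at *
  generalize mach x = m at *
  have hk : 0 < 2 - γ := by linarith
  have hk1 : 2 - γ < 1 := by linarith
  have hd : 0 < 4 - 3 * γ := by linarith
  have hd1 : 4 - 3 * γ < 1 := by linarith
  have hg : 0 < γ - 1 := by linarith
  have hg1 : γ - 1 < 1 / 3 := by linarith
  have hε0 : 0 < ε := hm0.1.trans_le hm
  set s := |X| + |Y| with hs
  have hs0 : 0 ≤ s := by positivity
  have hs2 : s ≤ 2 * ε := by linarith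
  have aX := abs_nonneg X
  have aY := abs_nonneg Y
  -- R is the error of replacing (2-γ)π by its value -2Y at Mach number zero. It carries a factor m,
  -- hence is of size ε(|X| + |Y|).
  obtain ⟨R, hR⟩ : ∃ R, R = (2 - γ) * π + 2 * Y := ⟨_, rfl⟩
  have hRm : (1 - m) * R = m * ((γ - 1) * (3 * X + X ^ 2) - 2 * Y) := by
    have h1m : 1 - m ≠ 0 := by linarith [hm0.2]
    rw [hR, hπ]
    field_simp
    ring
  have hRb : |R| ≤ 4 * ε * s := by
    have e1 : |(γ - 1) * (3 * X + X ^ 2) - 2 * Y| ≤ 2 * s := by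
      refine (abs_sub _ _).trans ?_
      have e3 : |3 * X + X ^ 2| ≤ 4 * |X| := by
        refine (abs_add_le _ _).trans ?_
        rw [abs_mul, abs_pow, abs_of_pos (show (0 : ℝ) < 3 by norm_num)]
        nlinarith
      rw [abs_mul, abs_mul, abs_of_pos hg, abs_of_pos (show (0 : ℝ) < 2 by norm_num), hs]
      nlinarith [abs_nonneg (3 * X + X ^ 2)]
    have e2 : (1 - m) * |R| ≤ ε * (2 * s) := by
      have : (1 - m) * |R| = |(1 - m) * R| := by
        rw [abs_mul, abs_of_pos (show 0 < 1 - m by linarith [hm0.2])]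
      rw [this, hRm, abs_mul, abs_of_pos hm0.1]
      exact mul_le_mul hm e1 (abs_nonneg _) hε0.le
    nlinarith [abs_nonneg R]
  have hπR : π = (R - 2 * Y) / (2 - γ) := by
    rw [hR]
    field_simp
    ring
  refine ⟨⟨R + X * (-(4 - 3 * γ) * X - 2 * Y + R),
    -((γ - 1) * R) + Y * ((4 - 3 * γ) * X + 2 * (γ - 1) * Y - (γ - 1) * R), ?_, ?_, ?_, ?_⟩, ?_⟩
  · rw [hπR]
    field_simp
    ring
  · rw [hπR]
    field_simp
    ring
  · have e1 : |-(4 - 3 * γ) * X - 2 * Y + R| ≤ 3 * s := by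
      refine (abs_add_le _ _).trans ?_
      have := abs_sub (-(4 - 3 * γ) * X) (2 * Y)
      rw [abs_mul, abs_mul, abs_neg, abs_of_pos hd, abs_of_pos (show (0 : ℝ) < 2 by norm_num)]
        at this
      nlinarith
    refine (abs_add_le _ _).trans ?_
    rw [abs_mul]
    have := mul_le_mul hX e1 (abs_nonneg _) hε0.le
    linarith
  · have e1 : |(4 - 3 * γ) * X + 2 * (γ - 1) * Y - (γ - 1) * R| ≤ 3 * s := by
      refine (abs_sub _ _).trans ?_
      have := abs_add_le ((4 - 3 * γ) * X) (2 * (γ - 1) * Y)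
      rw [abs_mul, abs_mul, abs_of_pos hd, abs_of_pos (show 0 < 2 * (γ - 1) by linarith)]
        at this
      rw [abs_mul, abs_of_pos hg]
      nlinarith [abs_nonneg R]
    refine (abs_add_le _ _).trans ?_
    rw [abs_neg, abs_mul, abs_mul, abs_of_pos hg]
    have := mul_le_mul hY e1 (abs_nonneg _) hε0.le
    nlinarith [abs_nonneg R]
  · have e1 : |R - 2 * Y| ≤ 3 * ε := by
      refine (abs_sub _ _).trans ?_
      rw [abs_mul, abs_of_pos (show (0 : ℝ) < 2 by norm_num)]
      nlinarith
    have e2 : 2 / (2 - γ) + 2 * ((4 - 3 * γ) / (2 - γ)) * X - (γ + 1) * π =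
        (2 + 2 * (4 - 3 * γ) * X - (γ + 1) * (R - 2 * Y)) / (2 - γ) := by
      rw [hπR]
      field_simp
    rw [e2]
    refine div_nonneg ?_ hk.le
    have e3 := (abs_le.1 hX).1
    have e4 := (abs_le.1 e1).2
    nlinarith

/-- Backward in time, two functions that cannot decrease as long as they are small stay small. -/
lemma forall_lt_of_deriv_nonneg {f g f' g' : ℝ → ℝ} {a b p q : ℝ}
    (hf : ∀ t ∈ Icc a b, HasDerivAt f (f' t) t) (hg : ∀ t ∈ Icc a b, HasDerivAt g (g' t) t)
    (h : ∀ t ∈ Icc a b, f t < p → g t < q → 0 ≤ f' t ∧ 0 ≤ g' t) (hfb : f b < p) (hgb : g b < q) :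
    ∀ t ∈ Icc a b, f t < p := by
  by_contra! hne
  obtain ⟨t₁, ht₁, hft₁⟩ := hne
  have hfc : ContinuousOn f (Icc a b) := fun t ht => (hf t ht).continuousAt.continuousWithinAt
  have hgc : ContinuousOn g (Icc a b) := fun t ht => (hg t ht).continuousAt.continuousWithinAt
  -- At the last time at which one of the thresholds is violated, both functions are non-decreasing
  -- from there to b. Their values at that time are thus below those at b, which satisfy the strict
  -- bounds.
  have hcomp : IsCompact (Icc a b ∩ f ⁻¹' Ici p ∪ Icc a b ∩ g ⁻¹' Ici q) :=
    (isCompact_Icc.of_isClosed_subset (hfc.preimage_isClosed_of_isClosed isClosed_Icc isClosed_Ici)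
      inter_subset_left).union
    (isCompact_Icc.of_isClosed_subset (hgc.preimage_isClosed_of_isClosed isClosed_Icc isClosed_Ici)
      inter_subset_left)
  obtain ⟨t₀, ht₀, hmax⟩ := hcomp.exists_isGreatest ⟨t₁, Or.inl ⟨ht₁, hft₁⟩⟩
  have ht₀' : t₀ ∈ Icc a b := ht₀.elim (fun h => h.1) fun h => h.1
  have hlater : ∀ t ∈ Ioc t₀ b, f t < p ∧ g t < q := by
    intro t ht
    have htab : t ∈ Icc a b := ⟨ht₀'.1.trans ht.1.le, ht.2⟩
    constructor <;> by_contra! hle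
    · exact absurd (hmax (Or.inl ⟨htab, hle⟩)) (not_le.2 ht.1)
    · exact absurd (hmax (Or.inr ⟨htab, hle⟩)) (not_le.2 ht.1)
  have hsub : Icc t₀ b ⊆ Icc a b := Icc_subset_Icc_left ht₀'.1
  have hmono : ∀ {u u' : ℝ → ℝ}, (∀ t ∈ Icc a b, HasDerivAt u (u' t) t) →
      (∀ t ∈ Ioo t₀ b, 0 ≤ u' t) → u t₀ ≤ u b := by
    intro u u' hu hu'
    refine monotoneOn_of_deriv_nonneg (convex_Icc t₀ b)
      (fun t ht => (hu t (hsub ht)).continuousAt.continuousWithinAt)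
      (fun t ht => ?_) (fun t ht => ?_) ⟨le_rfl, ht₀'.2⟩ ⟨ht₀'.2, le_rfl⟩ ht₀'.2
    · rw [interior_Icc] at ht
      exact (hu t (hsub (Ioo_subset_Icc_self ht))).differentiableAt.differentiableWithinAt
    · rw [interior_Icc] at ht
      rw [(hu t (hsub (Ioo_subset_Icc_self ht))).deriv]
      exact hu' t ht
  have hnn : ∀ t ∈ Ioo t₀ b, 0 ≤ f' t ∧ 0 ≤ g' t := fun t ht =>
    h t (hsub (Ioo_subset_Icc_self ht)) (hlater t ⟨ht.1, ht.2.le⟩).1 (hlater t ⟨ht.1, ht.2.le⟩).2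
  have h3 := hmono hf fun t ht => (hnn t ht).1
  have h4 := hmono hg fun t ht => (hnn t ht).2
  rcases ht₀ with h5 | h5
  · exact absurd (h5.2.trans h3) (not_le.2 hfb)
  · exact absurd (h5.2.trans h4) (not_le.2 hgb)

lemma exists_exp_le (h2 : γ < 4 / 3) {ε : ℝ} (hε : 0 < ε) :
    ∃ L > 0, ∀ t ≤ -L, Real.exp (2 / (2 - γ) * t) ≤ ε := by
  have hk : 0 < 2 - γ := by linarith
  have h3 : Tendsto (fun t => Real.exp (2 / (2 - γ) * t)) atBot (𝓝 0) :=
    Real.tendsto_exp_atBot.comp (tendsto_id.const_mul_atBot (by positivity))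
  obtain ⟨l, hl⟩ := eventually_atBot.1 (h3.eventually (ge_mem_nhds hε))
  refine ⟨max (-l) 1, by positivity, fun t ht => hl t ?_⟩
  have := le_max_left (-l) 1
  linarith

/-- A Lyapunov function of the linearization at the far-field solution. -/
def lyap (γ x y : ℝ) : ℝ :=
  2 * (4 - 3 * γ) * (2 - γ) * (x ^ 2 + y ^ 2) + 4 * ((γ - 1) * x + y) ^ 2 +
    (4 - 3 * γ) ^ 2 * (x + y) ^ 2

/-- The first partial derivative of the Lyapunov function. -/
def lyapN (γ x y : ℝ) : ℝ :=
  4 * ((4 - 3 * γ) * (2 - γ) * x) + 8 * ((γ - 1) * ((γ - 1) * x + y)) +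
    2 * ((4 - 3 * γ) ^ 2 * (x + y))

/-- The second partial derivative of the Lyapunov function. -/
def lyapD (γ x y : ℝ) : ℝ :=
  4 * ((4 - 3 * γ) * (2 - γ) * y) + 8 * ((γ - 1) * x + y) + 2 * ((4 - 3 * γ) ^ 2 * (x + y))

lemma hasDerivAt_lyap {x y : ℝ → ℝ} {x' y' t : ℝ} (hx : HasDerivAt x x' t)
    (hy : HasDerivAt y y' t) : HasDerivAt (fun t => lyap γ (x t) (y t))
      (lyapN γ (x t) (y t) * x' + lyapD γ (x t) (y t) * y') t := by
  have h1 := (((hx.fun_pow 2).fun_add (hy.fun_pow 2)).const_mul (2 * (4 - 3 * γ) * (2 - γ)))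
  have h2 := (((hx.const_mul (γ - 1)).fun_add hy).fun_pow 2).const_mul 4
  have h3 := ((hx.fun_add hy).fun_pow 2).const_mul ((4 - 3 * γ) ^ 2)
  refine ((h1.fun_add h2).fun_add h3).congr_deriv ?_
  simp only [lyapN, lyapD]
  push_cast
  ring

lemma abs_lyap_partial_le (h1 : 1 < γ) (h2 : γ < 4 / 3) (x y : ℝ) :
    |lyapN γ x y| ≤ 14 * (|x| + |y|) ∧ |lyapD γ x y| ≤ 14 * (|x| + |y|) := by
  have hk : 0 < 2 - γ := by linarith
  have hd : 0 < 4 - 3 * γ := by linarith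
  have hxs : |x| ≤ |x| + |y| := by linarith [abs_nonneg y]
  have hys : |y| ≤ |x| + |y| := by linarith [abs_nonneg x]
  have hxy : |x + y| ≤ |x| + |y| := abs_add_le x y
  have hgxy : |(γ - 1) * x + y| ≤ |x| + |y| := by
    refine (abs_add_le _ _).trans ?_
    rw [abs_mul, abs_of_pos (show 0 < γ - 1 by linarith)]
    nlinarith [abs_nonneg x]
  generalize |x| + |y| = s at *
  have hmul : ∀ {c w : ℝ}, 0 < c → c ≤ 1 → |w| ≤ s → |c * w| ≤ s := fun {c w} hc hc' hw => by
    rw [abs_mul, abs_of_pos hc]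
    nlinarith [abs_nonneg w]
  have hdk : (4 - 3 * γ) * (2 - γ) ≤ 1 := by nlinarith
  have hd2 : (4 - 3 * γ) ^ 2 ≤ 1 := by nlinarith
  have a1 := abs_le.1 (hmul (by positivity) hdk hxs)
  have a2 := abs_le.1 (hmul (by positivity) hdk hys)
  have a3 := abs_le.1 (hmul (by positivity) hd2 hxy)
  have a4 := abs_le.1 (hmul (show 0 < γ - 1 by linarith) (by linarith) hgxy)
  have a5 := abs_le.1 hgxy
  rw [abs_le, abs_le, lyapN, lyapD]
  refine ⟨⟨?_, ?_⟩, ?_, ?_⟩ <;> linarith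

lemma le_lyap (x y : ℝ) :
    2 * (4 - 3 * γ) * (2 - γ) * (x ^ 2 + y ^ 2) ≤ lyap γ x y := by
  have : 0 ≤ 4 * ((γ - 1) * x + y) ^ 2 := by positivity
  have : 0 ≤ (4 - 3 * γ) ^ 2 * (x + y) ^ 2 := by positivity
  rw [lyap]
  linarith

lemma lyap_le (h1 : 1 < γ) (h2 : γ < 4 / 3) {x y η : ℝ} (hx : |x| ≤ η) (hy : |y| ≤ η) :
    lyap γ x y ≤ 24 * η ^ 2 := by
  have hk : 0 < 2 - γ := by linarith
  have hd : 0 < 4 - 3 * γ := by linarith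
  have hx : x ^ 2 ≤ η ^ 2 := sq_le_sq' (abs_le.1 hx).1 (abs_le.1 hx).2
  have hy : y ^ 2 ≤ η ^ 2 := sq_le_sq' (abs_le.1 hy).1 (abs_le.1 hy).2
  have hdk : (4 - 3 * γ) * (2 - γ) ≤ 1 := by nlinarith
  have hdk0 : 0 < (4 - 3 * γ) * (2 - γ) := by positivity
  have e1 : (4 - 3 * γ) * (2 - γ) * (x ^ 2 + y ^ 2) ≤ 1 * (2 * η ^ 2) :=
    mul_le_mul hdk (by linarith) (by positivity) one_pos.le
  have e2 : ((γ - 1) * x + y) ^ 2 ≤ 4 * η ^ 2 := by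
    have h3 : ((γ - 1) * x) ^ 2 ≤ x ^ 2 := by
      rw [mul_pow]
      have : (γ - 1) ^ 2 ≤ 1 := by nlinarith
      nlinarith [sq_nonneg x]
    linarith [sq_nonneg ((γ - 1) * x - y), add_sq ((γ - 1) * x) y, sub_sq ((γ - 1) * x) y]
  have e3 : (4 - 3 * γ) ^ 2 * (x + y) ^ 2 ≤ 1 * (4 * η ^ 2) :=
    mul_le_mul (by nlinarith) (by linarith [sq_nonneg (x - y), add_sq x y, sub_sq x y])
      (sq_nonneg _) one_pos.le
  rw [lyap]
  linarith

/-- Let A be the matrix of the linearization times (2-γ). Then `lyap` is det A |z|² + |adj(A) z|².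
As adj(A) A = det A and A + adj(A) = tr A, its derivative along A is 2 det A tr A |z|² =
4(4-3γ)(2-γ)(5γ-6)|z|². The errors contribute at most 2 · 14 · 7 ε (|x| + |y|)² ≤ 392 ε |z|². -/
lemma lyap_deriv_nonneg (h1 : 1 < γ) (h2 : γ < 4 / 3) {x y e₁ e₂ ε : ℝ} (hε : 0 ≤ ε)
    (hε2 : 392 * ε ≤ 4 * (4 - 3 * γ) * (2 - γ) * (5 * γ - 6))
    (hb₁ : |e₁| ≤ 7 * ε * (|x| + |y|)) (hb₂ : |e₂| ≤ 7 * ε * (|x| + |y|)) :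
    0 ≤ lyapN γ x y * ((-(4 - 3 * γ) * x - 2 * y + e₁) / (2 - γ)) +
      lyapD γ x y * (((4 - 3 * γ) * x + 2 * (γ - 1) * y + e₂) / (2 - γ)) := by
  have hk : 0 < 2 - γ := by linarith
  obtain ⟨hu, hv⟩ := abs_lyap_partial_le h1 h2 x y
  have hss : (|x| + |y|) ^ 2 ≤ 2 * (x ^ 2 + y ^ 2) := by
    rw [← sq_abs x, ← sq_abs y]
    linarith [sq_nonneg (|x| - |y|), add_sq |x| |y|, sub_sq |x| |y|]
  have hs0 : 0 ≤ |x| + |y| := by positivity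
  generalize |x| + |y| = s at *
  have h5 : |lyapN γ x y * e₁| ≤ 14 * s * (7 * ε * s) := by
    rw [abs_mul]
    exact mul_le_mul hu hb₁ (abs_nonneg _) (by positivity)
  have h6 : |lyapD γ x y * e₂| ≤ 14 * s * (7 * ε * s) := by
    rw [abs_mul]
    exact mul_le_mul hv hb₂ (abs_nonneg _) (by positivity)
  have h7 : 392 * ε * (x ^ 2 + y ^ 2) ≤
      4 * (4 - 3 * γ) * (2 - γ) * (5 * γ - 6) * (x ^ 2 + y ^ 2) :=
    mul_le_mul_of_nonneg_right hε2 (by positivity)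
  have h8 : 196 * ε * s ^ 2 ≤ 196 * ε * (2 * (x ^ 2 + y ^ 2)) :=
    mul_le_mul_of_nonneg_left hss (by positivity)
  have h9 : 0 ≤ 4 * (4 - 3 * γ) * (2 - γ) * (5 * γ - 6) * (x ^ 2 + y ^ 2) + lyapN γ x y * e₁ +
      lyapD γ x y * e₂ := by
    linarith [(abs_le.1 h5).1, (abs_le.1 h6).1]
  refine (div_nonneg h9 hk.le).trans_eq ?_
  rw [lyapN, lyapD]
  field_simp
  ring

/-- If the far-field solution is stable backward in time, then the solutions that emanate from sonic
points near the far-field one do not all reach the Friedman velocity. -/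
theorem not_forall_isFirstCrossing_of_stable (h1 : 1 < γ) (h2 : γ < 4 / 3) (h3 : 6 / 5 < γ)
    {τ T : ℝ → ℝ} {X : ℝ → ℝ → ℝ × ℝ × ℝ} :
    ¬ ∀ n ∈ openRange γ, IsFirstCrossing γ n (τ n) (T n) (X n) := by
  intro hX
  have hk : 0 < 2 - γ := by linarith
  have hd : 0 < 4 - 3 * γ := by linarith
  obtain ⟨ε, hε, hε1, hε2⟩ : ∃ ε > 0, ε ≤ 1 / 16 ∧
      392 * ε ≤ 4 * (4 - 3 * γ) * (2 - γ) * (5 * γ - 6) := by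
    have : 0 < 4 * (4 - 3 * γ) * (2 - γ) * (5 * γ - 6) :=
      mul_pos (by positivity) (by linarith)
    refine ⟨min (1 / 16) (4 * (4 - 3 * γ) * (2 - γ) * (5 * γ - 6) / 392), by positivity,
      min_le_left _ _, ?_⟩
    have := min_le_right (1 / 16) (4 * (4 - 3 * γ) * (2 - γ) * (5 * γ - 6) / 392)
    linarith
  -- With d = (4-3γ)(2-γ) ≤ 1, the initial bound 24η² equals (3/2)d²ε², which is below the level
  -- 2dε² that confines both deviations to size ε.
  set η := ε * (4 - 3 * γ) * (2 - γ) / 4 with hη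
  have hη0 : 0 < η := by positivity
  have hηε : η ≤ ε / 4 := by
    rw [hη]
    have : (4 - 3 * γ) * (2 - γ) ≤ 1 := by nlinarith
    nlinarith
  obtain ⟨L, hL, hexp⟩ := exists_exp_le h2 (show 0 < ε / 2 by linarith)
  obtain ⟨n, hn, hT, hnear⟩ := exists_near_farField h1 h2 hX hη0 (show -L - 1 < 0 by linarith)
  have hXn := hX n hn
  have hmem : ∀ t ∈ Icc (T n) (-L), t ∈ Ioo (τ n) 0 := fun t ht =>
    ⟨hXn.lt.trans_le ht.1, ht.2.trans_lt (by linarith)⟩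
  obtain ⟨b1, b2, b3⟩ := hnear (-L) ⟨by linarith, by linarith⟩
  have hm : mach (X n (-L)) < ε := by
    have := hexp (-L) le_rfl
    linarith [(abs_le.1 b3).2]
  have hc : 0 < 2 * (4 - 3 * γ) * (2 - γ) := by positivity
  have hsmall : ∀ x y, lyap γ x y < 2 * (4 - 3 * γ) * (2 - γ) * ε ^ 2 → |x| ≤ ε ∧ |y| ≤ ε := by
    intro x y ht
    have h4 : x ^ 2 + y ^ 2 < ε ^ 2 := lt_of_mul_lt_mul_left ((le_lyap x y).trans_lt ht) hc.le
    exact ⟨abs_le_of_sq_le_sq (by linarith [sq_nonneg y]) hε.le,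
      abs_le_of_sq_le_sq (by linarith [sq_nonneg x]) hε.le⟩
  have hQ0 : lyap γ (devN γ (X n (-L))) (devD γ (X n (-L))) <
      2 * (4 - 3 * γ) * (2 - γ) * ε ^ 2 := by
    refine (lyap_le h1 h2 b1 b2).trans_lt ?_
    have hdk : (4 - 3 * γ) * (2 - γ) ≤ 1 := by nlinarith
    have h5 : 24 * η ^ 2 = (3 / 2 * ((4 - 3 * γ) * (2 - γ))) * ((4 - 3 * γ) * (2 - γ) * ε ^ 2) := by
      rw [hη]
      ring
    have h6 : 0 < (4 - 3 * γ) * (2 - γ) * ε ^ 2 := by positivity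
    rw [h5]
    nlinarith
  have key := forall_lt_of_deriv_nonneg
    (f := fun t => lyap γ (devN γ (X n t)) (devD γ (X n t)))
    (fun t ht => hasDerivAt_lyap (hXn.traj.hasDerivAt_devN h2 (hmem t ht))
      (hXn.traj.hasDerivAt_devD h2 (hmem t ht)))
    (fun t ht => hXn.traj.hasDerivAt_mach h2 (hmem t ht)) (fun t ht hQt hmt => by
      obtain ⟨hx, hy⟩ := hsmall _ _ hQt
      have hsub := hXn.traj.subsonic t (hmem t ht)
      obtain ⟨⟨e₁, e₂, he₁, he₂, hb₁, hb₂⟩, hℓ⟩ :=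
        near_farField_estimates h1 h2 hsub hε1 hx hy hmt.le
      refine ⟨?_, mul_nonneg (mach_mem_Ioo hsub).1.le hℓ⟩
      rw [he₁, he₂]
      exact lyap_deriv_nonneg h1 h2 hε.le hε2 hb₁ hb₂) hQ0 hm (T n)
    ⟨le_rfl, hT.trans (by linarith)⟩
  -- At the crossing time the relative deviation of N equals 2/(4-3γ) > 2, far above ε.
  have h4 := (abs_le.1 (hsmall _ _ key).1).2
  rw [devN, hXn.eq] at h4
  have h5 : (2 - γ) * (3 / (4 - 3 * γ)) - 1 = 2 / (4 - 3 * γ) := by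
    rw [eq_div_iff hd.ne', sub_mul, mul_assoc, div_mul_cancel₀ _ hd.ne']
    ring
  rw [h5, div_le_iff₀ hd] at h4
  nlinarith

end NearFarField

/-! ### The rotating case γ ≤ 6/5. -/

section Rotation

variable {γ : ℝ}

/-- The right-hand side is (2-γ)(x y' - y x') for the linearization. After subtracting c(x² + y²),
four times the determinant of the form is 12c(γ-1) + 4c² ≥ 0, so the form stays non-negative. -/
lemma rotation_pos (h1 : 1 < γ) (h2 : γ < 4 / 3)
    (h0 : 0 ≤ (8 * (4 - 3 * γ) - (2 - γ) ^ 2) / 12) (x y : ℝ) :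
    (8 * (4 - 3 * γ) - (2 - γ) ^ 2) / 12 * (x ^ 2 + y ^ 2) ≤
      (4 - 3 * γ) * x ^ 2 + (2 - γ) * x * y + 2 * y ^ 2 := by
  set c := (8 * (4 - 3 * γ) - (2 - γ) ^ 2) / 12 with hc
  have hγ : 0 ≤ 3 * γ - 3 := by linarith
  have hA : 0 < 4 - 3 * γ - c := by
    rw [hc]
    nlinarith [sq_nonneg (2 - γ)]
  have hdisc : 0 ≤ 4 * (4 - 3 * γ - c) * (2 - c) - (2 - γ) ^ 2 := by
    have h3 : 4 * (4 - 3 * γ - c) * (2 - c) - (2 - γ) ^ 2 =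
        4 * c * (3 * γ - 3) + 4 * c ^ 2 := by
      have : (2 - γ) ^ 2 = 8 * (4 - 3 * γ) - 12 * c := by rw [hc]; ring
      rw [this]
      ring
    rw [h3]
    positivity
  have h3 : 0 ≤ 4 * (4 - 3 * γ - c) *
      ((4 - 3 * γ) * x ^ 2 + (2 - γ) * x * y + 2 * y ^ 2 - c * (x ^ 2 + y ^ 2)) := by
    calc 0 ≤ (2 * (4 - 3 * γ - c) * x + (2 - γ) * y) ^ 2 +
          (4 * (4 - 3 * γ - c) * (2 - c) - (2 - γ) ^ 2) * y ^ 2 := by positivity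
      _ = _ := by ring
  have := nonneg_of_mul_nonneg_right h3 (by linarith)
  linarith

/-- If the ratio of two functions rotates with angular velocity at least `c`, then the first one
vanishes on each interval of length more than `π / c`. -/
lemma exists_zero_of_rotation {x y x' y' : ℝ → ℝ} {a b c : ℝ} (hab : a ≤ b)
    (hx : ∀ t ∈ Icc a b, HasDerivAt x (x' t) t) (hy : ∀ t ∈ Icc a b, HasDerivAt y (y' t) t)
    (hrot : ∀ t ∈ Icc a b, c * (x t ^ 2 + y t ^ 2) ≤ x t * y' t - y t * x' t)
    (hlen : Real.pi ≤ c * (b - a)) : ∃ t ∈ Icc a b, x t = 0 := by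
  by_contra! hne
  -- Without a zero of x the angle arctan(y/x) is differentiable and grows by at least c(b - a) ≥ π,
  -- which the open range (-π/2, π/2) forbids.
  have hder : ∀ t ∈ Icc a b, HasDerivAt (fun t => Real.arctan (y t / x t) - c * t)
      (1 / (1 + (y t / x t) ^ 2) * ((y' t * x t - y t * x' t) / x t ^ 2) - c * 1) t := fun t ht =>
    (((hy t ht).fun_div (hx t ht) (hne t ht)).arctan).sub ((hasDerivAt_id t).const_mul c)
  have hmono := monotoneOn_of_deriv_nonneg (convex_Icc a b)
      (fun t ht => (hder t ht).continuousAt.continuousWithinAt)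
      (fun t ht => (hder t (interior_subset ht)).differentiableAt.differentiableWithinAt)
      (fun t ht => by
        have ht' := interior_subset ht
        rw [(hder t ht').deriv]
        have h0 := hne t ht'
        have h3 := hrot t ht'
        have h4 : 0 < x t ^ 2 + y t ^ 2 := by positivity
        have h5 : 1 / (1 + (y t / x t) ^ 2) * ((y' t * x t - y t * x' t) / x t ^ 2) =
            (x t * y' t - y t * x' t) / (x t ^ 2 + y t ^ 2) := by
          field_simp
        rw [h5, mul_one, sub_nonneg, le_div_iff₀ h4]
        exact h3) ⟨le_rfl, hab⟩ ⟨hab, le_rfl⟩ hab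
  have h6 := Real.arctan_lt_pi_div_two (y b / x b)
  have h7 := Real.neg_pi_div_two_lt_arctan (y a / x a)
  simp only at hmono
  linarith

/-- If the far-field solution is a focus or a centre, or unstable, then the solutions that emanate
from sonic points near the far-field one do not all reach the Friedman velocity. -/
theorem not_forall_isFirstCrossing_of_rotation (h1 : 1 < γ) (h2 : γ < 4 / 3) (h3 : γ ≤ 6 / 5)
    {τ T : ℝ → ℝ} {X : ℝ → ℝ → ℝ × ℝ × ℝ} :
    ¬ ∀ n ∈ openRange γ, IsFirstCrossing γ n (τ n) (T n) (X n) := by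
  intro hX
  have hk : 0 < 2 - γ := by linarith
  have hk1 : 2 - γ < 1 := by linarith
  have hd : 0 < 4 - 3 * γ := by linarith
  obtain ⟨hfin, hcard⟩ := finite_crossings_and_ncard_eq h1 h2 hX
  obtain ⟨n₀, hn₀⟩ : (openRange γ).Nonempty := nonempty_Ioo.2 (farField_lt_friedman h1 h2)
  set K := {t | t ∈ Ioo (T n₀) 0 ∧ (X n₀ t).1 - 1 / (2 - γ) = 0}.ncard with hK
  set c := (8 * (4 - 3 * γ) - (2 - γ) ^ 2) / 12 with hc
  -- 12c = 28 - 20γ - γ² is positive for γ ≤ 6/5.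
  have hc0 : 0 < c := by
    rw [hc]
    nlinarith
  -- The error terms x e₂ - y e₁ cost at most 14ε(x² + y²), half of c. A rotation speed of c/2
  -- remains, since division by 2 - γ < 1 only helps.
  set ε := min (1 / 16) (c / 28) with hε
  have hε0 : 0 < ε := by positivity
  have hεc : 14 * ε ≤ c / 2 := by
    have := min_le_right (1 / 16) (c / 28)
    rw [← hε] at this
    linarith
  obtain ⟨L, hL, hexp⟩ := exists_exp_le h2 (half_pos hε0)
  set ℓ := Real.pi / (c / 2) with hℓ
  have hℓ0 : 0 < ℓ := by positivity
  obtain ⟨n, hn, hT, hnear⟩ := exists_near_farField h1 h2 hX (half_pos hε0)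
    (show -(L + (K + 1) * (ℓ + 1)) - 1 < 0 by
      have : 0 < L + (K + 1) * (ℓ + 1) := by positivity
      linarith)
  have hXn := hX n hn
  -- Each window has length ℓ, the time of a half turn at speed c/2, and neighbouring windows are
  -- separated by 1. The K + 1 windows give one zero more than the constant count K permits.
  have hzero : ∀ i : Fin (K + 1), ∃ t ∈ Icc (-(L + i * (ℓ + 1)) - ℓ) (-(L + i * (ℓ + 1))),
      t ∈ {t | t ∈ Ioo (T n) 0 ∧ (X n t).1 - 1 / (2 - γ) = 0} := by
    intro i
    have hi : (i : ℝ) + 1 ≤ K + 1 := by exact_mod_cast i.2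
    have hi' : ((i : ℝ) + 1) * (ℓ + 1) ≤ (K + 1) * (ℓ + 1) :=
      mul_le_mul_of_nonneg_right hi (by positivity)
    have hi0 : 0 ≤ (i : ℝ) * (ℓ + 1) := by positivity
    have hsub : ∀ t ∈ Icc (-(L + i * (ℓ + 1)) - ℓ) (-(L + i * (ℓ + 1))),
        t ∈ Ioo (-(L + (K + 1) * (ℓ + 1)) - 1) 0 ∧ t ≤ -L := fun t ht =>
      ⟨⟨by linarith [ht.1], by linarith [ht.2]⟩, by linarith [ht.2]⟩
    have hmem : ∀ t ∈ Icc (-(L + i * (ℓ + 1)) - ℓ) (-(L + i * (ℓ + 1))), t ∈ Ioo (τ n) 0 :=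
      fun t ht => ⟨hXn.lt.trans (hT.trans_lt (hsub t ht).1.1), (hsub t ht).1.2⟩
    obtain ⟨t, ht, ht0⟩ := exists_zero_of_rotation (x := fun t => devN γ (X n t))
      (y := fun t => devD γ (X n t)) (c := c / 2) (by linarith)
      (fun t ht => hXn.traj.hasDerivAt_devN h2 (hmem t ht))
      (fun t ht => hXn.traj.hasDerivAt_devD h2 (hmem t ht)) (fun t ht => by
        obtain ⟨b1, b2, b3⟩ := hnear t (hsub t ht).1
        have hm : mach (X n t) ≤ ε := by
          have := hexp t (hsub t ht).2
          linarith [(abs_le.1 b3).2]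
        obtain ⟨⟨e₁, e₂, he₁, he₂, hb₁, hb₂⟩, -⟩ := near_farField_estimates h1 h2
          (hXn.traj.subsonic t (hmem t ht)) (min_le_left _ _) (b1.trans (half_le_self hε0.le))
          (b2.trans (half_le_self hε0.le)) hm
        rw [he₁, he₂]
        generalize devN γ (X n t) = x at *
        generalize devD γ (X n t) = y at *
        have hss : (|x| + |y|) ^ 2 ≤ 2 * (x ^ 2 + y ^ 2) := by
          rw [← sq_abs x, ← sq_abs y]
          linarith [sq_nonneg (|x| - |y|), add_sq |x| |y|, sub_sq |x| |y|]
        have h4 : |x * e₂| ≤ |x| * (7 * ε * (|x| + |y|)) := by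
          rw [abs_mul]
          exact mul_le_mul_of_nonneg_left hb₂ (abs_nonneg _)
        have h5 : |y * e₁| ≤ |y| * (7 * ε * (|x| + |y|)) := by
          rw [abs_mul]
          exact mul_le_mul_of_nonneg_left hb₁ (abs_nonneg _)
        have h6 : 7 * ε * (|x| + |y|) ^ 2 ≤ 7 * ε * (2 * (x ^ 2 + y ^ 2)) :=
          mul_le_mul_of_nonneg_left hss (by positivity)
        have h7 := rotation_pos h1 h2 hc0.le x y
        rw [← hc] at h7
        have h8 : 14 * ε * (x ^ 2 + y ^ 2) ≤ c / 2 * (x ^ 2 + y ^ 2) :=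
          mul_le_mul_of_nonneg_right hεc (by positivity)
        have h9 : x * (((4 - 3 * γ) * x + 2 * (γ - 1) * y + e₂) / (2 - γ)) -
            y * ((-(4 - 3 * γ) * x - 2 * y + e₁) / (2 - γ)) =
            ((4 - 3 * γ) * x ^ 2 + (2 - γ) * x * y + 2 * y ^ 2 + x * e₂ - y * e₁) / (2 - γ) := by
          ring
        rw [h9, le_div_iff₀ hk]
        have h10 : 0 ≤ c / 2 * (x ^ 2 + y ^ 2) := by positivity
        have h11 : c / 2 * (x ^ 2 + y ^ 2) * (2 - γ) ≤ c / 2 * (x ^ 2 + y ^ 2) := by nlinarith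
        linarith [(abs_le.1 h4).1, (abs_le.1 h5).2]) (by
          rw [hℓ]
          field_simp
          linarith)
    refine ⟨t, ht, ⟨hT.trans_lt (hsub t ht).1.1, (hsub t ht).1.2⟩, ?_⟩
    simp only [devN] at ht0
    rw [sub_eq_zero, eq_div_iff hk.ne']
    linarith
  choose f hf hfz using hzero
  have hinj : Function.Injective f := by
    intro i j hij
    by_contra hne
    wlog hlt : i < j generalizing i j
    · exact this hij.symm (Ne.symm hne) (lt_of_le_of_ne (not_lt.1 hlt) (Ne.symm hne))
    have h4 : (i : ℝ) + 1 ≤ j := by exact_mod_cast hlt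
    have h5 : ((i : ℝ) + 1) * (ℓ + 1) ≤ j * (ℓ + 1) :=
      mul_le_mul_of_nonneg_right h4 (by positivity)
    have h6 := (hf i).1
    have h7 := (hf j).2
    rw [hij] at h6
    linarith
  have h4 : (range f).ncard ≤ K := by
    exact (ncard_le_ncard (range_subset_iff.2 hfz) (hfin n hn)).trans_eq (hcard n hn n₀ hn₀)
  rw [← image_univ, ncard_image_of_injective _ hinj, ncard_univ, Nat.card_fin] at h4
  omega

end Rotation

/-! ### Conclusion. -/

section Main

variable {γ : ℝ}

/-- The critical sonic point is not the sonic point of the far-field solution. -/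
theorem yBar_ne_yf (h1 : 1 < γ) (h2 : γ < 4 / 3) : yBar γ ≠ yf γ := by
  intro heq
  have hcross : ∀ n ∈ openRange γ, ∃ τ T X, IsFirstCrossing γ n τ T X := by
    intro n hn
    have hnr := openRange_subset hn
    refine exists_isFirstCrossing h1 h2 hnr ?_
    have h3 : yBar γ < sonicPos γ n := by
      rw [heq, ← sonicPos_farField h1 h2, sonicPos_lt_iff h1 h2 (farField_mem_sonicRange h1 h2) hnr]
      exact hn.1
    -- The infimum need not be attained, but some element of Y lies below the given sonic point, and
    -- membership in Y covers everything from there up to y_F.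
    obtain ⟨z, hz, hzn⟩ := exists_lt_of_csInf_lt (fundamentalSet_nonempty h1 h2) h3
    refine hz.2 _ ⟨hzn.le, ?_⟩
    rw [← sonicPos_friedman h1 h2, sonicPos_lt_iff h1 h2 hnr (friedman_mem_sonicRange h1 h2)]
    exact hn.2
  choose! τ T X hX using hcross
  rcases le_or_gt γ (6 / 5) with h3 | h3
  · exact not_forall_isFirstCrossing_of_rotation h1 h2 h3 hX
  · exact not_forall_isFirstCrossing_of_stable h1 h2 h3 hX

end Main

end EulerPoisson

end

theorem lemma4 (γ : ℝ) (hγ₁ : 1 < γ) (hγ₂ : γ < 4 / 3) :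
    (EulerPoisson.fundamentalSet γ).Nonempty ∧
    EulerPoisson.yBar γ ≠ EulerPoisson.yf γ ∧
    ∀ ρ ω : ℝ → ℝ, EulerPoisson.IsGlobalLPH γ (EulerPoisson.yBar γ) ρ ω →
      ¬ (∀ y : ℝ, 0 < y →
        ρ y = EulerPoisson.rhoFar γ y ∧ ω y = EulerPoisson.omegaFar γ y) := by
  have hne := EulerPoisson.fundamentalSet_nonempty hγ₁ hγ₂
  refine ⟨hne, EulerPoisson.yBar_ne_yf hγ₁ hγ₂, fun ρ ω H hfar => ?_⟩
  have hpos : 0 < EulerPoisson.yBar γ :=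
    (EulerPoisson.yf_pos hγ₁ hγ₂).trans_le (le_csInf hne fun _ hy => hy.1.1)
  -- The velocity at a sonic point determines its position, so the far-field velocity 2 - γ would
  -- place ȳ⋆ at y_f.
  have h3 := (EulerPoisson.sonic_unique hγ₁ hγ₂ hpos H.lph.rho_pos H.lph.sonic H.lph.regular).2.2
  rw [(hfar _ hpos).2, EulerPoisson.omegaFar, ← one_div,
    EulerPoisson.sonicPos_farField hγ₁ hγ₂] at h3
  exact EulerPoisson.yBar_ne_yf hγ₁ hγ₂ h3
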